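/- **Setting.** Let $\mathcal X$ be a finite set, $\mathbf L$ a symmetric real $\mathcal X\times\mathcal X$ matrix with $L_{x,y}\ge 0$ for $x\ne y$ and $\mathbf L\mathbf 1=\mathbf 0$, and $\pi$ a probability distribution on $\mathcal X$ with $\pi(x)>0$ for all $x$ and $\pi^\top\mathbf L=\mathbf 0^\top$. Put $\mathcal E(f,g)=\mathbb E_\pi[\Gamma(f,g)]$ with $\Gamma(f,g)=\frac12(\mathbf L(fg)-f\mathbf Lg-g\mathbf Lf)$, and $\overline{\mathcal E}(f,g)=\mathcal E(f,g)/\mathbb E_\pi[fg]$. On $\mathcal X^n$ let $\mathcal E_n,\overline{\mathcal E}_n$ be the same forms for $\pi^n$ and the generator $\mathbf L^{\oplus n}$, which is the sum over $k$ of $\mathbf L$ acting on the $k$-th coordinate. All functions $f$ below are nonnegative and not identically zero, except in $\Xi_0$. For such $f$ let $$J_q(f)=\tfrac1{q-1}\overline{\mathcal E}(f,f^{q-1})\ (q\neq1),\qquad J_1(f)=\mathcal E(f,\ln f)/\mathbb E_\pi[f],$$ where for $q\le 1$ the value is $+\infty$ if $L_{x,y}>0$ for some $x,y$ with $f(x)=0<f(y)$,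 and otherwise the zeros of $f$ contribute nothing; $J_q^{(n)}$ is the same quantity for $(\mathbf L^{\oplus n},\pi^n)$. Let $\overline{\operatorname{Ent}}(f)=\big(\mathbb E_\pi[f\ln f]-\mathbb E_\pi[f]\ln\mathbb E_\pi[f]\big)/\mathbb E_\pi[f]$ and $\|f\|_p=(\mathbb E_\pi[f^p])^{1/p}$. For $p,q>0$ let $\operatorname{Ent}_{p,q}(f)=\frac{pq}{p-q}\ln\frac{\|f\|_p}{\|f\|_q}$ if $p\ne q$ and $\operatorname{Ent}_{q,q}(f)=\overline{\operatorname{Ent}}(f^q)$; if $p=0$ or $q=0$ let $\operatorname{Ent}_{p,q}(f)=-\ln\pi(f>0)$; on $\mathcal X^n$ use $\pi^n$. Define, for real $\alpha$ and with $\inf\emptyset=+\infty$, $$\Xi_q(\alpha)=\inf_{f:\ \overline{\operatorname{Ent}}(f^q)\ge\alpha}J_q(f)\ \ (q>0),\qquad \Xi_0(\alpha)=\inf_{f>0:\ \frac12\operatorname{Var}_\pi(\ln f)\ge\alpha}J_0(f),$$ $$\Xi^{(n)}_{p,q}(\alpha)=\inf_{f:\mathcal X^n\to[0,\infty),\ \frac1n\operatorname{Ent}_{p,q}(f)\ge\alpha}\tfrac1nJ^{(n)}_q(f).$$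 Let $\operatorname{conv}\Xi_q$ be the lower convex envelope (greatest convex minorant) of $\Xi_q$, and put $\phi_{p,q}=\operatorname{conv}\Xi_q$ if $p\le q$ and $\phi_{p,q}=0$ if $p>q$. For a distribution $Q$ on $\mathcal X$ and $\epsilon>0$ let $\mathcal T^{(n)}_\epsilon(Q)=\{x^n:|T_{x^n}(a)-Q(a)|\le\epsilon Q(a)\ \forall a\in\mathcal X\}$, where $T_{x^n}$ is the empirical measure of $x^n$ (for $n=0$ the empty sequence is counted as typical), and let $Q^n(\cdot\mid\mathcal T^{(n)}_\epsilon(Q))$ be $Q^n$ conditioned on this set. For distributions $Q,R$, $\lambda\in[0,1]$ and $k=\lfloor\lambda n\rfloor$, let $$f_{n}(x^n)=\left(\frac{Q^k(x^k\mid\mathcal T^{(k)}_\epsilon(Q))}{\pi^k(x^k)}\times\frac{R^{n-k}(x_{k+1}^n\mid\mathcal T^{(n-k)}_\epsilon(R))}{\pi^{n-k}(x_{k+1}^n)}\right)^{1/q}.$$ **Theorem (Rényi–Sobolev inequalities).** 1. For all real $p,q\ge0$, all $n\ge1$ and all $\alpha$, $\ \Xi^{(n)}_{p,q}(\alpha)\ge\phi_{p,q}(\alpha)$.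 2. For all $p\ge0$, $q\ge1$ with $(p,q)\ne(0,1)$ and all $\alpha\in[0,-\ln\min_x\pi(x))$, $\ \lim_{n\to\infty}\Xi^{(n)}_{p,q}(\alpha)=\phi_{p,q}(\alpha)$. 3. Let $q>1$, $0\le p\le q$ and $\alpha\in[0,-\ln\min_x\pi(x))$. (a) For every $\delta>0$ there are distributions $Q,R$, a number $\lambda\in[0,1]$ and $\epsilon_0>0$ such that for every $\epsilon\in(0,\epsilon_0)$: for all sufficiently large $n$, $f_n$ is not identically zero and $\frac1n\operatorname{Ent}_{p,q}(f_n)\ge\alpha$; and $\lim_{n\to\infty}\frac1{(q-1)n}\overline{\mathcal E}_n(f_n,f_n^{q-1})$ exists and is at most $\operatorname{conv}\Xi_q(\alpha)+\delta$. (b) There are distributions $Q,R$ and $\lambda\in[0,1]$ such that for every $\delta>0$ there is $\epsilon_0>0$ such that for every $\epsilon\in(0,\epsilon_0)$: for all sufficiently large $n$, $f_n$ is not identically zero and $\frac1n\operatorname{Ent}_{p,q}(f_n)\ge\alpha-\delta$; and $\lim_{n\to\infty}\frac1{(q-1)n}\overline{\mathcal E}_n(f_n,f_n^{q-1})=\operatorname{conv}\Xi_q(\alpha)$.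 -/

import Mathlib

open Filter Topology

noncomputable section

namespace RenyiSobolev

section OneSpace

variable {Ω : Type*} [Fintype Ω]

/-- The expectation of `f` under the distribution `π` on a finite set. -/
def mean (π f : Ω → ℝ) : ℝ := ∑ x, π x * f x

/-- The carré du champ operator of a generator `L`. -/
def carreDuChamp (L : Matrix Ω Ω ℝ) (f g : Ω → ℝ) (x : Ω) : ℝ :=
  (1 / 2) * (L.mulVec (f * g) x - f x * L.mulVec g x - g x * L.mulVec f x)

/-- The Dirichlet form of `(L, π)`. -/
def dirichlet (L : Matrix Ω Ω ℝ) (π f g : Ω → ℝ) : ℝ := mean π (carreDuChamp L f g)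

/-- The normalized Dirichlet form of `(L, π)`. -/
def normDirichlet (L : Matrix Ω Ω ℝ) (π f g : Ω → ℝ) : ℝ :=
  dirichlet L π f g / mean π (f * g)

/-- `‖f‖_p = (E f ^ p) ^ (1 / p)`, for `p > 0` and nonnegative `f`. -/
def pNorm (π : Ω → ℝ) (p : ℝ) (f : Ω → ℝ) : ℝ := mean π (fun x => f x ^ p) ^ (1 / p)

/-- The entropy `E[f ln f] - E[f] ln E[f]` of a nonnegative function. -/
def ent (π f : Ω → ℝ) : ℝ :=
  mean π (fun x => f x * Real.log (f x)) - mean π f * Real.log (mean π f)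

/-- The normalized entropy. -/
def normEnt (π f : Ω → ℝ) : ℝ := ent π f / mean π f

/-- The variance under `π`. -/
def variance (π f : Ω → ℝ) : ℝ := mean π (fun x => (f x - mean π f) ^ 2)

open scoped Classical in
/-- The two-parameter entropy of a nonnegative, nonzero function, for finite orders `p, q ≥ 0`. -/
def ent₂ (π : Ω → ℝ) (p q : ℝ) (f : Ω → ℝ) : ℝ :=
  if p = 0 ∨ q = 0 then -Real.log (∑ x with 0 < f x, π x)
  else if p = q then normEnt π (fun x => f x ^ q)
  else p * q / (p - q) * Real.log (pNorm π p f / pNorm π q f)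

/-- The functions over which the infima run: nonnegative and not identically zero. -/
def Admissible (f : Ω → ℝ) : Prop := (∀ x, 0 ≤ f x) ∧ f ≠ 0

open scoped Classical in
/-- `𝓔̄(f, f ^ (q - 1)) / (q - 1)`, and its continuous extension `𝓔(f, ln f) / E f` at `q = 1`,
for a nonnegative nonzero `f`. For `q ≤ 1` the second argument is infinite where `f` vanishes:
the value is `+∞` if some transition of positive rate joins a zero of `f` to a point where `f` is
positive, and otherwise the zeros of `f` do not contribute. -/
def energy (L : Matrix Ω Ω ℝ) (π : Ω → ℝ) (q : ℝ) (f : Ω → ℝ) : EReal :=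
  if q ≤ 1 ∧ ∃ x y, 0 < L x y ∧ f x = 0 ∧ 0 < f y then ⊤
  else if q = 1 then
    ((dirichlet L π f (fun x => Real.log (f x)) / mean π f : ℝ) : EReal)
  else ((1 / (q - 1) * normDirichlet L π f (fun x => f x ^ (q - 1)) : ℝ) : EReal)

/-- The log-Sobolev function `Ξ_q`. For `q = 0` the constraint is on half the variance of `ln f`,
and `f` is positive. -/
def logSobolev (L : Matrix Ω Ω ℝ) (π : Ω → ℝ) (q α : ℝ) : EReal :=
  if q = 0 then
    ⨅ f ∈ {f : Ω → ℝ | (∀ x, 0 < f x) ∧ α ≤ 1 / 2 * variance π (fun x => Real.log (f x))},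
      energy L π 0 f
  else
    ⨅ f ∈ {f : Ω → ℝ | Admissible f ∧ α ≤ normEnt π (fun x => f x ^ q)}, energy L π q f

end OneSpace

/-- The lower convex envelope (greatest convex minorant) of an extended-real function on `ℝ`;
convexity of an extended-real function means convexity of its epigraph. -/
def convEnvelope (g : ℝ → EReal) (α : ℝ) : EReal :=
  ⨆ h ∈ {h : ℝ → EReal | Convex ℝ {z : ℝ × ℝ | h z.1 ≤ (z.2 : EReal)} ∧ ∀ a, h a ≤ g a}, h α

section Product

variable {X : Type*} {ι : Type*} [Fintype ι]

/-- The product distribution `π^n` on sequences indexed by `ι`. -/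
def prodDist (π : X → ℝ) (x : ι → X) : ℝ := ∏ i, π (x i)

open scoped Classical in
/-- The generator `L^{⊕n}` of the product semigroup: `L` acts on one coordinate at a time. -/
def prodGen (L : Matrix X X ℝ) : Matrix (ι → X) (ι → X) ℝ :=
  Matrix.of fun x y => ∑ k, if ∀ j, j ≠ k → x j = y j then L (x k) (y k) else 0

open scoped Classical in
/-- The `ε`-typical set of `Q`: the sequences `x` with `|T_x(a) - Q(a)| ≤ ε Q(a)` for all `a`,
where `T_x` is the empirical measure. The inequality is multiplied by the length of `x`, so that
the empty sequence is typical. -/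
def typicalSet (Q : X → ℝ) (ε : ℝ) : Set (ι → X) :=
  {x | ∀ a, |((Finset.univ.filter fun i => x i = a).card : ℝ) - Fintype.card ι * Q a|
    ≤ ε * (Fintype.card ι * Q a)}

open scoped Classical in
/-- The product distribution `Q^n` conditioned on the `ε`-typical set of `Q`. -/
def condTypical [Fintype X] (Q : X → ℝ) (ε : ℝ) (x : ι → X) : ℝ :=
  if x ∈ typicalSet Q ε then
    prodDist Q x / ∑ y : ι → X with y ∈ typicalSet Q ε, prodDist Q y
  else 0

end Product

section RS

variable {X : Type*} [Fintype X]

/-- The `n`-dimensional Rényi–Sobolev function `Ξ_{p,q}^{(n)}`. -/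
def renyiSobolev (L : Matrix X X ℝ) (π : X → ℝ) (p q : ℝ) (n : ℕ) (α : ℝ) : EReal :=
  ⨅ f ∈ {f : (Fin n → X) → ℝ | Admissible f ∧ α ≤ 1 / n * ent₂ (prodDist π) p q f},
    ((1 / n : ℝ) : EReal) * energy (prodGen L) (prodDist π) q f

/-- The dimension-free bound `φ_{p,q}`. -/
def phi (L : Matrix X X ℝ) (π : X → ℝ) (p q α : ℝ) : EReal :=
  if p ≤ q then convEnvelope (logSobolev L π q) α else 0

/-- The function on `X^n` whose `q`-th power is the density with respect to `π^n` of the product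
of `Q^k` and `R^{n-k}`, both conditioned on their `ε`-typical sets, with `k = ⌊t n⌋`. -/
def extremal (π : X → ℝ) (q : ℝ) (Q R : X → ℝ) (t ε : ℝ) (n : ℕ) (x : Fin n → X) : ℝ :=
  let x₁ : {i : Fin n // (i : ℕ) < ⌊t * n⌋₊} → X := fun i => x i
  let x₂ : {i : Fin n // ¬ (i : ℕ) < ⌊t * n⌋₊} → X := fun i => x i
  (condTypical Q ε x₁ / prodDist π x₁ * (condTypical R ε x₂ / prodDist π x₂)) ^ (1 / q)

end RS

end RenyiSobolev

end

noncomputable section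

namespace RenyiSobolev

lemma admissible_rpow {Ω : Type*} {f : Ω → ℝ} (hf : Admissible f) (q : ℝ) :
    Admissible (fun x => f x ^ q) := by
  refine ⟨fun x => Real.rpow_nonneg (hf.1 x) q, ?_⟩
  obtain ⟨x, hx⟩ := Function.ne_iff.1 hf.2
  refine Function.ne_iff.2 ⟨x, ?_⟩
  exact (Real.rpow_pos_of_pos (lt_of_le_of_ne (hf.1 x) (Ne.symm hx)) q).ne'

section OneSpaceLemmas

variable {Ω : Type*} [Fintype Ω]

lemma mean_add (π f g : Ω → ℝ) : mean π (fun x => f x + g x) = mean π f + mean π g := by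
  simp [mean, mul_add, Finset.sum_add_distrib]

lemma mean_const_mul (π f : Ω → ℝ) (c : ℝ) : mean π (fun x => c * f x) = c * mean π f := by
  simp only [mean, Finset.mul_sum]
  exact Finset.sum_congr rfl fun x _ => by ring

lemma mean_nonneg {π f : Ω → ℝ} (hπ : ∀ x, 0 ≤ π x) (hf : ∀ x, 0 ≤ f x) : 0 ≤ mean π f :=
  Finset.sum_nonneg fun x _ => mul_nonneg (hπ x) (hf x)

lemma mean_mono {π f g : Ω → ℝ} (hπ : ∀ x, 0 ≤ π x) (h : ∀ x, f x ≤ g x) :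
    mean π f ≤ mean π g :=
  Finset.sum_le_sum fun x _ => mul_le_mul_of_nonneg_left (h x) (hπ x)

lemma mean_pos {π f : Ω → ℝ} (hπ : ∀ x, 0 < π x) (hf : Admissible f) : 0 < mean π f := by
  obtain ⟨x, hx⟩ := Function.ne_iff.1 hf.2
  exact Finset.sum_pos' (fun x _ => mul_nonneg (hπ x).le (hf.1 x))
    ⟨x, Finset.mem_univ _, mul_pos (hπ x) (lt_of_le_of_ne (hf.1 x) (Ne.symm hx))⟩

lemma dirichlet_eq {L : Matrix Ω Ω ℝ} (hrow : ∀ x, ∑ y, L x y = 0) (π f g : Ω → ℝ) :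
    dirichlet L π f g =
      1 / 2 * ∑ x, ∑ y, π x * (L x y * ((f y - f x) * (g y - g x))) := by
  have key : ∀ x, carreDuChamp L f g x = 1 / 2 * ∑ y, L x y * ((f y - f x) * (g y - g x)) := by
    intro x
    have h0 : f x * g x * ∑ y, L x y = 0 := by rw [hrow, mul_zero]
    have : ∑ y, L x y * ((f y - f x) * (g y - g x)) =
        L.mulVec (f * g) x - f x * L.mulVec g x - g x * L.mulVec f x
          + f x * g x * ∑ y, L x y := by
      simp only [Matrix.mulVec, dotProduct, Finset.mul_sum, ← Finset.sum_sub_distrib,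
        ← Finset.sum_add_distrib, Pi.mul_apply]
      exact Finset.sum_congr rfl fun y _ => by ring
    rw [this, h0, add_zero, carreDuChamp]
  simp only [dirichlet, mean, key, Finset.mul_sum]
  exact Finset.sum_congr rfl fun x _ => Finset.sum_congr rfl fun y _ => by ring

/-- The Dirichlet form is nonnegative on pairs of functions that are similarly ordered across
the transitions of positive rate. -/
lemma dirichlet_nonneg {L : Matrix Ω Ω ℝ} (hoff : ∀ x y, x ≠ y → 0 ≤ L x y)
    (hrow : ∀ x, ∑ y, L x y = 0) {π : Ω → ℝ} (hπ : ∀ x, 0 ≤ π x) {f g : Ω → ℝ}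
    (h : ∀ x y, 0 < L x y → 0 ≤ (f y - f x) * (g y - g x)) : 0 ≤ dirichlet L π f g := by
  rw [dirichlet_eq hrow]
  refine mul_nonneg (by norm_num) (Finset.sum_nonneg fun x _ => Finset.sum_nonneg fun y _ => ?_)
  refine mul_nonneg (hπ x) ?_
  rcases eq_or_ne x y with rfl | hxy
  · simp
  · rcases (hoff x y hxy).eq_or_lt with h0 | h0
    · simp [← h0]
    · exact mul_nonneg h0.le (h x y h0)

lemma dirichlet_congr {L : Matrix Ω Ω ℝ} (hoff : ∀ x y, x ≠ y → 0 ≤ L x y)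
    (hrow : ∀ x, ∑ y, L x y = 0) {π : Ω → ℝ} {f g f' g' : Ω → ℝ}
    (h : ∀ x y, 0 < L x y → (f y - f x) * (g y - g x) = (f' y - f' x) * (g' y - g' x)) :
    dirichlet L π f g = dirichlet L π f' g' := by
  rw [dirichlet_eq hrow, dirichlet_eq hrow]
  congr 1
  refine Finset.sum_congr rfl fun x _ => Finset.sum_congr rfl fun y _ => ?_
  rcases eq_or_ne x y with rfl | hxy
  · simp
  · rcases (hoff x y hxy).eq_or_lt with h0 | h0
    · simp [← h0]
    · rw [h x y h0]

lemma dirichlet_smul (L : Matrix Ω Ω ℝ) (π f g : Ω → ℝ) (a b : ℝ) :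
    dirichlet L π (fun x => a * f x) (fun x => b * g x) = a * b * dirichlet L π f g := by
  simp only [dirichlet, mean, carreDuChamp, Matrix.mulVec, dotProduct, Finset.mul_sum,
    Pi.mul_apply, ← Finset.sum_sub_distrib]
  exact Finset.sum_congr rfl fun x _ => Finset.sum_congr rfl fun y _ => by ring

/-- The Gibbs variational inequality for the entropy. -/
lemma gibbs {π : Ω → ℝ} (hπ : ∀ x, 0 ≤ π x) {g r : Ω → ℝ} (hg : ∀ x, 0 ≤ g x)
    (hr : ∀ x, 0 ≤ r x) (hgr : ∀ x, r x = 0 → g x = 0) :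
    mean π (fun x => g x * Real.log (r x)) - mean π g * Real.log (mean π r) ≤ ent π g := by
  rcases (mean_nonneg hπ hg).eq_or_lt with h0 | h0
  · have hz : ∀ x, π x * g x = 0 := fun x =>
      (Finset.sum_eq_zero_iff_of_nonneg
        (fun x _ => mul_nonneg (hπ x) (hg x))).1 h0.symm x (Finset.mem_univ x)
    have h1 : ∀ s : Ω → ℝ, mean π (fun x => g x * Real.log (s x)) = 0 := fun s =>
      Finset.sum_eq_zero fun x _ => by rw [← mul_assoc, hz x, zero_mul]
    simp [ent, h1, ← h0]
  have hrpos : 0 < mean π r := by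
    refine (mean_nonneg hπ hr).lt_of_ne fun h => h0.ne' ?_
    refine Finset.sum_eq_zero fun x _ => ?_
    have := (Finset.sum_eq_zero_iff_of_nonneg
        (fun x _ => mul_nonneg (hπ x) (hr x))).1 h.symm x (Finset.mem_univ x)
    rcases mul_eq_zero.1 this with h | h
    · rw [h, zero_mul]
    · rw [hgr x h, mul_zero]
  set G := mean π g with hG
  set R := mean π r with hR
  have pt : ∀ x, g x - G / R * r x ≤ g x * Real.log (g x) - g x * Real.log (r x)
      - g x * Real.log G + g x * Real.log R := by
    intro x
    rcases (hg x).eq_or_lt with h | h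
    · rw [← h]
      have : 0 ≤ G / R * r x := mul_nonneg (div_nonneg h0.le hrpos.le) (hr x)
      simpa using this
    · have hrx : 0 < r x := (hr x).lt_of_ne fun h' => h.ne' (hgr x h'.symm)
      have h2 := Real.log_le_sub_one_of_pos (x := G * r x / (R * g x)) (by positivity)
      rw [Real.log_div (by positivity) (by positivity), Real.log_mul h0.ne' hrx.ne',
        Real.log_mul hrpos.ne' h.ne'] at h2
      have h3 := mul_le_mul_of_nonneg_left h2 h.le
      have h4 : g x * (G * r x / (R * g x) - 1) = G / R * r x - g x := by
        field_simp
      rw [h4] at h3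
      nlinarith
  have hs := mean_mono hπ pt
  have e1 : mean π (fun x => g x - G / R * r x) = 0 := by
    have : mean π (fun x => g x - G / R * r x) = G - G / R * R := by
      rw [hG, hR, ← mean_const_mul]
      simp [mean, mul_sub, Finset.sum_sub_distrib]
    rw [this]; field_simp; simp
  have e2 : mean π (fun x => g x * Real.log (g x) - g x * Real.log (r x)
      - g x * Real.log G + g x * Real.log R) =
      mean π (fun x => g x * Real.log (g x)) - mean π (fun x => g x * Real.log (r x))
        - G * Real.log G + G * Real.log R := by
    rw [hG]
    simp only [mean, mul_sub, mul_add, Finset.sum_sub_distrib, Finset.sum_add_distrib,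
      Finset.sum_mul, mul_assoc]
  rw [e1, e2] at hs
  rw [ent]
  linarith

lemma rpow_mul_log_rpow {t : ℝ} (ht : 0 ≤ t) {p q : ℝ} (hq : 0 < q) :
    t ^ q * Real.log (t ^ p) = p / q * (t ^ q * Real.log (t ^ q)) := by
  rcases ht.eq_or_lt with rfl | ht
  · simp [Real.zero_rpow hq.ne']
  · rw [Real.log_rpow ht, Real.log_rpow ht]
    field_simp

lemma ent₂_eq_log_sub_log {π : Ω → ℝ} (hπ : ∀ x, 0 < π x) {f : Ω → ℝ} (hf : Admissible f)
    {p q : ℝ} (hp : 0 < p) (hq : 0 < q) (hpq : p ≠ q) :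
    ent₂ π p q f = q / (p - q) * Real.log (mean π (fun x => f x ^ p))
      - p / (p - q) * Real.log (mean π (fun x => f x ^ q)) := by
  have hP := mean_pos hπ (admissible_rpow hf p)
  have hQ := mean_pos hπ (admissible_rpow hf q)
  rw [ent₂, if_neg (by simp [hp.ne', hq.ne']), if_neg hpq, pNorm, pNorm,
    Real.log_div (Real.rpow_pos_of_pos hP _).ne' (Real.rpow_pos_of_pos hQ _).ne',
    Real.log_rpow hP, Real.log_rpow hQ]
  have := sub_ne_zero.2 hpq
  field_simp

lemma normEnt_rpow_eq {π : Ω → ℝ} (hπ : ∀ x, 0 < π x) {f : Ω → ℝ} (hf : Admissible f) (q : ℝ) :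
    normEnt π (fun x => f x ^ q) =
      mean π (fun x => f x ^ q * Real.log (f x ^ q)) / mean π (fun x => f x ^ q)
        - Real.log (mean π (fun x => f x ^ q)) := by
  have hQ := mean_pos hπ (admissible_rpow hf q)
  rw [normEnt, ent, sub_div, mul_div_cancel_left₀ _ hQ.ne']

open scoped Classical in
lemma support_mass_pos {π : Ω → ℝ} (hπ : ∀ x, 0 < π x) {f : Ω → ℝ} (hf : Admissible f) :
    0 < ∑ x with 0 < f x, π x := by
  obtain ⟨x, hx⟩ := Function.ne_iff.1 hf.2
  exact Finset.sum_pos (fun x _ => hπ x)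
    ⟨x, Finset.mem_filter.2 ⟨Finset.mem_univ _, (hf.1 x).lt_of_ne (Ne.symm hx)⟩⟩

open scoped Classical in
lemma neg_mul_log_support_le {π : Ω → ℝ} (hπ : ∀ x, 0 < π x) {f : Ω → ℝ} (hf : Admissible f)
    {p : ℝ} (hp : 0 < p) :
    -(mean π (fun x => f x ^ p) * Real.log (∑ x with 0 < f x, π x))
      ≤ ent π (fun x => f x ^ p) := by
  have := gibbs (fun x => (hπ x).le) (admissible_rpow hf p).1
    (r := fun x => if 0 < f x then 1 else 0) (fun x => by positivity)
    (fun x hx => by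
      have : f x = 0 := by
        by_contra h
        simp [(hf.1 x).lt_of_ne (Ne.symm h)] at hx
      simp [this, Real.zero_rpow hp.ne'])
  have e : mean π (fun x => if 0 < f x then 1 else 0) = ∑ x with 0 < f x, π x := by
    simp [mean, Finset.sum_filter]
  rw [e] at this
  have e2 : mean π (fun x => f x ^ p * Real.log (if 0 < f x then 1 else 0)) = 0 :=
    Finset.sum_eq_zero fun x _ => by
    dsimp only
    split_ifs <;> simp
  linarith

/-- The two-parameter entropy is at most its diagonal value, for `p ≤ q`. -/
lemma ent₂_le_normEnt {π : Ω → ℝ} (hπ : ∀ x, 0 < π x) {f : Ω → ℝ} (hf : Admissible f)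
    {p q : ℝ} (hp : 0 ≤ p) (hq : 0 < q) (hpq : p ≤ q) :
    ent₂ π p q f ≤ normEnt π (fun x => f x ^ q) := by
  have hQ := mean_pos hπ (admissible_rpow hf q)
  rcases hp.eq_or_lt with rfl | hp
  · rw [ent₂, if_pos (Or.inl rfl), normEnt, le_div_iff₀ hQ]
    linarith [neg_mul_log_support_le hπ hf hq]
  rcases hpq.eq_or_lt with rfl | hpq
  · rw [ent₂, if_neg (by simp [hp.ne']), if_pos rfl]
  rw [ent₂_eq_log_sub_log hπ hf hp hq hpq.ne, normEnt_rpow_eq hπ hf]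
  have hg := gibbs (fun x => (hπ x).le) (admissible_rpow hf q).1 (admissible_rpow hf p).1
    (fun x hx => by
      rw [(Real.rpow_eq_zero (hf.1 x) hp.ne').1 hx, Real.zero_rpow hq.ne'])
  simp only [rpow_mul_log_rpow (hf.1 _) hq (p := p), mean_const_mul, ent] at hg
  set a := mean π (fun x => f x ^ q)
  set m := mean π (fun x => f x ^ q * Real.log (f x ^ q))
  set b := Real.log (mean π (fun x => f x ^ p))
  have hd : 0 < q - p := sub_pos.2 hpq
  have e : m / a - Real.log a - (q / (p - q) * b - p / (p - q) * Real.log a) =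
      q / (a * (q - p)) * ((m - a * Real.log a) - (p / q * m - a * b)) := by
    have : p - q ≠ 0 := by linarith
    have h' : p - q = -(q - p) := by ring
    rw [h']
    field_simp
    ring
  have : 0 ≤ m / a - Real.log a - (q / (p - q) * b - p / (p - q) * Real.log a) := by
    rw [e]
    exact mul_nonneg (by positivity) (by linarith)
  linarith

/-- The two-parameter entropy is at least its value at `p = 0`, for `p ≤ q`. -/
lemma ent₂_zero_le {π : Ω → ℝ} (hπ : ∀ x, 0 < π x) {f : Ω → ℝ} (hf : Admissible f)
    {p q : ℝ} (hp : 0 ≤ p) (hq : 0 < q) (hpq : p ≤ q) :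
    ent₂ π 0 q f ≤ ent₂ π p q f := by
  rcases hp.eq_or_lt with rfl | hp
  · rfl
  rcases hpq.eq_or_lt with rfl | hpq
  · rw [ent₂, if_pos (Or.inl rfl), ent₂, if_neg (by simp [hp.ne']), if_pos rfl, normEnt,
      le_div_iff₀ (mean_pos hπ (admissible_rpow hf p))]
    linarith [neg_mul_log_support_le hπ hf hp]
  rw [ent₂_eq_log_sub_log hπ hf hp hq hpq.ne, ent₂, if_pos (Or.inl rfl)]
  have hP := mean_pos hπ (admissible_rpow hf p)
  have h1 := neg_mul_log_support_le hπ hf hp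
  have h2 := gibbs (fun x => (hπ x).le) (admissible_rpow hf p).1 (admissible_rpow hf q).1
    (fun x hx => by
      rw [(Real.rpow_eq_zero (hf.1 x) hq.ne').1 hx, Real.zero_rpow hp.ne'])
  simp only [rpow_mul_log_rpow (hf.1 _) hp (p := q), mean_const_mul, ent] at h1 h2
  set b := mean π (fun x => f x ^ p)
  set m := mean π (fun x => f x ^ p * Real.log (f x ^ p))
  set a := Real.log (mean π (fun x => f x ^ q))
  set s := Real.log (∑ x with 0 < f x, π x)
  have hd : 0 < q - p := sub_pos.2 hpq
  have e : q / (p - q) * Real.log b - p / (p - q) * a - (- s) =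
      (1 / b) * (((m - b * Real.log b) - (-(b * s))) +
        p / (q - p) * ((m - b * Real.log b) - (q / p * m - b * a))) := by
    have h' : p - q = -(q - p) := by ring
    rw [h']
    field_simp
    ring
  have : 0 ≤ q / (p - q) * Real.log b - p / (p - q) * a - (- s) := by
    rw [e]
    exact mul_nonneg (by positivity)
      (add_nonneg (by linarith) (mul_nonneg (by positivity) (by linarith)))
  linarith

/-- `(t - s) (t ^ (q - 1) - s ^ (q - 1)) / (q - 1) ≥ 0`. -/
lemma sub_mul_rpow_sub_nonneg {q s t : ℝ} (hs : 0 ≤ s) (ht : 0 ≤ t)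
    (h : 1 < q ∨ (0 < s ∧ 0 < t)) :
    0 ≤ 1 / (q - 1) * ((t - s) * (t ^ (q - 1) - s ^ (q - 1))) := by
  wlog hst : s ≤ t generalizing s t
  · have := this ht hs (h.imp id And.symm) (le_of_not_ge hst)
    linarith [show (s - t) * (s ^ (q - 1) - t ^ (q - 1)) = (t - s) * (t ^ (q - 1) - s ^ (q - 1)) by
      ring]
  rcases lt_trichotomy q 1 with hq | rfl | hq
  · obtain ⟨hs, ht⟩ := h.resolve_left (by linarith)
    have h1 := Real.rpow_le_rpow_of_nonpos hs hst (by linarith : q - 1 ≤ 0)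
    have h2 : 1 / (q - 1) ≤ 0 := one_div_nonpos.2 (by linarith)
    exact mul_nonneg_of_nonpos_of_nonpos h2
      (mul_nonpos_of_nonneg_of_nonpos (by linarith) (by linarith))
  · simp
  · have h1 := Real.rpow_le_rpow hs hst (by linarith : 0 ≤ q - 1)
    have : 0 ≤ 1 / (q - 1) := one_div_nonneg.2 (by linarith)
    exact mul_nonneg this (mul_nonneg (by linarith) (by linarith))

lemma sub_mul_log_sub_nonneg {s t : ℝ} (hs : 0 < s) (ht : 0 < t) :
    0 ≤ (t - s) * (Real.log t - Real.log s) := by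
  rcases le_total s t with h | h
  · exact mul_nonneg (by linarith) (by linarith [Real.log_le_log hs h])
  · exact mul_nonneg_of_nonpos_of_nonpos (by linarith) (by linarith [Real.log_le_log ht h])

end OneSpaceLemmas

section EnergyForm

variable {Ω : Type*} [Fintype Ω]

/-- The numerator of the energy of order `q`: `𝓔(f, f ^ (q - 1)) / (q - 1)`, or `𝓔(f, ln f)` at
`q = 1`. -/
def energyForm (L : Matrix Ω Ω ℝ) (π : Ω → ℝ) (q : ℝ) (f : Ω → ℝ) : ℝ :=
  if q = 1 then dirichlet L π f (fun x => Real.log (f x))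
  else 1 / (q - 1) * dirichlet L π f (fun x => f x ^ (q - 1))

/-- No transition of positive rate leads from a zero of `f` to a point where `f` is positive,
unless the order `q` exceeds one. -/
def Regular (L : Matrix Ω Ω ℝ) (q : ℝ) (f : Ω → ℝ) : Prop :=
  ¬ (q ≤ 1 ∧ ∃ x y, 0 < L x y ∧ f x = 0 ∧ 0 < f y)

lemma energy_eq_top {L : Matrix Ω Ω ℝ} {π : Ω → ℝ} {q : ℝ} {f : Ω → ℝ} (h : ¬ Regular L q f) :
    energy L π q f = ⊤ := by
  rw [Regular, not_not] at h
  rw [energy, if_pos h]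

lemma regular_of_one_lt {Ω : Type*} (L : Matrix Ω Ω ℝ) {q : ℝ} (hq : 1 < q) (f : Ω → ℝ) : Regular L q f :=
  fun h => by linarith [h.1]

lemma regular_of_pos {Ω : Type*} (L : Matrix Ω Ω ℝ) (q : ℝ) {f : Ω → ℝ} (hf : ∀ x, 0 < f x) :
    Regular L q f := fun ⟨_, x, _, _, hx, _⟩ => (hf x).ne' hx

lemma mul_rpow_sub_one {t q : ℝ} (ht : 0 ≤ t) (hq : q ≠ 0) : t * t ^ (q - 1) = t ^ q := by
  rcases ht.eq_or_lt with rfl | ht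
  · simp [Real.zero_rpow hq]
  · rw [Real.rpow_sub_one ht.ne', mul_div_cancel₀ _ ht.ne']

lemma energy_eq {L : Matrix Ω Ω ℝ} {π : Ω → ℝ} {q : ℝ} (hq : q ≠ 0) {f : Ω → ℝ}
    (hf : ∀ x, 0 ≤ f x) (h : Regular L q f) :
    energy L π q f = ((energyForm L π q f / mean π (fun x => f x ^ q) : ℝ) : EReal) := by
  rw [energy, if_neg h, energyForm]
  split_ifs with h1
  · simp [h1]
  · congr 1
    rw [normDirichlet, mul_div_assoc]
    congr 3
    funext x
    exact mul_rpow_sub_one (hf x) hq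

lemma Regular.pos_pos {Ω : Type*} {L : Matrix Ω Ω ℝ} (hsymm : L.IsSymm) {q : ℝ} {f : Ω → ℝ}
    (hf : ∀ x, 0 ≤ f x) (h : Regular L q f) (hq : q ≤ 1) {x y : Ω} (hxy : 0 < L x y) :
    (f x = 0 ∧ f y = 0) ∨ (0 < f x ∧ 0 < f y) := by
  have h' : ∀ x y, 0 < L x y → f x = 0 → f y = 0 := fun x y hL h0 => by
    by_contra hy
    exact h ⟨hq, x, y, hL, h0, (hf y).lt_of_ne (Ne.symm hy)⟩
  by_cases h0 : f x = 0
  · exact Or.inl ⟨h0, h' x y hxy h0⟩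
  · refine Or.inr ⟨(hf x).lt_of_ne (Ne.symm h0), (hf y).lt_of_ne fun h1 => h0 ?_⟩
    exact h' y x (by rw [← hsymm.apply]; exact hxy) h1.symm

lemma energyForm_nonneg {L : Matrix Ω Ω ℝ} (hsymm : L.IsSymm)
    (hoff : ∀ x y, x ≠ y → 0 ≤ L x y)
    (hrow : ∀ x, ∑ y, L x y = 0) {π : Ω → ℝ} (hπ : ∀ x, 0 ≤ π x) {q : ℝ} {f : Ω → ℝ}
    (hf : ∀ x, 0 ≤ f x) (h : Regular L q f) : 0 ≤ energyForm L π q f := by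
  rw [energyForm]
  split_ifs with h1
  · refine dirichlet_nonneg hoff hrow hπ fun x y hxy => ?_
    rcases h.pos_pos hsymm hf h1.le hxy with ⟨h2, h3⟩ | ⟨h2, h3⟩
    · simp [h2, h3]
    · exact sub_mul_log_sub_nonneg h2 h3
  · have e := dirichlet_smul L π f (fun x => f x ^ (q - 1)) 1 (1 / (q - 1))
    simp only [one_mul] at e
    rw [← e]
    refine dirichlet_nonneg hoff hrow hπ fun x y hxy => ?_
    rw [← mul_sub, mul_left_comm]
    rcases lt_or_ge 1 q with hq | hq
    · exact sub_mul_rpow_sub_nonneg (hf x) (hf y) (Or.inl hq)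
    · rcases h.pos_pos hsymm hf hq hxy with ⟨h2, h3⟩ | h2
      · simp [h2, h3]
      · exact sub_mul_rpow_sub_nonneg (hf x) (hf y) (Or.inr h2)

lemma energyForm_smul {L : Matrix Ω Ω ℝ} (hsymm : L.IsSymm)
    (hoff : ∀ x y, x ≠ y → 0 ≤ L x y)
    (hrow : ∀ x, ∑ y, L x y = 0) (π : Ω → ℝ) {q : ℝ} {f : Ω → ℝ}
    (hf : ∀ x, 0 ≤ f x) (h : Regular L q f) {c : ℝ} (hc : 0 < c) :
    energyForm L π q (fun x => c * f x) = c ^ q * energyForm L π q f := by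
  rw [energyForm, energyForm]
  split_ifs with h1
  · have e := dirichlet_smul L π f (fun x => Real.log (f x)) c 1
    simp only [one_mul, mul_one] at e
    rw [h1, Real.rpow_one, ← e]
    refine dirichlet_congr hoff hrow fun x y hxy => ?_
    rcases h.pos_pos hsymm hf h1.le hxy with ⟨h2, h3⟩ | ⟨h2, h3⟩
    · simp [h2, h3]
    · rw [Real.log_mul hc.ne' h2.ne', Real.log_mul hc.ne' h3.ne']
      ring
  · have e := dirichlet_smul L π f (fun x => f x ^ (q - 1)) c (c ^ (q - 1))
    simp only [Real.mul_rpow hc.le (hf _)]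
    rw [e, Real.rpow_sub_one hc.ne']
    field_simp

lemma energy_nonneg_of_energyForm_nonneg {L : Matrix Ω Ω ℝ} {π : Ω → ℝ} (hπ : ∀ x, 0 ≤ π x)
    (q : ℝ) {f : Ω → ℝ} (hf : ∀ x, 0 ≤ f x) (h : Regular L q f → 0 ≤ energyForm L π q f) :
    0 ≤ energy L π q f := by
  by_cases hr : Regular L q f
  · have h0 := h hr
    rw [energyForm] at h0
    rw [energy, if_neg hr]
    split_ifs at h0 ⊢
    · exact EReal.coe_nonneg.2 (div_nonneg h0 (mean_nonneg hπ hf))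
    · refine EReal.coe_nonneg.2 ?_
      rw [normDirichlet, ← mul_div_assoc]
      exact div_nonneg h0
        (mean_nonneg hπ fun x => mul_nonneg (hf x) (Real.rpow_nonneg (hf x) _))
  · rw [energy_eq_top hr]
    exact le_top

end EnergyForm

section Product

/-- The product of the distributions `Q i`. -/
def piDist {X ι : Type*} [Fintype ι] (Q : ι → X → ℝ) (x : ι → X) : ℝ := ∏ i, Q i (x i)

lemma piDist_nonneg {X ι : Type*} [Fintype ι] {Q : ι → X → ℝ} (hQ : ∀ i a, 0 ≤ Q i a)
    (x : ι → X) : 0 ≤ piDist Q x := Finset.prod_nonneg fun i _ => hQ i _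

lemma prodDist_pos {X ι : Type*} [Fintype ι] {π : X → ℝ} (hπ : ∀ a, 0 < π a)
    (x : ι → X) : 0 < prodDist π x := Finset.prod_pos fun _ _ => hπ _

lemma piDist_update_mul {X ι : Type*} [Fintype ι] [DecidableEq ι] (Q : ι → X → ℝ) (x : ι → X)
    (k : ι) (a : X) : piDist Q (Function.update x k a) * Q k (x k) = piDist Q x * Q k a := by
  rw [piDist, piDist, ← Finset.mul_prod_erase Finset.univ _ (Finset.mem_univ k),
    ← Finset.mul_prod_erase Finset.univ (fun i => Q i (x i)) (Finset.mem_univ k),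
    Function.update_self, Finset.prod_congr rfl (g := fun i => Q i (x i))]
  · ring
  · intro i hi
    rw [Function.update_of_ne (Finset.ne_of_mem_erase hi)]

variable {X : Type*} [Fintype X] {ι : Type*} [Fintype ι] [DecidableEq ι]

lemma sum_piDist {Q : ι → X → ℝ} (hQ : ∀ i, ∑ a, Q i a = 1) : ∑ x, piDist Q x = 1 := by
  have := Finset.prod_univ_sum (fun _ : ι => (Finset.univ : Finset X)) (fun i a => Q i a)
  simp only [piDist]
  rw [Fintype.piFinset_univ] at this
  rw [← this]
  exact Finset.prod_eq_one fun i _ => hQ i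

/-- Resampling one coordinate does not change an expectation under a product distribution. -/
lemma mean_piDist_resample {Q : ι → X → ℝ} (k : ι) (hQ : ∑ a, Q k a = 1) (F : (ι → X) → ℝ) :
    mean (piDist Q) (fun x => mean (Q k) fun a => F (Function.update x k a)) =
      mean (piDist Q) F := by
  let e : (ι → X) × X ≃ (ι → X) × X :=
    { toFun := fun z => (Function.update z.1 k z.2, z.1 k)
      invFun := fun z => (Function.update z.1 k z.2, z.1 k)
      left_inv := fun z => by simp
      right_inv := fun z => by simp }
  calc mean (piDist Q) (fun x => mean (Q k) fun a => F (Function.update x k a))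
      = ∑ z : (ι → X) × X, piDist Q z.1 * Q k z.2 * F (Function.update z.1 k z.2) := by
        simp only [mean, Fintype.sum_prod_type, Finset.mul_sum, mul_assoc]
    _ = ∑ z : (ι → X) × X, piDist Q (e z).1 * Q k (e z).2 * F (e z).1 := by
        refine Finset.sum_congr rfl fun z _ => ?_
        simp only [e, Equiv.coe_fn_mk]
        rw [piDist_update_mul]
    _ = ∑ z : (ι → X) × X, piDist Q z.1 * Q k z.2 * F z.1 :=
        e.sum_comp (fun z => piDist Q z.1 * Q k z.2 * F z.1)
    _ = mean (piDist Q) F := by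
        simp only [mean, Fintype.sum_prod_type]
        refine Finset.sum_congr rfl fun x _ => ?_
        rw [← Finset.sum_mul, ← Finset.mul_sum, hQ, mul_one]

lemma mean_prodDist_resample {π : X → ℝ} (k : ι) (hπ : ∑ a, π a = 1) (F : (ι → X) → ℝ) :
    mean (prodDist π) (fun x => mean π fun a => F (Function.update x k a)) =
      mean (prodDist π) F :=
  mean_piDist_resample (Q := fun _ => π) k hπ F

lemma mulVec_prodGen (L : Matrix X X ℝ) (g : (ι → X) → ℝ) (x : ι → X) :
    (prodGen L).mulVec g x =
      ∑ k, L.mulVec (fun a => g (Function.update x k a)) (x k) := by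
  classical
  simp only [Matrix.mulVec, dotProduct, prodGen, Matrix.of_apply, Finset.sum_mul]
  rw [Finset.sum_comm]
  refine Finset.sum_congr rfl fun k _ => ?_
  simp only [ite_mul, zero_mul]
  rw [← Finset.sum_filter]
  symm
  refine Finset.sum_bij (fun a _ => Function.update x k a) ?_ ?_ ?_ ?_
  · intro a _
    simp only [Finset.mem_filter, Finset.mem_univ, true_and]
    intro j hj
    rw [Function.update_of_ne hj]
  · intro a _ b _ h
    exact Function.update_injective x k h
  · intro y hy
    simp only [Finset.mem_filter, Finset.mem_univ, true_and] at hy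
    refine ⟨y k, Finset.mem_univ _, ?_⟩
    funext j
    rcases eq_or_ne j k with rfl | hj
    · simp
    · rw [Function.update_of_ne hj, hy j hj]
  · intro a _
    simp

lemma dirichlet_prodGen (L : Matrix X X ℝ) {π : X → ℝ} (hπ : ∑ a, π a = 1)
    (f g : (ι → X) → ℝ) :
    dirichlet (prodGen L) (prodDist π) f g =
      ∑ k, mean (prodDist π) fun x =>
        dirichlet L π (fun a => f (Function.update x k a)) (fun a => g (Function.update x k a)) := by
  have key : ∀ x, carreDuChamp (prodGen L) f g x = ∑ k, carreDuChamp L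
      (fun a => f (Function.update x k a)) (fun a => g (Function.update x k a)) (x k) := by
    intro x
    simp only [carreDuChamp, mulVec_prodGen, Function.update_eq_self, ← Finset.mul_sum,
      Finset.sum_sub_distrib]
    rfl
  have : ∀ k, (mean (prodDist π) fun x => carreDuChamp L
      (fun a => f (Function.update x k a)) (fun a => g (Function.update x k a)) (x k)) =
      mean (prodDist π) fun x =>
        dirichlet L π (fun a => f (Function.update x k a)) (fun a => g (Function.update x k a)) := by
    intro k
    rw [← mean_prodDist_resample k hπ]
    simp only [Function.update_idem, Function.update_self, dirichlet]
  rw [← Finset.sum_congr rfl fun k _ => this k]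
  simp only [dirichlet, mean, key, Finset.mul_sum]
  rw [Finset.sum_comm]

/-- The energy form of the product chain is the sum of the averaged energy forms of the
one-coordinate slices. -/
lemma energyForm_prodGen (L : Matrix X X ℝ) {π : X → ℝ} (hπ : ∑ a, π a = 1) (q : ℝ)
    (f : (ι → X) → ℝ) :
    energyForm (prodGen L) (prodDist π) q f =
      ∑ k, mean (prodDist π) fun x => energyForm L π q (fun a => f (Function.update x k a)) := by
  simp only [energyForm]
  split_ifs with h
  · exact dirichlet_prodGen L hπ _ _
  · rw [dirichlet_prodGen L hπ, Finset.mul_sum]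
    exact Finset.sum_congr rfl fun k _ => (mean_const_mul _ _ _).symm

lemma prodGen_update {X : Type*} (L : Matrix X X ℝ) (x : ι → X) (k : ι) {a b : X} (hab : a ≠ b) :
    prodGen L (Function.update x k a) (Function.update x k b) = L a b := by
  classical
  rw [prodGen, Matrix.of_apply, Finset.sum_eq_single k]
  · rw [if_pos]
    · simp
    · intro j hj
      rw [Function.update_of_ne hj, Function.update_of_ne hj]
  · intro j _ hj
    rw [if_neg]
    intro h
    have := h k hj.symm
    simp only [Function.update_self] at this
    exact hab this
  · simp

lemma Regular.slice {X : Type*} {L : Matrix X X ℝ} {q : ℝ} {f : (ι → X) → ℝ}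
    (h : Regular (prodGen L) q f) (k : ι) (x : ι → X) :
    Regular L q (fun a => f (Function.update x k a)) := by
  rintro ⟨hq, a, b, hL, ha, hb⟩
  have hab : a ≠ b := by
    rintro rfl
    exact hb.ne' ha
  exact h ⟨hq, _, _, by rwa [prodGen_update L x k hab], ha, hb⟩

/-- Averaging over one coordinate. -/
def average (π : X → ℝ) (k : ι) (g : (ι → X) → ℝ) (x : ι → X) : ℝ :=
  mean π fun a => g (Function.update x k a)

/-- The mean entropy of the slices in direction `k`. -/
def sliceEnt (π : X → ℝ) (k : ι) (g : (ι → X) → ℝ) : ℝ :=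
  mean (prodDist π) fun x => ent π fun a => g (Function.update x k a)

lemma ent_prodDist_eq {π : X → ℝ} (hπ : ∑ a, π a = 1) (k : ι) (g : (ι → X) → ℝ) :
    ent (prodDist π) g = sliceEnt π k g + ent (prodDist π) (average π k g) := by
  have h1 : mean (prodDist π) (average π k g) = mean (prodDist π) g :=
    mean_prodDist_resample k hπ g
  have h2 := mean_prodDist_resample k hπ (fun x => g x * Real.log (g x))
  rw [ent, ent, sliceEnt, h1, ← h2]
  simp only [ent]
  have h3 : ∀ x, average π k g x = mean π fun a => g (Function.update x k a) := fun x => rfl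
  simp only [h3]
  simp only [mean, mul_sub, Finset.sum_sub_distrib]
  ring

lemma sliceEnt_average_le {π : X → ℝ} (hpos : ∀ a, 0 < π a) (hπ : ∑ a, π a = 1) {j k : ι}
    (hjk : j ≠ k) {g : (ι → X) → ℝ} (hg : ∀ x, 0 ≤ g x) :
    sliceEnt π j (average π k g) ≤ sliceEnt π j g := by
  rw [sliceEnt, sliceEnt, ← mean_prodDist_resample k hπ]
  conv_rhs => rw [← mean_prodDist_resample k hπ]
  refine mean_mono (fun x => (prodDist_pos hpos x).le) fun x => ?_
  have e : ∀ b a, average π k g (Function.update (Function.update x k b) j a) =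
      mean π fun c => g (Function.update (Function.update x k c) j a) := by
    intro b a
    rw [average]
    congr 1
    funext c
    rw [Function.update_comm hjk, Function.update_idem, Function.update_comm hjk.symm]
  simp only [e]
  set r : X → ℝ := fun a => mean π fun c => g (Function.update (Function.update x k c) j a) with hr
  have hr0 : ∀ a, 0 ≤ r a := fun a => mean_nonneg (fun a => (hpos a).le) fun c => hg _
  have hc : mean π (fun _ : X => ent π r) = ent π r := by
    rw [mean, ← Finset.sum_mul, hπ, one_mul]
  rw [hc]
  have hG : ∀ c, mean π (fun a => g (Function.update (Function.update x k c) j a) *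
      Real.log (r a)) - mean π (fun a => g (Function.update (Function.update x k c) j a)) *
        Real.log (mean π r) ≤ ent π (fun a => g (Function.update (Function.update x k c) j a)) := by
    intro c
    refine gibbs (fun a => (hpos a).le) (fun a => hg _) hr0 fun a ha => ?_
    have := (Finset.sum_eq_zero_iff_of_nonneg (fun c _ =>
      mul_nonneg (hpos c).le (hg _))).1 ha c (Finset.mem_univ c)
    exact (mul_eq_zero.1 this).resolve_left (hpos c).ne'
  refine le_trans (le_of_eq ?_) (mean_mono (fun a => (hpos a).le) hG)
  rw [ent]
  have s1 : mean π (fun a => r a * Real.log (r a)) = mean π (fun c => mean π fun a =>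
      g (Function.update (Function.update x k c) j a) * Real.log (r a)) := by
    simp only [mean, Finset.mul_sum]
    rw [Finset.sum_comm]
    refine Finset.sum_congr rfl fun a _ => ?_
    have hra : r a = ∑ c, π c * g (Function.update (Function.update x k c) j a) := rfl
    generalize Real.log (r a) = l
    rw [hra, Finset.sum_mul, Finset.mul_sum]
    exact Finset.sum_congr rfl fun c _ => by ring
  have s2 : mean π r = mean π (fun c => mean π fun a =>
      g (Function.update (Function.update x k c) j a)) := by
    simp only [hr, mean, Finset.mul_sum]
    rw [Finset.sum_comm]
    exact Finset.sum_congr rfl fun a _ => Finset.sum_congr rfl fun c _ => by ring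
  rw [s1]
  nth_rewrite 1 [s2]
  simp only [mean, mul_sub, Finset.sum_sub_distrib, Finset.sum_mul, mul_assoc]

lemma average_nonneg {ι : Type*} [DecidableEq ι] {π : X → ℝ} (hpos : ∀ a, 0 < π a) (k : ι) {g : (ι → X) → ℝ}
    (hg : ∀ x, 0 ≤ g x) (x : ι → X) : 0 ≤ average π k g x :=
  mean_nonneg (fun a => (hpos a).le) fun _ => hg _

/-- A function that does not depend on any coordinate is constant. -/
lemma eq_of_forall_update {X β : Type*} {g : (ι → X) → β}
    (h : ∀ k x a, g (Function.update x k a) = g x) (x y : ι → X) : g x = g y := by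
  have : ∀ s : Finset ι, g (s.piecewise y x) = g x := by
    intro s
    induction s using Finset.induction_on with
    | empty => simp
    | insert k s hk ih => rw [Finset.piecewise_insert, h, ih]
  simpa using (this Finset.univ).symm

/-- Subadditivity of the entropy of product distributions. -/
lemma ent_prodDist_le {π : X → ℝ} (hpos : ∀ a, 0 < π a) (hπ : ∑ a, π a = 1)
    {g : (ι → X) → ℝ} (hg : ∀ x, 0 ≤ g x) :
    ent (prodDist π) g ≤ ∑ k, sliceEnt π k g := by
  have main : ∀ s : Finset ι, ∃ r : (ι → X) → ℝ, (∀ x, 0 ≤ r x) ∧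
      (∀ k ∈ s, ∀ x a, r (Function.update x k a) = r x) ∧
      (∀ k ∉ s, sliceEnt π k r ≤ sliceEnt π k g) ∧
      ent (prodDist π) g ≤ ∑ k ∈ s, sliceEnt π k g + ent (prodDist π) r := by
    intro s
    induction s using Finset.induction_on with
    | empty => exact ⟨g, hg, by simp, fun _ _ => le_rfl, by simp⟩
    | insert k s hk ih =>
      obtain ⟨r, hr0, hr1, hr2, hr3⟩ := ih
      refine ⟨average π k r, average_nonneg hpos k hr0, ?_, ?_, ?_⟩
      · intro j hj x a
        simp only [average]
        congr 1
        funext b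
        rcases eq_or_ne j k with rfl | hjk
        · rw [Function.update_idem]
        · rw [Function.update_comm hjk, hr1 j (Finset.mem_of_mem_insert_of_ne hj hjk)]
      · intro j hj
        rw [Finset.mem_insert, not_or] at hj
        exact (sliceEnt_average_le hpos hπ hj.1 hr0).trans (hr2 j hj.2)
      · rw [Finset.sum_insert hk]
        have := ent_prodDist_eq hπ k r
        linarith [hr2 k hk]
  obtain ⟨r, hr0, hr1, -, hr3⟩ := main Finset.univ
  have hone : ∑ x : ι → X, prodDist π x = 1 := sum_piDist (Q := fun _ => π) fun _ => hπ
  have : ent (prodDist π) r = 0 := by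
    rcases isEmpty_or_nonempty (ι → X) with he | ⟨⟨x₀⟩⟩
    · simp [ent, mean]
    · have hc : r = fun _ => r x₀ := by
        funext x
        exact eq_of_forall_update (fun k x a => hr1 k (Finset.mem_univ k) x a) x x₀
      rw [hc]
      simp only [ent, mean, ← Finset.sum_mul, hone, one_mul, sub_self]
  linarith

end Product

section Envelope

lemma convEnvelope_le {g : ℝ → EReal} (α : ℝ) : convEnvelope g α ≤ g α :=
  iSup₂_le fun _ hh => hh.2 α

lemma le_convEnvelope_of_affine {g : ℝ → EReal} {α m μ : ℝ}
    (h : ∀ a, ((m + μ * (a - α) : ℝ) : EReal) ≤ g a) : (m : EReal) ≤ convEnvelope g α := by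
  refine le_iSup₂_of_le (fun a => ((m + μ * (a - α) : ℝ) : EReal)) ⟨?_, h⟩ (by simp)
  intro z hz w hw s t hs ht hst
  simp only [Set.mem_ofPred_eq, EReal.coe_le_coe_iff, Prod.fst_add, Prod.snd_add, Prod.smul_fst,
    Prod.smul_snd, smul_eq_mul] at hz hw ⊢
  have h1 := mul_le_mul_of_nonneg_left hz hs
  have h2 := mul_le_mul_of_nonneg_left hw ht
  have e : m + μ * (s * z.1 + t * w.1 - α) =
      s * (m + μ * (z.1 - α)) + t * (m + μ * (w.1 - α)) := by
    linear_combination (μ * α - m) * hst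
  linarith

/-- A convex combination of points in the epigraph of a nondecreasing function lies above the
convex envelope. -/
lemma convEnvelope_le_of_combination {κ : Type*} [Fintype κ] {g : ℝ → EReal} {w a c : κ → ℝ}
    (hw : ∀ i, 0 ≤ w i) (hw1 : ∑ i, w i = 1)
    (hg : ∀ i, w i ≠ 0 → ∀ b ≤ a i, g b ≤ (c i : EReal)) {α : ℝ} (hα : α ≤ ∑ i, w i * a i) :
    convEnvelope g α ≤ ((∑ i, w i * c i : ℝ) : EReal) := by
  classical
  refine iSup₂_le fun h hh => ?_
  set d := ∑ i, w i * a i - α with hd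
  have hne : ∀ u : κ → ℝ, ∑ i with w i ≠ 0, w i * u i = ∑ i, w i * u i := fun u =>
    Finset.sum_subset (Finset.filter_subset _ _) fun i _ hi => by
      simp only [Finset.mem_filter, Finset.mem_univ, true_and, not_not] at hi
      rw [hi, zero_mul]
  have hne1 : ∑ i with w i ≠ 0, w i = 1 := by
    simpa [hw1] using hne fun _ => 1
  have key := hh.1.sum_mem (t := Finset.univ.filter fun i => w i ≠ 0) (w := w)
    (z := fun i => (a i - d, c i)) (fun i _ => hw i) hne1 (fun i hi => by
      simp only [Finset.mem_filter, Finset.mem_univ, true_and] at hi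
      exact (hh.2 _).trans (hg i hi _ (by simp only [hd]; linarith)))
  have e1 : (∑ i with w i ≠ 0, w i • (a i - d, c i)).1 = α := by
    simp only [Prod.fst_sum, Prod.smul_fst, smul_eq_mul, hne fun i => a i - d]
    simp only [mul_sub, Finset.sum_sub_distrib, ← Finset.sum_mul, hw1, hd]
    ring
  have e2 : (∑ i with w i ≠ 0, w i • (a i - d, c i)).2 = ∑ i, w i * c i := by
    simp only [Prod.snd_sum, Prod.smul_snd, smul_eq_mul, hne fun i => c i]
  rw [Set.mem_ofPred_eq, e1, e2] at key
  exact key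

end Envelope

section LowerBound

variable {X : Type*} [Fintype X]

lemma logSobolev_le {L : Matrix X X ℝ} {π : X → ℝ} {q : ℝ} (hq : 0 < q) {f : X → ℝ}
    (hf : Admissible f) (hr : Regular L q f) {b : ℝ} (hb : b ≤ normEnt π (fun x => f x ^ q)) :
    logSobolev L π q b ≤ ((energyForm L π q f / mean π (fun x => f x ^ q) : ℝ) : EReal) := by
  rw [logSobolev, if_neg hq.ne', ← energy_eq hq.ne' hf.1 hr]
  exact iInf₂_le f ⟨hf, hb⟩

lemma mean_mul_slice_div {ι : Type*} [Fintype ι] [DecidableEq ι] {π : X → ℝ}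
    (hpos : ∀ a, 0 < π a) (hπ : ∑ a, π a = 1) {g : (ι → X) → ℝ} (hg : ∀ x, 0 ≤ g x) (k : ι)
    {N : (ι → X) → ℝ} (hN : ∀ x a, N (Function.update x k a) = N x)
    (hN0 : ∀ x, (∀ a, g (Function.update x k a) = 0) → N x = 0) :
    mean (prodDist π) (fun x => g x * (N x / mean π fun a => g (Function.update x k a))) =
      mean (prodDist π) N := by
  rw [← mean_prodDist_resample k hπ]
  simp only [hN, Function.update_idem]
  congr 1
  funext x
  simp only [mul_comm (g _), mean_const_mul]
  by_cases h : ∀ a, g (Function.update x k a) = 0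
  · rw [hN0 x h]
    simp
  · have := mean_pos hpos (f := fun a => g (Function.update x k a))
      ⟨fun a => hg _, fun h' => h fun a => congrFun h' a⟩
    exact div_mul_cancel₀ _ this.ne'

/-- Tensorization: the energy of a function on a power space dominates the convex envelope of the
log-Sobolev function, evaluated at the entropy per coordinate. -/
lemma convEnvelope_le_energy_prod {ι : Type*} [Fintype ι] [DecidableEq ι] [Nonempty ι]
    {L : Matrix X X ℝ} {π : X → ℝ} (hpos : ∀ a, 0 < π a) (hπ : ∑ a, π a = 1) {q : ℝ} (hq : 0 < q)
    {f : (ι → X) → ℝ} (hf : Admissible f) (hr : Regular (prodGen L) q f) {α : ℝ}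
    (hα : α ≤ 1 / Fintype.card ι * normEnt (prodDist π) (fun x => f x ^ q)) :
    convEnvelope (logSobolev L π q) α ≤ ((1 / Fintype.card ι : ℝ) : EReal) *
      energy (prodGen L) (prodDist π) q f := by
  have hn : (0 : ℝ) < Fintype.card ι := by exact_mod_cast Fintype.card_pos
  have hE := mean_pos (prodDist_pos hpos) (admissible_rpow hf q)
  set E := mean (prodDist π) (fun x => f x ^ q) with hEdef
  have hg0 : ∀ x, 0 ≤ f x ^ q := (admissible_rpow hf q).1
  let S : ι × (ι → X) → X → ℝ := fun i a => f (Function.update i.2 i.1 a)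
  let w : ι × (ι → X) → ℝ := fun i => 1 / Fintype.card ι * (1 / E) * (prodDist π i.2 * f i.2 ^ q)
  have hsum : ∀ N : ι × (ι → X) → ℝ, ∑ i, w i * N i =
      1 / Fintype.card ι * (1 / E) * ∑ k, mean (prodDist π) (fun x => f x ^ q * N (k, x)) := by
    intro N
    simp only [w, Fintype.sum_prod_type, mean, Finset.mul_sum]
    exact Finset.sum_congr rfl fun k _ => Finset.sum_congr rfl fun x _ => by ring
  have hw1 : ∑ i, w i = 1 := by
    have := hsum fun _ => 1
    simp only [mul_one, ← hEdef, Finset.sum_const, Finset.card_univ, nsmul_eq_mul] at this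
    rw [this]
    field_simp
  have hzero : ∀ (k : ι) (x : ι → X), (∀ a, f (Function.update x k a) ^ q = 0) →
      (fun a => f (Function.update x k a)) = fun _ => 0 := fun k x h => by
    funext a
    exact (Real.rpow_eq_zero (hf.1 _) hq.ne').1 (h a)
  have hJ : ∑ i, w i * (energyForm L π q (S i) / mean π (fun a => S i a ^ q)) =
      1 / Fintype.card ι * (energyForm (prodGen L) (prodDist π) q f / E) := by
    rw [hsum, energyForm_prodGen L hπ, mul_assoc, one_div_mul_eq_div E]
    congr 2
    refine Finset.sum_congr (M := ℝ) rfl fun k _ => ?_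
    refine mean_mul_slice_div hpos hπ hg0 k (N := fun x => energyForm L π q (S (k, x)))
      (fun x a => by simp [S]) fun x h => ?_
    simp only [S, hzero k x h]
    simp [energyForm, dirichlet, carreDuChamp, mean, Matrix.mulVec, dotProduct]
  have hEnt : ∑ i, w i * normEnt π (fun a => S i a ^ q) =
      1 / Fintype.card ι * (1 / E) * ∑ k, sliceEnt π k (fun x => f x ^ q) := by
    rw [hsum]
    congr 1
    refine Finset.sum_congr rfl fun k _ => ?_
    refine mean_mul_slice_div hpos hπ hg0 k (N := fun x => ent π (fun a => S (k, x) a ^ q))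
      (fun x a => by simp [S]) fun x h => ?_
    simp only [S, h]
    simp [ent, mean]
  rw [energy_eq hq.ne' hf.1 hr, ← EReal.coe_mul, ← hEdef, ← hJ]
  refine convEnvelope_le_of_combination (w := w) (a := fun i => normEnt π fun a => S i a ^ q)
    (fun i => ?_) hw1 (fun i hi b hb => ?_) ?_
  · exact mul_nonneg (by positivity) (mul_nonneg (prodDist_pos hpos _).le (hg0 _))
  · refine logSobolev_le hq ⟨fun a => hf.1 _, fun h => hi ?_⟩ (hr.slice i.1 i.2) hb
    have : f i.2 = 0 := by
      have := congrFun h (i.2 i.1)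
      simpa [S] using this
    simp [w, this, Real.zero_rpow hq.ne']
  · rw [hEnt]
    refine hα.trans ?_
    rw [normEnt, ← hEdef, mul_assoc, one_div_mul_eq_div E]
    gcongr
    exact ent_prodDist_le hpos hπ hg0

/-- If a nonempty proper subset is closed under the transitions, the log-Sobolev function of order
zero vanishes. -/
lemma logSobolev_zero_le_of_closed {L : Matrix X X ℝ} (hsymm : L.IsSymm)
    (hoff : ∀ x y, x ≠ y → 0 ≤ L x y) (hrow : ∀ x, ∑ y, L x y = 0)
    {π : X → ℝ} (hpos : ∀ a, 0 < π a) {v : X → ℝ} (hv : ∀ a, 0 ≤ v a)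
    (hr : Regular L 0 v) {a₀ b₀ : X} (ha₀ : v a₀ = 0) (hb₀ : 0 < v b₀) (α : ℝ) :
    logSobolev L π 0 α ≤ 0 := by
  classical
  let e : ℝ → X → ℝ := fun s x => if v x = 0 then 0 else s
  have hvar : ∀ s, variance π (e s) = s ^ 2 * variance π (e 1) := by
    intro s
    have h1 : ∀ x, e s x = s * e 1 x := fun x => by simp [e]
    have h2 : mean π (e s) = s * mean π (e 1) := by
      rw [← mean_const_mul]
      congr 1
      funext x
      exact h1 x
    rw [variance, variance, h2, ← mean_const_mul π (fun x => (e 1 x - mean π (e 1)) ^ 2)]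
    congr 1
    funext x
    rw [h1 x]
    ring
  have hvpos : 0 < variance π (e 1) := by
    refine mean_pos hpos ⟨fun x => sq_nonneg _, fun h => ?_⟩
    have ha := congrFun h a₀
    have hb := congrFun h b₀
    simp only [e, ha₀, hb₀.ne', Pi.zero_apply, if_true, if_false, pow_eq_zero_iff, ne_eq,
      OfNat.ofNat_ne_zero, not_false_eq_true] at ha hb
    linarith
  obtain ⟨s, hs⟩ : ∃ s : ℝ, α ≤ 1 / 2 * (s ^ 2 * variance π (e 1)) := by
    refine ⟨Real.sqrt (2 * |α| / variance π (e 1)), ?_⟩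
    rw [Real.sq_sqrt (by positivity), div_mul_cancel₀ _ hvpos.ne']
    linarith [le_abs_self α]
  rw [logSobolev, if_pos rfl]
  have hs' : α ≤ 1 / 2 * variance π (fun x => Real.log (Real.exp (e s x))) := by
    simpa only [Real.log_exp, hvar s] using hs
  refine le_trans (iInf₂_le (fun x => Real.exp (e s x)) ⟨fun x => Real.exp_pos _, hs'⟩) ?_
  · rw [energy, if_neg (regular_of_pos L 0 fun x => Real.exp_pos _), if_neg (by norm_num),
      normDirichlet]
    have : dirichlet L π (fun x => Real.exp (e s x)) (fun x => Real.exp (e s x) ^ (0 - 1 : ℝ)) =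
        dirichlet L π (fun _ => 0) (fun _ => 0) := by
      refine dirichlet_congr hoff hrow fun x y hxy => ?_
      rcases hr.pos_pos hsymm hv zero_le_one hxy with ⟨h1, h2⟩ | ⟨h1, h2⟩
      · simp [e, h1, h2]
      · simp [e, h1.ne', h2.ne']
    rw [this]
    simp [dirichlet, carreDuChamp, mean, Matrix.mulVec, dotProduct]

lemma logSobolev_zero_le_of_nonpos {L : Matrix X X ℝ} (hrow : ∀ x, ∑ y, L x y = 0) {π : X → ℝ} {α : ℝ} (hα : α ≤ 0) :
    logSobolev L π 0 α ≤ 0 := by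
  rw [logSobolev, if_pos rfl]
  have hα' : α ≤ 1 / 2 * variance π (fun _ => Real.log 1) := by
    simpa [variance, mean] using hα
  refine le_trans (iInf₂_le (fun _ => 1) ⟨fun x => one_pos, hα'⟩) ?_
  · rw [energy, if_neg (regular_of_pos L 0 fun x => one_pos), if_neg (by norm_num), normDirichlet]
    have : dirichlet L π (fun _ => 1) (fun _ => (1 : ℝ) ^ (0 - 1 : ℝ)) = 0 := by
      rw [dirichlet_eq hrow]
      simp
    rw [this]
    simp

lemma exists_slice_not_constant {ι : Type*} [Fintype ι] [DecidableEq ι] {X : Type*}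
    {f : (ι → X) → ℝ} {x y : ι → X} (hx : f x = 0) (hy : f y ≠ 0) :
    ∃ k z a b, f (Function.update z k a) = 0 ∧ f (Function.update z k b) ≠ 0 := by
  by_contra! h
  have : ∀ k x a, (f (Function.update x k a) = 0) = (f x = 0) := by
    intro k x a
    refine propext ⟨fun h0 => ?_, fun h0 => ?_⟩
    · have := h k x a (x k) h0
      simpa using this
    · exact h k x (x k) a (by simpa using h0)
  have := eq_of_forall_update (g := fun x => f x = 0) this x y
  exact hy (this ▸ hx)

lemma energy_prod_nonneg {ι : Type*} [Fintype ι] [DecidableEq ι] {L : Matrix X X ℝ}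
    (hsymm : L.IsSymm) (hoff : ∀ x y, x ≠ y → 0 ≤ L x y) (hrow : ∀ x, ∑ y, L x y = 0)
    {π : X → ℝ} (hpos : ∀ a, 0 < π a) (hπ : ∑ a, π a = 1) (q : ℝ) {f : (ι → X) → ℝ}
    (hf : ∀ x, 0 ≤ f x) : 0 ≤ energy (prodGen L) (prodDist π) q f := by
  have hn : ∀ x : ι → X, 0 ≤ prodDist π x := fun x => (prodDist_pos hpos x).le
  refine energy_nonneg_of_energyForm_nonneg hn q hf fun hr => ?_
  rw [energyForm_prodGen L hπ]
  exact Finset.sum_nonneg fun k _ => mean_nonneg hn fun x =>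
    energyForm_nonneg hsymm hoff hrow (fun a => (hpos a).le) (fun a => hf _) (hr.slice k x)

lemma phi_le_renyiSobolev {L : Matrix X X ℝ} (hsymm : L.IsSymm)
    (hoff : ∀ x y, x ≠ y → 0 ≤ L x y) (hrow : ∀ x, ∑ y, L x y = 0)
    {π : X → ℝ} (hpos : ∀ a, 0 < π a) (hπ : ∑ a, π a = 1) {p q : ℝ} (hp : 0 ≤ p) (hq : 0 ≤ q)
    {n : ℕ} (hn : 1 ≤ n) (α : ℝ) : phi L π p q α ≤ renyiSobolev L π p q n α := by
  have hn0 : (0 : ℝ) < 1 / n := by positivity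
  refine le_iInf₂ fun f hf => ?_
  obtain ⟨hf, hα⟩ := hf
  by_cases hr : Regular (prodGen L) q f
  swap
  · rw [energy_eq_top hr, EReal.coe_mul_top_of_pos hn0]
    exact le_top
  have hnn : (0 : EReal) ≤ ((1 / n : ℝ) : EReal) * energy (prodGen L) (prodDist π) q f :=
    mul_nonneg (EReal.coe_nonneg.2 hn0.le) (energy_prod_nonneg hsymm hoff hrow hpos hπ q hf.1)
  rw [phi]
  split_ifs with hpq
  swap
  · exact hnn
  rcases hq.eq_or_lt with rfl | hq
  · have hp0 : p = 0 := le_antisymm hpq hp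
    refine ((convEnvelope_le α).trans ?_).trans hnn
    by_cases hz : ∃ x, f x = 0
    · obtain ⟨x, hx⟩ := hz
      obtain ⟨y, hy⟩ := Function.ne_iff.1 hf.2
      obtain ⟨k, z, a, b, ha, hb⟩ := exists_slice_not_constant hx hy
      exact logSobolev_zero_le_of_closed hsymm hoff hrow hpos (fun a => hf.1 _)
        (hr.slice k z) ha ((hf.1 _).lt_of_ne hb.symm) α
    · push Not at hz
      refine logSobolev_zero_le_of_nonpos hrow (hα.trans (le_of_eq ?_))
      rw [ent₂, if_pos (Or.inr rfl), Finset.filter_true_of_mem fun x _ =>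
        (hf.1 x).lt_of_ne (hz x).symm]
      have : ∑ x : Fin n → X, prodDist π x = 1 := sum_piDist (Q := fun _ => π) fun _ => hπ
      simp [this]
  · have : Nonempty (Fin n) := ⟨⟨0, hn⟩⟩
    have := convEnvelope_le_energy_prod hpos hπ hq hf hr (α := α) (by
      rw [Fintype.card_fin]
      exact hα.trans (mul_le_mul_of_nonneg_left
        (ent₂_le_normEnt (prodDist_pos hpos) hf hp hq hpq) hn0.le))
    rwa [Fintype.card_fin] at this

end LowerBound

section Duality

/-- If `m` bounds from below the second coordinates of all two-point mixtures from `S` whose first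
coordinate exceeds `α`, then `S` lies above a nondecreasing affine function with value `m`
at `α`. -/
lemma exists_slope {S : Set (ℝ × ℝ)} {α m : ℝ}
    (H : ∀ z ∈ S, ∀ w ∈ S, ∀ t ∈ Set.Icc (0 : ℝ) 1, α < t * z.1 + (1 - t) * w.1 →
      m ≤ t * z.2 + (1 - t) * w.2)
    (hne : ∃ z ∈ S, α < z.1) : ∃ μ : ℝ, 0 ≤ μ ∧ ∀ z ∈ S, m + μ * (z.1 - α) ≤ z.2 := by
  have hright : ∀ z ∈ S, α < z.1 → m ≤ z.2 := fun z hz h => by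
    simpa using H z hz z hz 1 (by simp) (by simpa using h)
  have hcross : ∀ z ∈ S, α < z.1 → ∀ w ∈ S, w.1 ≤ α →
      (m - w.2) * (z.1 - α) ≤ (z.2 - m) * (α - w.1) := by
    intro z hz hzα w hw hwα
    have hd : 0 < z.1 - w.1 := by linarith
    set r := (α - w.1) / (z.1 - w.1) with hr
    have hr0 : 0 ≤ r := div_nonneg (by linarith) hd.le
    have hr1 : r < 1 := (div_lt_one hd).2 (by linarith)
    have hlim : Tendsto (fun t : ℝ => t * z.2 + (1 - t) * w.2) (𝓝[>] r)
        (𝓝 (r * z.2 + (1 - r) * w.2)) := by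
      refine Tendsto.mono_left ?_ nhdsWithin_le_nhds
      exact (by fun_prop : Continuous fun t : ℝ => t * z.2 + (1 - t) * w.2).tendsto r
    have hm : m ≤ r * z.2 + (1 - r) * w.2 := by
      refine ge_of_tendsto hlim ?_
      filter_upwards [Ioo_mem_nhdsGT hr1] with t ht
      refine H z hz w hw t ⟨hr0.trans ht.1.le, ht.2.le⟩ ?_
      have h1 := (div_lt_iff₀ hd).1 ht.1
      linarith
    have h2 := mul_le_mul_of_nonneg_right hm hd.le
    have h3 : r * (z.1 - w.1) = α - w.1 := div_mul_cancel₀ _ hd.ne'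
    have h4 : (r * z.2 + (1 - r) * w.2) * (z.1 - w.1) =
        (α - w.1) * z.2 + (z.1 - α) * w.2 := by
      linear_combination (z.2 - w.2) * h3
    rw [h4] at h2
    linarith
  let V : Set ℝ := (fun z : ℝ × ℝ => (z.2 - m) / (z.1 - α)) '' {z ∈ S | α < z.1}
  obtain ⟨z₀, hz₀, hz₀α⟩ := hne
  have hVne : V.Nonempty := ⟨_, z₀, ⟨hz₀, hz₀α⟩, rfl⟩
  have hV0 : ∀ v ∈ V, 0 ≤ v := by
    rintro _ ⟨z, ⟨hz, hzα⟩, rfl⟩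
    exact div_nonneg (by linarith [hright z hz hzα]) (by linarith)
  refine ⟨sInf V, le_csInf hVne hV0, fun z hz => ?_⟩
  rcases lt_trichotomy α z.1 with h | h | h
  · have h1 : sInf V ≤ (z.2 - m) / (z.1 - α) := csInf_le ⟨0, hV0⟩ ⟨z, ⟨hz, h⟩, rfl⟩
    have h2 := (le_div_iff₀ (by linarith)).1 h1
    linarith
  · have h1 := hcross z₀ hz₀ hz₀α z hz h.ge
    rw [← h] at h1 ⊢
    have : 0 ≤ (z.2 - m) * (z₀.1 - α) := by linarith
    have := nonneg_of_mul_nonneg_left this (by linarith)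
    simp only [sub_self, mul_zero]
    linarith
  · have h1 : (m - z.2) / (α - z.1) ≤ sInf V := by
      refine le_csInf hVne ?_
      rintro _ ⟨w, ⟨hw, hwα⟩, rfl⟩
      rw [div_le_div_iff₀ (by linarith) (by linarith)]
      exact hcross w hw hwα z hz h.le
    have h2 := (div_le_iff₀ (by linarith)).1 h1
    linarith

end Duality

section Densities

variable {X : Type*} [Fintype X]

lemma normEnt_const_mul {π : X → ℝ} {g : X → ℝ} (hg : ∀ a, 0 ≤ g a) {c : ℝ} (hc : 0 < c) :
    normEnt π (fun a => c * g a) = normEnt π g := by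
  have h1 : mean π (fun a => c * g a * Real.log (c * g a)) =
      c * mean π (fun a => g a * Real.log (g a)) + c * Real.log c * mean π g := by
    rw [← mean_const_mul, ← mean_const_mul, ← mean_add]
    congr 1
    funext a
    rcases (hg a).eq_or_lt with h | h
    · simp [← h]
    · rw [Real.log_mul hc.ne' h.ne']
      ring
  rcases eq_or_ne (mean π g) 0 with h0 | h0
  · simp [normEnt, mean_const_mul, h0]
  · rw [normEnt, normEnt, ent, ent, h1, mean_const_mul, Real.log_mul hc.ne' h0]
    field_simp
    ring

/-- The relative entropy of `Q` with respect to `π`. -/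
def relEnt (π Q : X → ℝ) : ℝ := normEnt π fun a => Q a / π a

/-- The `q`-th root of the density of `Q` with respect to `π`. -/
def rootDensity {X : Type*} (π : X → ℝ) (q : ℝ) (Q : X → ℝ) (a : X) : ℝ := (Q a / π a) ^ (1 / q)

lemma rootDensity_nonneg {X : Type*} {π : X → ℝ} (hpos : ∀ a, 0 < π a) (q : ℝ) {Q : X → ℝ}
    (hQ : ∀ a, 0 ≤ Q a) (a : X) : 0 ≤ rootDensity π q Q a :=
  Real.rpow_nonneg (div_nonneg (hQ a) (hpos a).le) _

lemma rootDensity_rpow {X : Type*} {π : X → ℝ} (hpos : ∀ a, 0 < π a) {q : ℝ} (hq : 0 < q)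
    {Q : X → ℝ} (hQ : ∀ a, 0 ≤ Q a) (a : X) : rootDensity π q Q a ^ q = Q a / π a := by
  rw [rootDensity, ← Real.rpow_mul (div_nonneg (hQ a) (hpos a).le), one_div_mul_cancel hq.ne',
    Real.rpow_one]

lemma mean_rootDensity_rpow {π : X → ℝ} (hpos : ∀ a, 0 < π a) {q : ℝ} (hq : 0 < q)
    {Q : X → ℝ} (hQ : Q ∈ stdSimplex ℝ X) : mean π (fun a => rootDensity π q Q a ^ q) = 1 := by
  simp only [rootDensity_rpow hpos hq hQ.1, mean, mul_div_cancel₀ _ (hpos _).ne']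
  exact hQ.2

lemma admissible_rootDensity {π : X → ℝ} (hpos : ∀ a, 0 < π a) {q : ℝ} (hq : 0 < q)
    {Q : X → ℝ} (hQ : Q ∈ stdSimplex ℝ X) : Admissible (rootDensity π q Q) := by
  refine ⟨rootDensity_nonneg hpos q hQ.1, fun h => ?_⟩
  have := mean_rootDensity_rpow hpos hq hQ
  simp [h, mean, Real.zero_rpow hq.ne'] at this

lemma relEnt_eq_sum {π : X → ℝ} (hpos : ∀ a, 0 < π a) {Q : X → ℝ} (hQ : Q ∈ stdSimplex ℝ X) :
    relEnt π Q = ∑ a, Q a * Real.log (Q a / π a) := by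
  have h1 : mean π (fun a => Q a / π a) = 1 := by
    simp only [mean, mul_div_cancel₀ _ (hpos _).ne']
    exact hQ.2
  rw [relEnt, normEnt, ent, h1]
  simp only [mean, Real.log_one, mul_zero, sub_zero, div_one]
  exact Finset.sum_congr rfl fun a _ => by
    rw [← mul_assoc, mul_div_cancel₀ _ (hpos a).ne']

lemma logSobolev_le_rootDensity {L : Matrix X X ℝ} {π : X → ℝ} (hpos : ∀ a, 0 < π a) {q : ℝ}
    (hq : 0 < q) {Q : X → ℝ} (hQ : Q ∈ stdSimplex ℝ X) (hr : Regular L q (rootDensity π q Q))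
    {b : ℝ} (hb : b ≤ relEnt π Q) :
    logSobolev L π q b ≤ (energyForm L π q (rootDensity π q Q) : EReal) := by
  have := logSobolev_le (π := π) hq (admissible_rootDensity hpos hq hQ) hr (b := b) (by
    simpa only [rootDensity_rpow hpos hq hQ.1, relEnt] using hb)
  rwa [mean_rootDensity_rpow hpos hq hQ, div_one] at this

lemma convEnvelope_le_mix {L : Matrix X X ℝ} {π : X → ℝ} (hpos : ∀ a, 0 < π a) {q : ℝ}
    (hq : 0 < q) {Q R : X → ℝ} (hQ : Q ∈ stdSimplex ℝ X) (hR : R ∈ stdSimplex ℝ X)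
    (hrQ : Regular L q (rootDensity π q Q)) (hrR : Regular L q (rootDensity π q R))
    {t α : ℝ} (ht : t ∈ Set.Icc (0 : ℝ) 1) (hα : α ≤ t * relEnt π Q + (1 - t) * relEnt π R) :
    convEnvelope (logSobolev L π q) α ≤ ((t * energyForm L π q (rootDensity π q Q) +
      (1 - t) * energyForm L π q (rootDensity π q R) : ℝ) : EReal) := by
  have := convEnvelope_le_of_combination (g := logSobolev L π q) (κ := Fin 2) (w := ![t, 1 - t])
    (a := ![relEnt π Q, relEnt π R])
    (c := ![energyForm L π q (rootDensity π q Q), energyForm L π q (rootDensity π q R)])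
    (α := α) (by
      intro i
      fin_cases i
      · exact ht.1
      · exact sub_nonneg.2 ht.2) (by simp) (by
      intro i _ b hb
      fin_cases i
      · exact logSobolev_le_rootDensity hpos hq hQ hrQ hb
      · exact logSobolev_le_rootDensity hpos hq hR hrR hb) (by simpa using hα)
  simpa using this

/-- Every admissible function is, up to scaling, the root of a density. -/
lemma exists_rootDensity {L : Matrix X X ℝ} (hsymm : L.IsSymm)
    (hoff : ∀ x y, x ≠ y → 0 ≤ L x y) (hrow : ∀ x, ∑ y, L x y = 0)
    {π : X → ℝ} (hpos : ∀ a, 0 < π a) {q : ℝ} (hq : 0 < q) {f : X → ℝ} (hf : Admissible f)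
    (hr : Regular L q f) : ∃ Q ∈ stdSimplex ℝ X, (∀ a, 0 < f a → 0 < Q a) ∧
      relEnt π Q = normEnt π (fun a => f a ^ q) ∧
      energyForm L π q (rootDensity π q Q) =
        energyForm L π q f / mean π (fun a => f a ^ q) := by
  have hE := mean_pos hpos (admissible_rpow hf q)
  set E := mean π (fun a => f a ^ q) with hEdef
  have hd : ∀ a, π a * f a ^ q / E / π a = E⁻¹ * f a ^ q := fun a => by
    have := (hpos a).ne'
    field_simp
  have hroot : rootDensity π q (fun a => π a * f a ^ q / E) =
      fun a => E⁻¹ ^ (1 / q) * f a := by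
    funext a
    rw [rootDensity, hd, Real.mul_rpow (inv_nonneg.2 hE.le) (Real.rpow_nonneg (hf.1 a) q),
      ← Real.rpow_mul (hf.1 a), mul_one_div_cancel hq.ne', Real.rpow_one]
  refine ⟨fun a => π a * f a ^ q / E, ⟨fun a => ?_, ?_⟩, fun a ha => ?_, ?_, ?_⟩
  · exact div_nonneg (mul_nonneg (hpos a).le (Real.rpow_nonneg (hf.1 a) q)) hE.le
  · rw [← Finset.sum_div]
    exact div_self hE.ne'
  · exact div_pos (mul_pos (hpos a) (Real.rpow_pos_of_pos ha q)) hE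
  · simp only [relEnt, hd]
    exact normEnt_const_mul (fun a => Real.rpow_nonneg (hf.1 a) q) (inv_pos.2 hE)
  · rw [hroot, energyForm_smul hsymm hoff hrow π hf.1 hr
      (Real.rpow_pos_of_pos (inv_pos.2 hE) _), ← Real.rpow_mul (inv_nonneg.2 hE.le),
      one_div_mul_cancel hq.ne', Real.rpow_one, inv_mul_eq_div]

lemma energyForm_one_add_const_le {L : Matrix X X ℝ} (hsymm : L.IsSymm)
    (hoff : ∀ x y, x ≠ y → 0 ≤ L x y) (hrow : ∀ x, ∑ y, L x y = 0)
    {π : X → ℝ} (hpos : ∀ a, 0 < π a) {f : X → ℝ} (hf : ∀ a, 0 ≤ f a)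
    (hr : Regular L 1 f) {η : ℝ} (hη : 0 < η) :
    energyForm L π 1 (fun a => f a + η) ≤ energyForm L π 1 f := by
  have mono : ∀ s t : ℝ, 0 < s → s ≤ t → (t + η - (s + η)) *
      (Real.log (t + η) - Real.log (s + η)) ≤ (t - s) * (Real.log t - Real.log s) := by
    intro s t hs hst
    rw [add_sub_add_right_eq_sub]
    refine mul_le_mul_of_nonneg_left ?_ (by linarith)
    rw [← Real.log_div (by linarith) (by linarith), ← Real.log_div (by linarith) (by linarith)]
    refine Real.log_le_log (by apply div_pos <;> linarith) ?_
    rw [div_le_div_iff₀ (by linarith) hs]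
    nlinarith
  rw [energyForm, energyForm, if_pos rfl, if_pos rfl, dirichlet_eq hrow, dirichlet_eq hrow]
  refine mul_le_mul_of_nonneg_left (Finset.sum_le_sum fun x _ => Finset.sum_le_sum fun y _ =>
    mul_le_mul_of_nonneg_left ?_ (hpos x).le) (by norm_num)
  rcases eq_or_ne x y with rfl | hxy
  · simp
  rcases (hoff x y hxy).eq_or_lt with h0 | h0
  · simp [← h0]
  refine mul_le_mul_of_nonneg_left ?_ h0.le
  rcases hr.pos_pos hsymm hf le_rfl h0 with ⟨h1, h2⟩ | ⟨h1, h2⟩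
  · simp [h1, h2]
  · rcases le_total (f x) (f y) with h | h
    · exact mono _ _ h1 h
    · have := mono _ _ h2 h
      linarith [this]

lemma tendsto_normEnt_add_const {π : X → ℝ} (hpos : ∀ a, 0 < π a) {f : X → ℝ}
    (hf : Admissible f) :
    Tendsto (fun η : ℝ => normEnt π (fun a => f a + η)) (𝓝[>] 0) (𝓝 (normEnt π f)) := by
  have h0 : mean π f ≠ 0 := (mean_pos hpos hf).ne'
  have hm : Tendsto (fun η : ℝ => mean π (fun a => f a + η)) (𝓝[>] 0) (𝓝 (mean π f)) := by
    refine Tendsto.mono_left ?_ nhdsWithin_le_nhds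
    have : Continuous fun η : ℝ => mean π (fun a => f a + η) := by
      unfold mean
      fun_prop
    simpa using this.tendsto 0
  have hl : Tendsto (fun η : ℝ => mean π (fun a => (f a + η) * Real.log (f a + η))) (𝓝[>] 0)
      (𝓝 (mean π (fun a => f a * Real.log (f a)))) := by
    refine Tendsto.mono_left ?_ nhdsWithin_le_nhds
    have : Continuous fun η : ℝ => mean π (fun a => (f a + η) * Real.log (f a + η)) := by
      unfold mean
      refine continuous_finsetSum _ fun a _ => continuous_const.mul ?_
      exact Real.continuous_mul_log.comp (continuous_const.add continuous_id)
    simpa using this.tendsto 0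
  exact (hl.sub (hm.mul (hm.log h0))).div hm h0

/-- The affine minorant given by duality bounds the convex envelope from below, if bounds on the
class `T` of distributions extend to all admissible functions. -/
lemma le_convEnvelope_of_mix {L : Matrix X X ℝ} {π : X → ℝ} {q : ℝ} (hq : 0 < q) {T : Set (X → ℝ)}
    {α m : ℝ} (hne : ∃ Q ∈ T, α < relEnt π Q)
    (hcover : ∀ μ, 0 ≤ μ → (∀ Q ∈ T, m + μ * (relEnt π Q - α) ≤
      energyForm L π q (rootDensity π q Q)) → ∀ f : X → ℝ, Admissible f → Regular L q f →
        m + μ * (normEnt π (fun a => f a ^ q) - α) ≤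
          energyForm L π q f / mean π (fun a => f a ^ q))
    (hm : ∀ Q ∈ T, ∀ R ∈ T, ∀ t ∈ Set.Icc (0 : ℝ) 1,
      α < t * relEnt π Q + (1 - t) * relEnt π R →
      m ≤ t * energyForm L π q (rootDensity π q Q) +
        (1 - t) * energyForm L π q (rootDensity π q R)) :
    (m : EReal) ≤ convEnvelope (logSobolev L π q) α := by
  obtain ⟨μ, hμ, hS⟩ := exists_slope (α := α) (m := m)
    (S := (fun Q => (relEnt π Q, energyForm L π q (rootDensity π q Q))) '' T)
    (by
      rintro _ ⟨Q, hQ, rfl⟩ _ ⟨R, hR, rfl⟩ t ht h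
      exact hm Q hQ R hR t ht h)
    (by
      obtain ⟨Q, hQ, h⟩ := hne
      exact ⟨_, ⟨Q, hQ, rfl⟩, h⟩)
  refine le_convEnvelope_of_affine (μ := μ) fun a => ?_
  rw [logSobolev, if_neg hq.ne']
  refine le_iInf₂ fun f hf => ?_
  by_cases hr : Regular L q f
  · rw [energy_eq hq.ne' hf.1.1 hr, EReal.coe_le_coe_iff]
    refine le_trans ?_ (hcover μ hμ (fun Q hQ => hS _ ⟨Q, hQ, rfl⟩) f hf.1 hr)
    have := mul_le_mul_of_nonneg_left hf.2 hμ
    linarith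
  · rw [energy_eq_top hr]
    exact le_top

lemma exists_relEnt_eq [Nonempty X] {π : X → ℝ} (hpos : ∀ a, 0 < π a) :
    ∃ Q ∈ stdSimplex ℝ X, relEnt π Q = -Real.log (⨅ x, π x) := by
  classical
  obtain ⟨x₀, hx₀⟩ := exists_eq_ciInf_of_finite (f := π)
  refine ⟨Pi.single x₀ 1, single_mem_stdSimplex ℝ x₀, ?_⟩
  rw [relEnt_eq_sum hpos (single_mem_stdSimplex ℝ x₀), Finset.sum_eq_single x₀]
  · rw [Pi.single_eq_same, ← hx₀, one_mul, one_div, Real.log_inv]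
  · intro a _ ha
    rw [Pi.single_eq_of_ne ha, zero_mul]
  · simp

lemma le_convEnvelope_of_one_lt [Nonempty X] {L : Matrix X X ℝ} (hsymm : L.IsSymm)
    (hoff : ∀ x y, x ≠ y → 0 ≤ L x y) (hrow : ∀ x, ∑ y, L x y = 0)
    {π : X → ℝ} (hpos : ∀ a, 0 < π a) {q : ℝ} (hq : 1 < q) {α m : ℝ}
    (hα : α < -Real.log (⨅ x, π x))
    (hm : ∀ Q ∈ stdSimplex ℝ X, ∀ R ∈ stdSimplex ℝ X, ∀ t ∈ Set.Icc (0 : ℝ) 1,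
      α < t * relEnt π Q + (1 - t) * relEnt π R →
      m ≤ t * energyForm L π q (rootDensity π q Q) +
        (1 - t) * energyForm L π q (rootDensity π q R)) :
    (m : EReal) ≤ convEnvelope (logSobolev L π q) α := by
  have hq0 : 0 < q := by linarith
  refine le_convEnvelope_of_mix hq0 ?_ ?_ hm
  · obtain ⟨Q, hQ, h⟩ := exists_relEnt_eq hpos
    exact ⟨Q, hQ, h ▸ hα⟩
  · intro μ _ h f hf hr
    obtain ⟨Q, hQ, -, h1, h2⟩ := exists_rootDensity hsymm hoff hrow hpos hq0 hf hr
    rw [← h1, ← h2]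
    exact h Q hQ

lemma exists_pos_rootDensity [Nonempty X] {L : Matrix X X ℝ} (hsymm : L.IsSymm)
    (hoff : ∀ x y, x ≠ y → 0 ≤ L x y) (hrow : ∀ x, ∑ y, L x y = 0)
    {π : X → ℝ} (hpos : ∀ a, 0 < π a) {f : X → ℝ} (hf : Admissible f) {η : ℝ} (hη : 0 < η) :
    ∃ Q ∈ {Q ∈ stdSimplex ℝ X | ∀ a, 0 < Q a}, relEnt π Q = normEnt π (fun a => f a + η) ∧
      energyForm L π 1 (rootDensity π 1 Q) =
        energyForm L π 1 (fun a => f a + η) / mean π (fun a => f a + η) := by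
  have hp : ∀ a, 0 < f a + η := fun a => by linarith [hf.1 a]
  obtain ⟨Q, hQ, h0, h1, h2⟩ := exists_rootDensity hsymm hoff hrow hpos one_pos
    (f := fun a => f a + η) ⟨fun a => (hp a).le, fun h => by
      obtain ⟨a⟩ := ‹Nonempty X›
      exact (hp a).ne' (congrFun h a)⟩ (regular_of_pos L 1 hp)
  simp only [Real.rpow_one] at h1 h2
  exact ⟨Q, ⟨hQ, fun a => h0 a (hp a)⟩, h1, h2⟩

lemma exists_pos_lt_relEnt [Nonempty X] {L : Matrix X X ℝ} (hsymm : L.IsSymm)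
    (hoff : ∀ x y, x ≠ y → 0 ≤ L x y) (hrow : ∀ x, ∑ y, L x y = 0)
    {π : X → ℝ} (hpos : ∀ a, 0 < π a)
    {α : ℝ} (hα : α < -Real.log (⨅ x, π x)) :
    ∃ Q ∈ {Q ∈ stdSimplex ℝ X | ∀ a, 0 < Q a}, α < relEnt π Q := by
  obtain ⟨Q, hQ, h⟩ := exists_relEnt_eq hpos
  have hadm := admissible_rootDensity hpos one_pos hQ
  have h1 : normEnt π (rootDensity π 1 Q) = relEnt π Q := by
    rw [relEnt]
    congr 1
    funext a
    simp [rootDensity]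
  have := (tendsto_normEnt_add_const hpos hadm).eventually_const_lt (h1 ▸ h ▸ hα)
  obtain ⟨η, hη, hη0⟩ := (this.and self_mem_nhdsWithin).exists
  obtain ⟨Q', hQ', h2, -⟩ := exists_pos_rootDensity hsymm hoff hrow hpos hadm hη0
  exact ⟨Q', hQ', h2 ▸ hη⟩

lemma le_convEnvelope_of_eq_one [Nonempty X] {L : Matrix X X ℝ} (hsymm : L.IsSymm)
    (hoff : ∀ x y, x ≠ y → 0 ≤ L x y) (hrow : ∀ x, ∑ y, L x y = 0)
    {π : X → ℝ} (hpos : ∀ a, 0 < π a) {α m : ℝ}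
    (hα : α < -Real.log (⨅ x, π x))
    (hm : ∀ Q ∈ {Q ∈ stdSimplex ℝ X | ∀ a, 0 < Q a}, ∀ R ∈ {Q ∈ stdSimplex ℝ X | ∀ a, 0 < Q a},
      ∀ t ∈ Set.Icc (0 : ℝ) 1, α < t * relEnt π Q + (1 - t) * relEnt π R →
      m ≤ t * energyForm L π 1 (rootDensity π 1 Q) +
        (1 - t) * energyForm L π 1 (rootDensity π 1 R)) :
    (m : EReal) ≤ convEnvelope (logSobolev L π 1) α := by
  refine le_convEnvelope_of_mix one_pos (exists_pos_lt_relEnt hsymm hoff hrow hpos hα) ?_ hm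
  · intro μ _ h f hf hr
    simp only [Real.rpow_one]
    have hlim : Tendsto (fun η : ℝ => m + μ * (normEnt π (fun a => f a + η) - α)) (𝓝[>] 0)
        (𝓝 (m + μ * (normEnt π f - α))) :=
      (((tendsto_normEnt_add_const hpos hf).sub_const α).const_mul μ).const_add m
    refine le_of_tendsto hlim ?_
    filter_upwards [self_mem_nhdsWithin] with η hη
    obtain ⟨Q, hQ, h1, h2⟩ := exists_pos_rootDensity hsymm hoff hrow hpos hf hη
    refine le_trans (h1 ▸ h Q hQ) ?_
    rw [h2]
    have hm := mean_pos hpos hf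
    refine div_le_div₀ (energyForm_nonneg hsymm hoff hrow (fun a => (hpos a).le) hf.1 hr)
      (energyForm_one_add_const_le hsymm hoff hrow hpos hf.1 hr hη) hm ?_
    exact mean_mono (fun a => (hpos a).le) fun a => by linarith [Set.mem_Ioi.1 hη]

/-- Almost optimal mixtures with strict inequality in the entropy constraint. -/
lemma exists_mix_lt {L : Matrix X X ℝ} {π : X → ℝ} {q : ℝ} {T : Set (X → ℝ)} {α : ℝ}
    (hJ : ∀ Q ∈ T, 0 ≤ energyForm L π q (rootDensity π q Q))
    (hne : ∃ Q ∈ T, α < relEnt π Q)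
    (hle : ∀ m : ℝ, 0 ≤ m → (∀ Q ∈ T, ∀ R ∈ T, ∀ t ∈ Set.Icc (0 : ℝ) 1,
      α < t * relEnt π Q + (1 - t) * relEnt π R →
      m ≤ t * energyForm L π q (rootDensity π q Q) +
        (1 - t) * energyForm L π q (rootDensity π q R)) →
      (m : EReal) ≤ convEnvelope (logSobolev L π q) α) {δ : ℝ} (hδ : 0 < δ) :
    ∃ Q ∈ T, ∃ R ∈ T, ∃ t ∈ Set.Icc (0 : ℝ) 1, α < t * relEnt π Q + (1 - t) * relEnt π R ∧
      ((t * energyForm L π q (rootDensity π q Q) +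
        (1 - t) * energyForm L π q (rootDensity π q R) : ℝ) : EReal) ≤
          convEnvelope (logSobolev L π q) α + (δ : EReal) := by
  let V : Set ℝ := {v | ∃ Q ∈ T, ∃ R ∈ T, ∃ t ∈ Set.Icc (0 : ℝ) 1,
    α < t * relEnt π Q + (1 - t) * relEnt π R ∧ t * energyForm L π q (rootDensity π q Q) +
        (1 - t) * energyForm L π q (rootDensity π q R) = v}
  have hV0 : ∀ v ∈ V, 0 ≤ v := by
    rintro _ ⟨Q, hQ, R, hR, t, ht, -, rfl⟩
    exact add_nonneg (mul_nonneg ht.1 (hJ Q hQ)) (mul_nonneg (sub_nonneg.2 ht.2) (hJ R hR))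
  have hVne : V.Nonempty := by
    obtain ⟨Q, hQ, h⟩ := hne
    exact ⟨_, Q, hQ, Q, hQ, 1, by simp, by simpa using h, rfl⟩
  have hm := hle (sInf V) (le_csInf hVne hV0) fun Q hQ R hR t ht h =>
    csInf_le ⟨0, hV0⟩ ⟨Q, hQ, R, hR, t, ht, h, rfl⟩
  obtain ⟨v, ⟨Q, hQ, R, hR, t, ht, h, rfl⟩, hv⟩ := exists_lt_of_csInf_lt hVne
    (lt_add_of_pos_right (sInf V) hδ)
  refine ⟨Q, hQ, R, hR, t, ht, h, ?_⟩
  calc _ ≤ ((sInf V + δ : ℝ) : EReal) := EReal.coe_le_coe_iff.2 hv.le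
    _ = ((sInf V : ℝ) : EReal) + (δ : EReal) := EReal.coe_add _ _
    _ ≤ _ := add_le_add_left hm _

lemma continuous_energyForm_rootDensity {L : Matrix X X ℝ} (hrow : ∀ x, ∑ y, L x y = 0)
    (π : X → ℝ) {q : ℝ} (hq : 1 < q) :
    Continuous fun Q : X → ℝ => energyForm L π q (rootDensity π q Q) := by
  simp only [energyForm, if_neg hq.ne', dirichlet_eq hrow]
  have h1 : ∀ a, Continuous fun Q : X → ℝ => rootDensity π q Q a := fun a =>
    ((continuous_apply a).div_const _).rpow_const fun _ => Or.inr (by positivity)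
  have h2 : ∀ a, Continuous fun Q : X → ℝ => rootDensity π q Q a ^ (q - 1) := fun a =>
    (h1 a).rpow_const fun _ => Or.inr (by linarith)
  refine continuous_const.mul (continuous_const.mul (continuous_finsetSum _ fun x _ =>
    continuous_finsetSum _ fun y _ => ?_))
  exact continuous_const.mul (continuous_const.mul
    (((h1 y).sub (h1 x)).mul ((h2 y).sub (h2 x))))

lemma continuousOn_relEnt {π : X → ℝ} (hpos : ∀ a, 0 < π a) :
    ContinuousOn (relEnt π) (stdSimplex ℝ X) := by
  have : Continuous fun Q : X → ℝ => ∑ a, π a * (Q a / π a * Real.log (Q a / π a)) :=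
    continuous_finsetSum _ fun a _ => continuous_const.mul
      (Real.continuous_mul_log.comp ((continuous_apply a).div_const _))
  refine this.continuousOn.congr fun Q hQ => ?_
  rw [relEnt_eq_sum hpos hQ]
  exact Finset.sum_congr rfl fun a _ => by
    rw [← mul_assoc, mul_div_cancel₀ _ (hpos a).ne']

/-- For `q > 1` the convex envelope is attained by a mixture of two distributions. -/
lemma exists_mix_eq [Nonempty X] {L : Matrix X X ℝ} (hsymm : L.IsSymm)
    (hoff : ∀ x y, x ≠ y → 0 ≤ L x y) (hrow : ∀ x, ∑ y, L x y = 0)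
    {π : X → ℝ} (hpos : ∀ a, 0 < π a) {q : ℝ} (hq : 1 < q) {α : ℝ}
    (hα : α < -Real.log (⨅ x, π x)) :
    ∃ Q ∈ stdSimplex ℝ X, ∃ R ∈ stdSimplex ℝ X, ∃ t ∈ Set.Icc (0 : ℝ) 1,
      α ≤ t * relEnt π Q + (1 - t) * relEnt π R ∧
      convEnvelope (logSobolev L π q) α = ((t * energyForm L π q (rootDensity π q Q) +
        (1 - t) * energyForm L π q (rootDensity π q R) : ℝ) : EReal) := by
  have hq0 : 0 < q := by linarith
  let K : Set ((X → ℝ) × (X → ℝ) × ℝ) := stdSimplex ℝ X ×ˢ stdSimplex ℝ X ×ˢ Set.Icc 0 1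
  have hK : IsCompact K :=
    (isCompact_stdSimplex ℝ X).prod ((isCompact_stdSimplex ℝ X).prod isCompact_Icc)
  let D : (X → ℝ) × (X → ℝ) × ℝ → ℝ := fun z =>
    z.2.2 * relEnt π z.1 + (1 - z.2.2) * relEnt π z.2.1
  let J : (X → ℝ) × (X → ℝ) × ℝ → ℝ := fun z =>
    z.2.2 * energyForm L π q (rootDensity π q z.1) +
      (1 - z.2.2) * energyForm L π q (rootDensity π q z.2.1)
  have hJ : Continuous J := by
    have h := continuous_energyForm_rootDensity hrow π hq
    have h1 := h.comp (continuous_fst : Continuous fun z : (X → ℝ) × (X → ℝ) × ℝ => z.1)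
    have h2 := h.comp (continuous_fst.comp continuous_snd :
      Continuous fun z : (X → ℝ) × (X → ℝ) × ℝ => z.2.1)
    have h3 : Continuous fun z : (X → ℝ) × (X → ℝ) × ℝ => z.2.2 := by fun_prop
    exact (h3.mul h1).add ((continuous_const.sub h3).mul h2)
  have hD : ContinuousOn D K := by
    have h := continuousOn_relEnt hpos
    have h1 : ContinuousOn (fun z : (X → ℝ) × (X → ℝ) × ℝ => relEnt π z.1) K :=
      h.comp continuous_fst.continuousOn fun z hz => hz.1
    have h2 : ContinuousOn (fun z : (X → ℝ) × (X → ℝ) × ℝ => relEnt π z.2.1) K :=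
      h.comp (by fun_prop : Continuous fun z : (X → ℝ) × (X → ℝ) × ℝ => z.2.1).continuousOn
        fun z hz => hz.2.1
    have h3 : ContinuousOn (fun z : (X → ℝ) × (X → ℝ) × ℝ => z.2.2) K :=
      (by fun_prop : Continuous fun z : (X → ℝ) × (X → ℝ) × ℝ => z.2.2).continuousOn
    exact (h3.mul h1).add ((continuousOn_const.sub h3).mul h2)
  have hC : IsCompact (K ∩ D ⁻¹' Set.Ici α) := by
    obtain ⟨u, hu, hu'⟩ := continuousOn_iff_isClosed.1 hD _ (isClosed_Ici (a := α))
    rw [Set.inter_comm, hu', Set.inter_comm]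
    exact hK.inter_right hu
  obtain ⟨Q₀, hQ₀, h₀⟩ := exists_relEnt_eq hpos
  have hne : (K ∩ D ⁻¹' Set.Ici α).Nonempty := by
    refine ⟨(Q₀, Q₀, 1), ⟨hQ₀, hQ₀, by simp⟩, ?_⟩
    simp only [D, Set.mem_preimage, Set.mem_Ici, h₀]
    linarith
  obtain ⟨z, ⟨hzK, hzD⟩, hz⟩ := hC.exists_isMinOn hne hJ.continuousOn
  refine ⟨z.1, hzK.1, z.2.1, hzK.2.1, z.2.2, hzK.2.2, hzD, le_antisymm ?_ ?_⟩
  · exact convEnvelope_le_mix hpos hq0 hzK.1 hzK.2.1 (regular_of_one_lt L hq _)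
      (regular_of_one_lt L hq _) hzK.2.2 hzD
  · refine le_convEnvelope_of_one_lt hsymm hoff hrow hpos hq hα fun Q hQ R hR t ht h => ?_
    exact isMinOn_iff.1 hz (Q, R, t) ⟨⟨hQ, hR, ht⟩, h.le⟩

end Densities

section Perturbation

variable {X : Type*} [Fintype X] {ι : Type*} [Fintype ι] [DecidableEq ι]

open scoped Classical in
/-- The probability of an event under a product distribution. -/
def piProb (Q : ι → X → ℝ) (A : Set (ι → X)) : ℝ :=
  mean (piDist Q) fun x => if x ∈ A then 1 else 0

lemma piProb_nonneg {Q : ι → X → ℝ} (hQ : ∀ i, Q i ∈ stdSimplex ℝ X) (A : Set (ι → X)) :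
    0 ≤ piProb Q A :=
  mean_nonneg (piDist_nonneg fun i => (hQ i).1) fun x => by positivity

lemma mul_piProb_update_le {Q : ι → X → ℝ} (hQ : ∀ i, Q i ∈ stdSimplex ℝ X) (A : Set (ι → X))
    (k : ι) (a : X) :
    Q k a * piProb Q {x | Function.update x k a ∈ A} ≤ piProb Q A := by
  classical
  simp only [piProb]
  rw [← mean_piDist_resample k (hQ k).2 (fun x => if x ∈ A then (1 : ℝ) else 0),
    ← mean_const_mul]
  refine mean_mono (piDist_nonneg fun i => (hQ i).1) fun x => ?_
  exact Finset.single_le_sum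
    (f := fun b => Q k b * if Function.update x k b ∈ A then (1 : ℝ) else 0)
    (fun b _ => mul_nonneg ((hQ k).1 b) (by positivity)) (Finset.mem_univ a)

/-- A bounded function that takes the value `h` unless a change of the coordinate `k` leaves `A`
has expectation close to `h`, if `A` is likely. -/
lemma abs_mean_sub_le {Q : ι → X → ℝ} (hQ : ∀ i, Q i ∈ stdSimplex ℝ X) (A : Set (ι → X)) (k : ι)
    {H : (ι → X) → ℝ} {h C : ℝ} (hH : ∀ x, |H x| ≤ C) (hh : |h| ≤ C)
    (hgood : ∀ x, (∀ a, 0 < Q k a → Function.update x k a ∈ A) → H x = h) :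
    |mean (piDist Q) H - h| ≤ 2 * C * (∑ a, (Q k a)⁻¹) * piProb Q Aᶜ := by
  classical
  have hC : 0 ≤ C := (abs_nonneg _).trans hh
  have hP := piDist_nonneg (fun i => (hQ i).1)
  have e1 : mean (piDist Q) H - h = mean (piDist Q) (fun x => H x - h) := by
    simp only [mean, mul_sub, Finset.sum_sub_distrib, ← Finset.sum_mul,
      sum_piDist fun i => (hQ i).2, one_mul]
  have hpt : ∀ x, |H x - h| ≤ ∑ a, 2 * C *
      (if 0 < Q k a then (if Function.update x k a ∈ Aᶜ then 1 else 0) else 0) := by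
    intro x
    by_cases hx : ∀ a, 0 < Q k a → Function.update x k a ∈ A
    · rw [hgood x hx, sub_self, abs_zero]
      exact Finset.sum_nonneg fun a _ => by positivity
    · push Not at hx
      obtain ⟨a, ha, hxa⟩ := hx
      refine le_trans ?_ (Finset.single_le_sum (fun a _ => by positivity) (Finset.mem_univ a))
      rw [if_pos ha, if_pos (Set.mem_compl hxa), mul_one]
      exact (abs_sub _ _).trans (by linarith [hH x])
  rw [e1]
  calc |mean (piDist Q) (fun x => H x - h)| ≤ mean (piDist Q) (fun x => |H x - h|) := by
        refine (Finset.abs_sum_le_sum_abs _ _).trans (le_of_eq (Finset.sum_congr rfl fun x _ => ?_))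
        rw [abs_mul, abs_of_nonneg (hP x)]
    _ ≤ mean (piDist Q) (fun x => ∑ a, 2 * C *
      (if 0 < Q k a then (if Function.update x k a ∈ Aᶜ then 1 else 0) else 0)) := mean_mono hP hpt
    _ = ∑ a, 2 * C * if 0 < Q k a then piProb Q {x | Function.update x k a ∈ Aᶜ} else 0 := by
        simp only [mean, Finset.mul_sum, piProb]
        rw [Finset.sum_comm]
        refine Finset.sum_congr rfl fun a _ => ?_
        split_ifs
        · rw [Finset.mul_sum]
          exact Finset.sum_congr rfl fun x _ => by
            simp only [Set.mem_ofPred_eq]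
            rw [mul_left_comm]
            congr!
        · simp
    _ ≤ ∑ a, 2 * C * ((Q k a)⁻¹ * piProb Q Aᶜ) := by
        refine Finset.sum_le_sum fun a _ => mul_le_mul_of_nonneg_left ?_ (by positivity)
        split_ifs with ha
        · rw [inv_mul_eq_div, le_div_iff₀ ha, mul_comm]
          exact mul_piProb_update_le hQ _ k a
        · exact mul_nonneg (inv_nonneg.2 ((hQ k).1 a)) (piProb_nonneg hQ _)
    _ = 2 * C * (∑ a, (Q k a)⁻¹) * piProb Q Aᶜ := by
        rw [Finset.mul_sum, Finset.sum_mul]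
        exact Finset.sum_congr rfl fun a _ => by ring

/-- The second moment of a sum of independent centred variables. -/
lemma mean_sq_sum_eq {Q : ι → X → ℝ} (hQ : ∀ i, Q i ∈ stdSimplex ℝ X) {h : ι → X → ℝ}
    (h0 : ∀ i, mean (Q i) (h i) = 0) :
    mean (piDist Q) (fun x => (∑ i, h i (x i)) ^ 2) =
      ∑ i, mean (Q i) (fun a => h i a ^ 2) := by
  have hone := sum_piDist fun i => (hQ i).2
  have hij : ∀ i j, mean (piDist Q) (fun x => h i (x i) * h j (x j)) =
      if i = j then mean (Q i) (fun a => h i a ^ 2) else 0 := by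
    intro i j
    rw [← mean_piDist_resample i (hQ i).2]
    split_ifs with hij
    · subst hij
      simp only [Function.update_self, ← sq]
      rw [mean, ← Finset.sum_mul, hone, one_mul]
    · simp only [Function.update_self, Function.update_of_ne (Ne.symm hij)]
      refine Finset.sum_eq_zero fun x _ => ?_
      simp only [mul_comm (h i _), mean_const_mul, h0, mul_zero]
  have : ∀ x : ι → X, (∑ i, h i (x i)) ^ 2 = ∑ i, ∑ j, h i (x i) * h j (x j) := fun x => by
    rw [sq, Finset.sum_mul_sum]
  simp only [this]
  calc mean (piDist Q) (fun x => ∑ i, ∑ j, h i (x i) * h j (x j))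
      = ∑ i, ∑ j, mean (piDist Q) (fun x => h i (x i) * h j (x j)) := by
        simp only [mean, Finset.mul_sum]
        rw [Finset.sum_comm]
        exact Finset.sum_congr rfl fun i _ => Finset.sum_comm
    _ = ∑ i, mean (Q i) (fun a => h i a ^ 2) := by
        simp only [hij]
        exact Finset.sum_congr rfl fun i _ => by simp

lemma prodDist_mul_prod_rpow {X ι : Type*} [Fintype ι] {π : X → ℝ} (hpos : ∀ a, 0 < π a) {q : ℝ}
    (hq : 0 < q) {Q : ι → X → ℝ} (hQ : ∀ i a, 0 ≤ Q i a) (x : ι → X) :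
    prodDist π x * (∏ i, rootDensity π q (Q i) (x i)) ^ q = piDist Q x := by
  rw [← Real.finsetProd_rpow _ _ fun i _ => rootDensity_nonneg hpos q (hQ i) _, piDist, prodDist,
    ← Finset.prod_mul_distrib]
  refine Finset.prod_congr rfl fun i _ => ?_
  rw [rootDensity_rpow hpos hq (hQ i), mul_div_cancel₀ _ (hpos _).ne']

/-- The energy form of a perturbed product of root densities. -/
lemma energyForm_perturbed {L : Matrix X X ℝ} (hsymm : L.IsSymm)
    (hoff : ∀ x y, x ≠ y → 0 ≤ L x y) (hrow : ∀ x, ∑ y, L x y = 0)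
    {π : X → ℝ} (hpos : ∀ a, 0 < π a) (hπ : ∑ a, π a = 1) {q : ℝ} (hq : 0 < q)
    {Q : ι → X → ℝ} (hQ : ∀ i, Q i ∈ stdSimplex ℝ X) {c : ℝ} (hc : 0 < c) {w : (ι → X) → ℝ}
    (hw : ∀ x, 0 ≤ w x)
    (hreg : ∀ k x, Regular L q fun a => rootDensity π q (Q k) a * w (Function.update x k a)) :
    energyForm (prodGen L) (prodDist π) q
        (fun x => c * ((∏ i, rootDensity π q (Q i) (x i)) * w x)) =
      c ^ q * ∑ k, mean (piDist Q) fun x =>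
        energyForm L π q fun a => rootDensity π q (Q k) a * w (Function.update x k a) := by
  rw [energyForm_prodGen L hπ, Finset.mul_sum]
  refine Finset.sum_congr rfl fun k _ => ?_
  have hu : ∀ i a, 0 ≤ rootDensity π q (Q i) a := fun i => rootDensity_nonneg hpos q (hQ i).1
  let G : (ι → X) → ℝ := fun x => ∏ i ∈ Finset.univ.erase k, rootDensity π q (Q i) (x i)
  have hG : ∀ x a, G (Function.update x k a) = G x := fun x a =>
    Finset.prod_congr rfl fun i hi => by rw [Function.update_of_ne (Finset.ne_of_mem_erase hi)]
  have hG0 : ∀ x, 0 ≤ G x := fun x => Finset.prod_nonneg fun i _ => hu _ _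
  have hprod : ∀ x, ∏ i, rootDensity π q (Q i) (x i) = rootDensity π q (Q k) (x k) * G x :=
    fun x => (Finset.mul_prod_erase Finset.univ _ (Finset.mem_univ k)).symm
  let Φ : (ι → X) → ℝ := fun x =>
    energyForm L π q fun a => rootDensity π q (Q k) a * w (Function.update x k a)
  have hΦ : ∀ x a, Φ (Function.update x k a) = Φ x := fun x a => by simp [Φ]
  have hslice : ∀ x, energyForm L π q (fun a => c * ((∏ i, rootDensity π q (Q i)
      (Function.update x k a i)) * w (Function.update x k a))) = c ^ q * (G x ^ q * Φ x) := by
    intro x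
    have e : (fun a => c * ((∏ i, rootDensity π q (Q i)
        (Function.update x k a i)) * w (Function.update x k a))) =
        fun a => c * G x * (rootDensity π q (Q k) a * w (Function.update x k a)) := by
      funext a
      rw [hprod, hG, Function.update_self]
      ring
    rw [e]
    rcases (hG0 x).eq_or_lt with h | h
    · rw [← h, Real.zero_rpow hq.ne']
      simp [energyForm, dirichlet, carreDuChamp, mean, Matrix.mulVec, dotProduct]
    · rw [energyForm_smul hsymm hoff hrow π (fun a => mul_nonneg (hu _ _) (hw _)) (hreg k x)
        (mul_pos hc h), Real.mul_rpow hc.le h.le, mul_assoc]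
  simp only [hslice, mean_const_mul]
  congr 1
  have hP : ∀ x, piDist Q x = prodDist π x * (G x ^ q * rootDensity π q (Q k) (x k) ^ q) := by
    intro x
    rw [← Real.mul_rpow (hG0 x) (hu _ _), mul_comm (G x), ← hprod,
      prodDist_mul_prod_rpow hpos hq fun i => (hQ i).1]
  have e2 : mean (piDist Q) Φ = mean (prodDist π)
      (fun x => G x ^ q * Φ x * rootDensity π q (Q k) (x k) ^ q) :=
    Finset.sum_congr rfl fun x _ => by
      rw [hP]
      ring
  change _ = mean (piDist Q) Φ
  rw [e2, ← mean_prodDist_resample k hπ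
    (fun x => G x ^ q * Φ x * rootDensity π q (Q k) (x k) ^ q)]
  simp only [hG, hΦ, Function.update_self, mean_const_mul, mean_rootDensity_rpow hpos hq (hQ k),
    mul_one]

lemma mean_perturbed_rpow {π : X → ℝ} (hpos : ∀ a, 0 < π a) {q : ℝ} (hq : 0 < q)
    {Q : ι → X → ℝ} (hQ : ∀ i, Q i ∈ stdSimplex ℝ X) {c : ℝ} (hc : 0 < c) {w : (ι → X) → ℝ}
    (hw : ∀ x, 0 ≤ w x) :
    mean (prodDist π) (fun x => (c * ((∏ i, rootDensity π q (Q i) (x i)) * w x)) ^ q) =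
      c ^ q * mean (piDist Q) fun x => w x ^ q := by
  have hu : ∀ i a, 0 ≤ rootDensity π q (Q i) a := fun i => rootDensity_nonneg hpos q (hQ i).1
  rw [← mean_const_mul]
  refine Finset.sum_congr rfl fun x _ => ?_
  have h0 : 0 ≤ ∏ i, rootDensity π q (Q i) (x i) := Finset.prod_nonneg fun i _ => hu _ _
  have := prodDist_mul_prod_rpow hpos hq (fun i => (hQ i).1) x
  dsimp only
  rw [Real.mul_rpow hc.le (mul_nonneg h0 (hw x)), Real.mul_rpow h0 (hw x), ← this]
  ring

lemma abs_dirichlet_le {L : Matrix X X ℝ} (hrow : ∀ x, ∑ y, L x y = 0)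
    {π : X → ℝ} (hpos : ∀ a, 0 < π a) {f g : X → ℝ} {M N : ℝ} (hM : 0 ≤ M)
    (hf : ∀ x y, |f y - f x| ≤ M) (hg : ∀ x y, |g y - g x| ≤ N) :
    |dirichlet L π f g| ≤ (∑ x, ∑ y, π x * |L x y|) * (M * N) := by
  rw [dirichlet_eq hrow, abs_mul]
  have h1 : |∑ x, ∑ y, π x * (L x y * ((f y - f x) * (g y - g x)))| ≤
      (∑ x, ∑ y, π x * |L x y|) * (M * N) := by
    simp only [Finset.sum_mul]
    refine (Finset.abs_sum_le_sum_abs _ _).trans (Finset.sum_le_sum fun x _ =>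
      (Finset.abs_sum_le_sum_abs _ _).trans (Finset.sum_le_sum fun y _ => ?_))
    rw [abs_mul, abs_mul, abs_mul, abs_of_pos (hpos x), mul_assoc]
    refine mul_le_mul_of_nonneg_left (mul_le_mul_of_nonneg_left ?_ (abs_nonneg _)) (hpos x).le
    exact mul_le_mul (hf x y) (hg x y) (abs_nonneg _) hM
  have : |(1 / 2 : ℝ)| ≤ 1 := by norm_num [abs_of_pos]
  calc _ ≤ 1 * _ := mul_le_mul this h1 (abs_nonneg _) zero_le_one
    _ = _ := one_mul _

end Perturbation

section Blocks

variable {X : Type*} [Fintype X]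

/-- The distribution `Q` on the first `m` coordinates and `R` on the others. -/
def blockDist {X : Type*} (Q R : X → ℝ) (m : ℕ) {n : ℕ} (i : Fin n) : X → ℝ :=
  if (i : ℕ) < m then Q else R

lemma blockDist_mem {Q R : X → ℝ} (hQ : Q ∈ stdSimplex ℝ X) (hR : R ∈ stdSimplex ℝ X) (m : ℕ)
    {n : ℕ} (i : Fin n) : blockDist Q R m i ∈ stdSimplex ℝ X := by
  rw [blockDist]
  split_ifs
  exacts [hQ, hR]

lemma blockDist_pos {X : Type*} {Q R : X → ℝ} (hQ : ∀ a, 0 < Q a) (hR : ∀ a, 0 < R a) (m : ℕ)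
    {n : ℕ} (i : Fin n) (a : X) : 0 < blockDist Q R m i a := by
  rw [blockDist]
  split_ifs
  exacts [hQ a, hR a]

lemma sum_ite_val_lt {m n : ℕ} (h : m ≤ n) (a b : ℝ) :
    ∑ i : Fin n, (if (i : ℕ) < m then a else b) = m * a + (n - m) * b := by
  rw [Finset.sum_ite, Finset.sum_const, Finset.sum_const, Fin.card_filter_val_lt, min_eq_right h]
  have h2 := Finset.card_filter_add_card_filter_not (s := (Finset.univ : Finset (Fin n)))
    (fun i => (i : ℕ) < m)
  rw [Fin.card_filter_val_lt, min_eq_right h, Finset.card_univ, Fintype.card_fin] at h2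
  have h3 := congrArg (Nat.cast : ℕ → ℝ) h2
  push_cast at h3
  rw [nsmul_eq_mul, nsmul_eq_mul, ← h3, add_sub_cancel_left]

lemma sum_blockDist {X : Type*} (Q R : X → ℝ) {m n : ℕ} (h : m ≤ n) (φ : (X → ℝ) → ℝ) :
    ∑ i : Fin n, φ (blockDist Q R m i) = m * φ Q + (n - m) * φ R := by
  rw [← sum_ite_val_lt h]
  refine Finset.sum_congr rfl fun i _ => ?_
  rw [blockDist]
  split_ifs <;> rfl

lemma floor_mul_le {t : ℝ} (ht : t ∈ Set.Icc (0 : ℝ) 1) (n : ℕ) : ⌊t * n⌋₊ ≤ n := by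
  refine Nat.floor_le_of_le ?_
  nlinarith [ht.2, (Nat.cast_nonneg n : (0 : ℝ) ≤ n)]

lemma tendsto_block_average {t : ℝ} (ht : t ∈ Set.Icc (0 : ℝ) 1) (a b : ℝ) :
    Tendsto (fun n : ℕ => 1 / (n : ℝ) * (⌊t * n⌋₊ * a + (n - ⌊t * n⌋₊) * b)) atTop
      (𝓝 (t * a + (1 - t) * b)) := by
  have h1 : Tendsto (fun n : ℕ => (⌊t * n⌋₊ : ℝ) / n) atTop (𝓝 t) :=
    (tendsto_nat_floor_mul_div_atTop ht.1).comp tendsto_natCast_atTop_atTop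
  have h2 : Tendsto (fun n : ℕ => (⌊t * n⌋₊ : ℝ) / n * a + (1 - (⌊t * n⌋₊ : ℝ) / n) * b) atTop
      (𝓝 (t * a + (1 - t) * b)) := (h1.mul_const a).add ((h1.const_sub 1).mul_const b)
  refine h2.congr' ?_
  filter_upwards [eventually_gt_atTop 0] with n hn
  have : (n : ℝ) ≠ 0 := by exact_mod_cast hn.ne'
  field_simp

lemma one_sub_piProb_le_mean {ι : Type*} [Fintype ι] [DecidableEq ι] {Q : ι → X → ℝ}
    (hQ : ∀ i, Q i ∈ stdSimplex ℝ X) (q : ℝ) {w : (ι → X) → ℝ} (hw0 : ∀ x, 0 ≤ w x)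
    {A : Set (ι → X)} (hA : ∀ x ∈ A, w x = 1) :
    1 - piProb Q Aᶜ ≤ mean (piDist Q) fun x => w x ^ q := by
  classical
  have e : 1 - piProb Q Aᶜ = mean (piDist Q) (fun x => 1 - if x ∈ Aᶜ then 1 else 0) := by
    simp only [piProb, mean, mul_sub, Finset.sum_sub_distrib, mul_one]
    rw [sum_piDist fun i => (hQ i).2]
    congr!
  rw [e]
  refine mean_mono (piDist_nonneg fun i => (hQ i).1) fun x => ?_
  by_cases hx : x ∈ A
  · simp [hx, hA x hx]
  · simpa [hx] using Real.rpow_nonneg (hw0 x) q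

/-- The energy per coordinate of a slightly perturbed product of root densities. -/
lemma tendsto_energy {L : Matrix X X ℝ} (hsymm : L.IsSymm)
    (hoff : ∀ x y, x ≠ y → 0 ≤ L x y) (hrow : ∀ x, ∑ y, L x y = 0)
    {π : X → ℝ} (hpos : ∀ a, 0 < π a) (hπ : ∑ a, π a = 1) {q : ℝ} (hq : 0 < q)
    {Q R : X → ℝ} (hQ : Q ∈ stdSimplex ℝ X) (hR : R ∈ stdSimplex ℝ X)
    {t : ℝ} (ht : t ∈ Set.Icc (0 : ℝ) 1) {c : ℕ → ℝ} (hc : ∀ᶠ n in atTop, 0 < c n)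
    {w : ∀ n : ℕ, (Fin n → X) → ℝ} (hw0 : ∀ n x, 0 ≤ w n x) (hw1 : ∀ n x, w n x ≤ 1)
    (hreg : 1 < q ∨ (∀ a, 0 < Q a) ∧ (∀ a, 0 < R a) ∧ ∀ n x, 0 < w n x)
    {A : ∀ n : ℕ, Set (Fin n → X)} (hA : ∀ n, ∀ x ∈ A n, w n x = 1)
    (hprob : Tendsto (fun n : ℕ => piProb (blockDist Q R ⌊t * n⌋₊) (A n)ᶜ) atTop (𝓝 0))
    {C : ℝ} (hCQ : |energyForm L π q (rootDensity π q Q)| ≤ C)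
    (hCR : |energyForm L π q (rootDensity π q R)| ≤ C)
    (hC : ∀ (n : ℕ) (k : Fin n) (x : Fin n → X), |energyForm L π q fun a =>
      rootDensity π q (blockDist Q R ⌊t * n⌋₊ k) a * w n (Function.update x k a)| ≤ C) :
    Tendsto (fun n : ℕ => ((1 / n : ℝ) : EReal) * energy (prodGen L) (prodDist π) q
      (fun x : Fin n → X => c n *
        ((∏ i, rootDensity π q (blockDist Q R ⌊t * n⌋₊ i) (x i)) * w n x))) atTop
      (𝓝 ((t * energyForm L π q (rootDensity π q Q) +
        (1 - t) * energyForm L π q (rootDensity π q R) : ℝ) : EReal)) := by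
  have hB : ∀ (n : ℕ) (i : Fin n), blockDist Q R ⌊t * n⌋₊ i ∈ stdSimplex ℝ X := fun n =>
    blockDist_mem hQ hR _
  have hu : ∀ (n : ℕ) (i : Fin n) a, 0 ≤ rootDensity π q (blockDist Q R ⌊t * n⌋₊ i) a :=
    fun n i => rootDensity_nonneg hpos q (hB n i).1
  have hC0 : 0 ≤ C := (abs_nonneg _).trans hCQ
  let ρ : ℕ → ℝ := fun n => piProb (blockDist Q R ⌊t * n⌋₊) (A n)ᶜ
  let W : ℕ → ℝ := fun n => mean (piDist (blockDist Q R ⌊t * n⌋₊)) fun x => w n x ^ q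
  let F : ∀ n : ℕ, Fin n → ℝ := fun n k => mean (piDist (blockDist Q R ⌊t * n⌋₊)) fun x =>
    energyForm L π q fun a =>
      rootDensity π q (blockDist Q R ⌊t * n⌋₊ k) a * w n (Function.update x k a)
  let K : ℝ := 2 * C * (∑ a, (Q a)⁻¹ + ∑ a, (R a)⁻¹)
  have hinv : ∀ S ∈ stdSimplex ℝ X, 0 ≤ ∑ a, (S a)⁻¹ := fun S hS =>
    Finset.sum_nonneg fun a _ => inv_nonneg.2 (hS.1 a)
  have hW : Tendsto W atTop (𝓝 1) := by
    refine tendsto_of_tendsto_of_tendsto_of_le_of_le (g := fun n => 1 - ρ n) (h := fun _ => 1)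
      (by simpa using hprob.const_sub 1) tendsto_const_nhds (fun n => ?_) fun n => ?_
    · exact one_sub_piProb_le_mean (hB n) q (hw0 n) (hA n)
    · have hone := sum_piDist fun i => (hB n i).2
      calc W n ≤ mean (piDist (blockDist Q R ⌊t * n⌋₊)) (fun _ => 1) :=
            mean_mono (piDist_nonneg fun i => (hB n i).1) fun x =>
              Real.rpow_le_one (hw0 n x) (hw1 n x) hq.le
        _ = 1 := by simpa [mean] using hone
  have hF : ∀ n (k : Fin n), |F n k -
      energyForm L π q (rootDensity π q (blockDist Q R ⌊t * n⌋₊ k))| ≤ K * ρ n := by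
    intro n k
    refine (abs_mean_sub_le (hB n) (A n) k (hC n k) ?_ ?_).trans ?_
    · rw [blockDist]
      split_ifs
      exacts [hCQ, hCR]
    · intro x hx
      congr 1
      funext a
      rcases ((hB n k).1 a).eq_or_lt with h | h
      · have : rootDensity π q (blockDist Q R ⌊t * n⌋₊ k) a = 0 := by
          rw [rootDensity, ← h, zero_div, Real.zero_rpow (by positivity)]
        rw [this, zero_mul]
      · rw [hA n _ (hx a h), mul_one]
    · refine mul_le_mul_of_nonneg_right (mul_le_mul_of_nonneg_left ?_ (by positivity))
        (piProb_nonneg (hB n) _)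
      rw [blockDist]
      split_ifs
      · linarith [hinv R hR]
      · linarith [hinv Q hQ]
  have hsum : Tendsto (fun n : ℕ => 1 / (n : ℝ) * ∑ k, F n k) atTop
      (𝓝 (t * energyForm L π q (rootDensity π q Q) +
        (1 - t) * energyForm L π q (rootDensity π q R))) := by
    have h1 := tendsto_block_average ht (energyForm L π q (rootDensity π q Q))
      (energyForm L π q (rootDensity π q R))
    have h2 : Tendsto (fun n : ℕ => 1 / (n : ℝ) * ∑ k, F n k - 1 / (n : ℝ) *
        (⌊t * n⌋₊ * energyForm L π q (rootDensity π q Q) +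
          (n - ⌊t * n⌋₊) * energyForm L π q (rootDensity π q R))) atTop (𝓝 0) := by
      refine squeeze_zero_norm' (a := fun n => K * ρ n) ?_ (by simpa using hprob.const_mul K)
      filter_upwards [eventually_gt_atTop 0] with n hn
      have hn' : (0 : ℝ) < n := by exact_mod_cast hn
      rw [← sum_blockDist Q R (floor_mul_le ht n)
        (fun S => energyForm L π q (rootDensity π q S)), ← mul_sub, ← Finset.sum_sub_distrib,
        Real.norm_eq_abs, abs_mul, abs_of_pos (by positivity : 0 < 1 / (n : ℝ)), one_div_mul_eq_div,
        div_le_iff₀ hn']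
      refine (Finset.abs_sum_le_sum_abs _ _).trans
        ((Finset.sum_le_sum fun k _ => hF n k).trans (le_of_eq ?_))
      simp [mul_comm]
    simpa using h2.add h1
  have hlim := hsum.div hW one_ne_zero
  rw [div_one] at hlim
  refine ((continuous_coe_real_ereal.tendsto _).comp hlim).congr' ?_
  filter_upwards [hc] with n hcn
  have hr1 : Regular (prodGen L) q (fun x : Fin n → X => c n *
        ((∏ i, rootDensity π q (blockDist Q R ⌊t * n⌋₊ i) (x i)) * w n x)) := by
    rcases hreg with h | ⟨h1, h2, h3⟩
    · exact regular_of_one_lt _ h _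
    · exact regular_of_pos _ _ fun x => mul_pos hcn (mul_pos (Finset.prod_pos fun i _ =>
        Real.rpow_pos_of_pos (div_pos (blockDist_pos h1 h2 _ _ _) (hpos _)) _) (h3 n x))
  have hr2 : ∀ (k : Fin n) x, Regular L q fun a =>
      rootDensity π q (blockDist Q R ⌊t * n⌋₊ k) a * w n (Function.update x k a) := by
    intro k x
    rcases hreg with h | ⟨h1, h2, h3⟩
    · exact regular_of_one_lt _ h _
    · exact regular_of_pos _ _ fun a => mul_pos
        (Real.rpow_pos_of_pos (div_pos (blockDist_pos h1 h2 _ _ _) (hpos _)) _) (h3 n _)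
  rw [energy_eq hq.ne' (fun x => mul_nonneg hcn.le (mul_nonneg
      (Finset.prod_nonneg fun i _ => hu n i _) (hw0 n x))) hr1,
    energyForm_perturbed hsymm hoff hrow hpos hπ hq (hB n) hcn (hw0 n) hr2,
    mean_perturbed_rpow hpos hq (hB n) hcn (hw0 n), ← EReal.coe_mul,
    mul_div_mul_left _ _ (Real.rpow_pos_of_pos hcn q).ne', ← mul_div_assoc]
  rfl

end Blocks

section Typical

variable {X : Type*} [Fintype X]

open scoped Classical in
lemma sum_comp_eq_sum_card {κ : Type*} [Fintype κ] (y : κ → X) (g : X → ℝ) :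
    ∑ i, g (y i) = ∑ a, ((Finset.univ.filter fun i => y i = a).card : ℝ) * g a := by
  rw [← Finset.sum_fiberwise Finset.univ y (fun i => g (y i))]
  refine Finset.sum_congr rfl fun a _ => ?_
  rw [Finset.sum_congr rfl (g := fun _ => g a)
    fun i hi => by rw [(Finset.mem_filter.1 hi).2], Finset.sum_const, nsmul_eq_mul]

lemma pos_of_mem_typicalSet {X κ : Type*} [Fintype κ] {S : X → ℝ} (hS : ∀ a, 0 ≤ S a) {ε : ℝ}
    {y : κ → X} (hy : y ∈ typicalSet S ε) (i : κ) : 0 < S (y i) := by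
  classical
  refine (hS _).lt_of_ne fun h => ?_
  have h1 := hy (y i)
  rw [← h] at h1
  simp only [mul_zero, sub_zero, abs_nonpos_iff, Nat.cast_eq_zero, Finset.card_eq_zero] at h1
  exact Finset.notMem_empty i (h1 ▸ Finset.mem_filter.2 ⟨Finset.mem_univ i, rfl⟩)

/-- On typical sequences the density of `S^n` is at least exponential in the relative entropy. -/
lemma exp_mul_prodDist_le {κ : Type*} [Fintype κ] {π : X → ℝ} (hpos : ∀ a, 0 < π a) {S : X → ℝ}
    (hS : S ∈ stdSimplex ℝ X) {ε : ℝ} {y : κ → X} (hy : y ∈ typicalSet S ε) :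
    Real.exp (Fintype.card κ * (relEnt π S - ε * ∑ a, S a * |Real.log (S a / π a)|)) *
      prodDist π y ≤ prodDist S y := by
  classical
  have hyp := pos_of_mem_typicalSet hS.1 hy
  have h1 : prodDist S y = Real.exp (∑ i, Real.log (S (y i) / π (y i))) * prodDist π y := by
    rw [Real.exp_sum, prodDist, prodDist, ← Finset.prod_mul_distrib]
    refine Finset.prod_congr rfl fun i _ => ?_
    rw [Real.exp_log (div_pos (hyp i) (hpos _)), div_mul_cancel₀ _ (hpos _).ne']
  rw [h1]
  refine mul_le_mul_of_nonneg_right (Real.exp_le_exp.2 ?_) (prodDist_pos hpos y).le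
  rw [sum_comp_eq_sum_card y (fun a => Real.log (S a / π a)), relEnt_eq_sum hpos hS, mul_sub,
    ← mul_assoc, Finset.mul_sum, Finset.mul_sum, ← Finset.sum_sub_distrib]
  refine Finset.sum_le_sum fun a _ => ?_
  set l := Real.log (S a / π a)
  set N := ((Finset.univ.filter fun i => y i = a).card : ℝ)
  have h2 : |N - Fintype.card κ * S a| ≤ ε * (Fintype.card κ * S a) := hy a
  have h3 : -(|N - Fintype.card κ * S a| * |l|) ≤ (N - Fintype.card κ * S a) * l := by
    rw [← abs_mul]
    exact neg_abs_le _
  have h4 := mul_le_mul_of_nonneg_right h2 (abs_nonneg l)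
  nlinarith

/-- The Chebyshev inequality for typicality of a block of coordinates. -/
lemma piProb_not_typical_le {ι : Type*} [Fintype ι] [DecidableEq ι] {Q : ι → X → ℝ}
    (hQ : ∀ i, Q i ∈ stdSimplex ℝ X) {S : X → ℝ} (hS : S ∈ stdSimplex ℝ X) (B : ι → Prop)
    [DecidablePred B] (hB : ∀ i, B i → Q i = S) {ε : ℝ} (hε : 0 < ε) :
    piProb Q {x | (fun i : {i // B i} => x i) ∉ typicalSet S ε} ≤
      (∑ a, ((ε * S a) ^ 2)⁻¹) / Fintype.card {i // B i} := by
  classical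
  set d := (Fintype.card {i // B i} : ℝ) with hd
  let h : X → ι → X → ℝ := fun a i b => if B i then (if b = a then 1 else 0) - S a else 0
  have hsub : ∀ g : ι → ℝ, ∑ i, (if B i then g i else 0) = ∑ i : {i // B i}, g i := fun g => by
    rw [← Finset.sum_filter]
    exact Finset.sum_subtype _ (by simp) g
  have hcount : ∀ a (x : ι → X), ∑ i, h a i (x i) =
      ((Finset.univ.filter fun i : {i // B i} => x i = a).card : ℝ) - d * S a := by
    intro a x
    simp only [h]
    rw [hsub fun i => (if x i = a then 1 else 0) - S a, Finset.sum_sub_distrib, Finset.sum_const,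
      Finset.sum_boole, nsmul_eq_mul, Finset.card_univ]
  have hP := piDist_nonneg (fun i => (hQ i).1)
  have hpt : ∀ x, piDist Q x *
      (if x ∈ {x | (fun i : {i // B i} => x i) ∉ typicalSet S ε} then 1 else 0) ≤
      piDist Q x * ∑ a, ((ε * S a) ^ 2 * d ^ 2)⁻¹ * (∑ i, h a i (x i)) ^ 2 := by
    intro x
    rcases (hP x).eq_or_lt with h0 | h0
    · simp [← h0]
    refine mul_le_mul_of_nonneg_left ?_ h0.le
    split_ifs with hx
    swap
    · exact Finset.sum_nonneg fun a _ => by positivity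
    simp only [Set.mem_ofPred_eq, typicalSet, not_forall, not_le] at hx
    obtain ⟨a, ha⟩ := hx
    refine le_trans ?_ (Finset.single_le_sum (fun a _ => by positivity) (Finset.mem_univ a))
    rw [hcount a x]
    have hSa : 0 < S a := by
      refine (hS.1 a).lt_of_ne fun hz => ?_
      rw [← hz] at ha
      simp only [mul_zero, sub_zero, abs_pos, ne_eq, Nat.cast_eq_zero, Finset.card_eq_zero] at ha
      obtain ⟨i, hi⟩ := Finset.nonempty_iff_ne_empty.2 ha
      have hi' := (Finset.mem_filter.1 hi).2
      refine h0.ne' (Finset.prod_eq_zero (Finset.mem_univ i.1) ?_)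
      rw [hB i i.2, hi', ← hz]
    have hd0 : 0 < d := by
      rw [hd, Nat.cast_pos, Fintype.card_pos_iff]
      by_contra he
      rw [not_nonempty_iff] at he
      simp at ha
    rw [inv_mul_eq_div, le_div_iff₀ (by positivity), one_mul, ← sq_abs (_ - _)]
    have e : (ε * S a) ^ 2 * d ^ 2 = (ε * (d * S a)) ^ 2 := by ring
    rw [e]
    exact pow_le_pow_left₀ (by positivity) ha.le 2
  have h0 : ∀ a i, mean (Q i) (h a i) = 0 := by
    intro a i
    simp only [h, mean]
    split_ifs with hi
    · simp [mul_sub, Finset.sum_sub_distrib, ← Finset.sum_mul, hS.2, hB i hi]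
    · simp
  have hvar : ∀ a, mean (piDist Q) (fun x => (∑ i, h a i (x i)) ^ 2) ≤ d := by
    intro a
    rw [mean_sq_sum_eq hQ (h0 a)]
    have : d = ∑ i, (if B i then (1 : ℝ) else 0) := by
      rw [hsub fun _ => 1]
      simp [hd]
    rw [this]
    refine Finset.sum_le_sum fun i _ => ?_
    split_ifs with hi
    · refine le_trans (mean_mono (hQ i).1 (g := fun _ => 1) fun b => ?_)
        (le_of_eq (by simpa [mean] using (hQ i).2))
      simp only [h, if_pos hi]
      have hS0 := hS.1 a
      have hS1 : S a ≤ 1 := by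
        rw [← hS.2]
        exact Finset.single_le_sum (fun a _ => hS.1 a) (Finset.mem_univ a)
      split_ifs <;> nlinarith
    · simp [h, hi, mean]
  calc piProb Q {x | (fun i : {i // B i} => x i) ∉ typicalSet S ε}
      ≤ mean (piDist Q) (fun x => ∑ a, ((ε * S a) ^ 2 * d ^ 2)⁻¹ * (∑ i, h a i (x i)) ^ 2) :=
        Finset.sum_le_sum fun x _ => by
          refine le_trans (le_of_eq ?_) (hpt x)
          congr!
    _ = ∑ a, ((ε * S a) ^ 2 * d ^ 2)⁻¹ * mean (piDist Q) (fun x => (∑ i, h a i (x i)) ^ 2) := by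
        simp only [mean, Finset.mul_sum]
        rw [Finset.sum_comm]
        exact Finset.sum_congr rfl fun a _ => Finset.sum_congr rfl fun x _ => by ring
    _ ≤ ∑ a, ((ε * S a) ^ 2 * d ^ 2)⁻¹ * d :=
        Finset.sum_le_sum fun a _ => mul_le_mul_of_nonneg_left (hvar a) (by positivity)
    _ = _ := by
        rw [Finset.sum_div]
        refine Finset.sum_congr rfl fun a _ => ?_
        rcases eq_or_ne d 0 with h | h
        · simp [h]
        · rw [mul_inv]
          field_simp

/-- The sequences whose first `m` entries are typical for `Q` and whose other entries are typical
for `R`. -/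
def blockTypical {X : Type*} (Q R : X → ℝ) (ε : ℝ) (m n : ℕ) : Set (Fin n → X) :=
  {x | (fun i : {i : Fin n // (i : ℕ) < m} => x i) ∈ typicalSet Q ε ∧
    (fun i : {i : Fin n // ¬ (i : ℕ) < m} => x i) ∈ typicalSet R ε}

lemma card_val_lt {m n : ℕ} (h : m ≤ n) : Fintype.card {i : Fin n // (i : ℕ) < m} = m := by
  rw [Fintype.card_subtype, Fin.card_filter_val_lt, min_eq_right h]

lemma card_not_val_lt {m n : ℕ} (h : m ≤ n) :
    Fintype.card {i : Fin n // ¬ (i : ℕ) < m} = n - m := by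
  rw [Fintype.card_subtype_compl, card_val_lt h, Fintype.card_fin]

lemma tendsto_inv_block {t : ℝ} (ht : t ∈ Set.Icc (0 : ℝ) 1) :
    Tendsto (fun n : ℕ => ((⌊t * n⌋₊ : ℝ))⁻¹) atTop (𝓝 0) ∧
      Tendsto (fun n : ℕ => ((n - ⌊t * n⌋₊ : ℕ) : ℝ)⁻¹) atTop (𝓝 0) := by
  constructor
  · rcases ht.1.eq_or_lt with rfl | h
    · simp
    · refine tendsto_inv_atTop_zero.comp (tendsto_natCast_atTop_atTop.comp ?_)
      exact tendsto_nat_floor_atTop.comp (tendsto_natCast_atTop_atTop.const_mul_atTop h)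
  · rcases ht.2.eq_or_lt with rfl | h
    · simp
    · have h1 : Tendsto (fun n : ℕ => (1 - t) * (n : ℝ)) atTop atTop :=
        tendsto_natCast_atTop_atTop.const_mul_atTop (by linarith)
      refine tendsto_inv_atTop_zero.comp (tendsto_atTop_mono (fun n => ?_) h1)
      rw [Nat.cast_sub (floor_mul_le ht n)]
      have := Nat.floor_le (mul_nonneg ht.1 (Nat.cast_nonneg n : (0 : ℝ) ≤ n))
      linarith

lemma tendsto_piProb_blockTypical {Q R : X → ℝ} (hQ : Q ∈ stdSimplex ℝ X)
    (hR : R ∈ stdSimplex ℝ X) {t : ℝ} (ht : t ∈ Set.Icc (0 : ℝ) 1) {ε : ℝ} (hε : 0 < ε) :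
    Tendsto (fun n : ℕ => piProb (blockDist Q R ⌊t * n⌋₊) (blockTypical Q R ε ⌊t * n⌋₊ n)ᶜ)
      atTop (𝓝 0) := by
  classical
  have hB : ∀ (n : ℕ) (i : Fin n), blockDist Q R ⌊t * n⌋₊ i ∈ stdSimplex ℝ X := fun n =>
    blockDist_mem hQ hR _
  have hlim : Tendsto (fun n : ℕ => (∑ a, ((ε * Q a) ^ 2)⁻¹) * ((⌊t * n⌋₊ : ℝ))⁻¹ +
      (∑ a, ((ε * R a) ^ 2)⁻¹) * ((n - ⌊t * n⌋₊ : ℕ) : ℝ)⁻¹) atTop (𝓝 0) := by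
    simpa using ((tendsto_inv_block ht).1.const_mul (∑ a, ((ε * Q a) ^ 2)⁻¹)).add
      ((tendsto_inv_block ht).2.const_mul (∑ a, ((ε * R a) ^ 2)⁻¹))
  refine squeeze_zero (fun n => piProb_nonneg (hB n) _) (fun n => ?_) hlim
  have h1 := piProb_not_typical_le (hB n) hQ (fun i : Fin n => (i : ℕ) < ⌊t * n⌋₊)
    (fun i hi => by rw [blockDist, if_pos hi]) hε
  have h2 := piProb_not_typical_le (hB n) hR (fun i : Fin n => ¬ (i : ℕ) < ⌊t * n⌋₊)
    (fun i hi => by rw [blockDist, if_neg hi]) hε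
  rw [card_val_lt (floor_mul_le ht n), div_eq_mul_inv] at h1
  rw [card_not_val_lt (floor_mul_le ht n), div_eq_mul_inv] at h2
  refine le_trans ?_ (add_le_add h1 h2)
  rw [piProb, piProb, piProb, ← mean_add]
  refine mean_mono (piDist_nonneg fun i => (hB n i).1) fun x => ?_
  by_cases hx1 : (fun i : {i : Fin n // (i : ℕ) < ⌊t * n⌋₊} => x i) ∈ typicalSet Q ε <;>
  by_cases hx2 : (fun i : {i : Fin n // ¬ (i : ℕ) < ⌊t * n⌋₊} => x i) ∈ typicalSet R ε <;>
  simp [blockTypical, hx1, hx2]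

end Typical

section Extremal

variable {X : Type*} [Fintype X]

lemma prodDist_mul_prodDist {X : Type*} (π : X → ℝ) {n : ℕ} (m : ℕ) (x : Fin n → X) :
    prodDist π (fun i : {i : Fin n // (i : ℕ) < m} => x i) *
      prodDist π (fun i : {i : Fin n // ¬ (i : ℕ) < m} => x i) = prodDist π x :=
  Fintype.prod_subtype_mul_prod_subtype (fun i : Fin n => (i : ℕ) < m) fun i => π (x i)

lemma piDist_blockDist {X : Type*} (Q R : X → ℝ) {n : ℕ} (m : ℕ) (x : Fin n → X) :
    piDist (blockDist Q R m) x = prodDist Q (fun i : {i : Fin n // (i : ℕ) < m} => x i) *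
      prodDist R (fun i : {i : Fin n // ¬ (i : ℕ) < m} => x i) := by
  rw [piDist, ← Fintype.prod_subtype_mul_prod_subtype (fun i : Fin n => (i : ℕ) < m)]
  congr 1
  · exact Finset.prod_congr rfl fun i _ => by rw [blockDist, if_pos i.2]
  · exact Finset.prod_congr rfl fun i _ => by rw [blockDist, if_neg i.2]

open scoped Classical in
/-- The mass that `Q^n` gives to its typical set. -/
def typicalMass (ι : Type*) [Fintype ι] (Q : X → ℝ) (ε : ℝ) : ℝ :=
  ∑ y : ι → X with y ∈ typicalSet Q ε, prodDist Q y

lemma typicalMass_pos {ι : Type*} [Fintype ι] {Q : X → ℝ} (hQ : ∀ a, 0 ≤ Q a) {ε : ℝ}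
    {y : ι → X} (hy : y ∈ typicalSet Q ε) : 0 < typicalMass ι Q ε := by
  classical
  refine Finset.sum_pos' (fun y _ => Finset.prod_nonneg fun i _ => hQ _)
    ⟨y, by simpa using hy, Finset.prod_pos fun i _ => pos_of_mem_typicalSet hQ hy i⟩

open scoped Classical in
lemma extremal_eq {π : X → ℝ} (hpos : ∀ a, 0 < π a) {q : ℝ} (hq : 0 < q) {Q R : X → ℝ}
    (hQ : ∀ a, 0 ≤ Q a) (hR : ∀ a, 0 ≤ R a) (t ε : ℝ) (n : ℕ) :
    extremal π q Q R t ε n = fun x =>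
      (1 / (typicalMass {i : Fin n // (i : ℕ) < ⌊t * n⌋₊} Q ε *
        typicalMass {i : Fin n // ¬ (i : ℕ) < ⌊t * n⌋₊} R ε)) ^ (1 / q) *
      ((∏ i, rootDensity π q (blockDist Q R ⌊t * n⌋₊ i) (x i)) *
        if x ∈ blockTypical Q R ε ⌊t * n⌋₊ n then 1 else 0) := by
  funext x
  have hq' : 1 / q ≠ 0 := by positivity
  have hprod : ∏ i, rootDensity π q (blockDist Q R ⌊t * n⌋₊ i) (x i) =
      (piDist (blockDist Q R ⌊t * n⌋₊) x / prodDist π x) ^ (1 / q) := by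
    simp only [rootDensity]
    rw [Real.finsetProd_rpow, Finset.prod_div_distrib]
    · rfl
    · intro i _
      refine div_nonneg ?_ (hpos _).le
      rw [blockDist]
      split_ifs
      exacts [hQ _, hR _]
  have hQ0 : ∀ κ [Fintype κ] (y : κ → X), 0 ≤ prodDist Q y := fun κ _ y =>
    Finset.prod_nonneg fun i _ => hQ _
  have hR0 : ∀ κ [Fintype κ] (y : κ → X), 0 ≤ prodDist R y := fun κ _ y =>
    Finset.prod_nonneg fun i _ => hR _
  simp only [extremal, condTypical]
  by_cases hx : x ∈ blockTypical Q R ε ⌊t * n⌋₊ n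
  · rw [if_pos hx.1, if_pos hx.2, if_pos hx, mul_one, hprod, ← Real.mul_rpow]
    · congr 1
      rw [piDist_blockDist, ← prodDist_mul_prodDist π ⌊t * n⌋₊ x, typicalMass, typicalMass]
      simp only [div_eq_mul_inv, mul_inv, one_mul]
      ring
    · exact one_div_nonneg.2 (mul_nonneg (Finset.sum_nonneg fun y _ => hQ0 _ y)
        (Finset.sum_nonneg fun y _ => hR0 _ y))
    · rw [piDist_blockDist]
      exact div_nonneg (mul_nonneg (hQ0 _ _) (hR0 _ _)) (prodDist_pos hpos x).le
  · rw [if_neg hx, mul_zero, mul_zero]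
    have : ¬ ((fun i : {i : Fin n // (i : ℕ) < ⌊t * n⌋₊} => x i) ∈ typicalSet Q ε ∧
      (fun i : {i : Fin n // ¬ (i : ℕ) < ⌊t * n⌋₊} => x i) ∈ typicalSet R ε) := hx
    rw [not_and_or] at this
    rcases this with h | h
    · rw [if_neg h, zero_div, zero_mul, Real.zero_rpow hq']
    · rw [if_neg h, zero_div, mul_zero, Real.zero_rpow hq']

/-- The mean of `|ln (Q / π)|` under `Q`. -/
def absRelEnt (π Q : X → ℝ) : ℝ := ∑ a, Q a * |Real.log (Q a / π a)|

lemma ent₂_extremal_ge {π : X → ℝ} (hpos : ∀ a, 0 < π a) {p q : ℝ} (hp : 0 ≤ p) (hpq : p ≤ q)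
    (hq : 0 < q) {Q R : X → ℝ} (hQ : Q ∈ stdSimplex ℝ X) (hR : R ∈ stdSimplex ℝ X) {t : ℝ}
    (ht : t ∈ Set.Icc (0 : ℝ) 1) {ε : ℝ} {n : ℕ}
    (hne : (blockTypical Q R ε ⌊t * n⌋₊ n).Nonempty) :
    Admissible (extremal π q Q R t ε n) ∧
      ⌊t * n⌋₊ * (relEnt π Q - ε * absRelEnt π Q) +
        (n - ⌊t * n⌋₊) * (relEnt π R - ε * absRelEnt π R) ≤
      ent₂ (prodDist π) p q (extremal π q Q R t ε n) := by
  classical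
  obtain ⟨x₀, hx₀⟩ := hne
  have hB : ∀ i : Fin n, blockDist Q R ⌊t * n⌋₊ i ∈ stdSimplex ℝ X := blockDist_mem hQ hR _
  have hc : 0 < (1 / (typicalMass {i : Fin n // (i : ℕ) < ⌊t * n⌋₊} Q ε *
        typicalMass {i : Fin n // ¬ (i : ℕ) < ⌊t * n⌋₊} R ε)) ^ (1 / q) :=
    Real.rpow_pos_of_pos (one_div_pos.2 (mul_pos (typicalMass_pos hQ.1 hx₀.1)
      (typicalMass_pos hR.1 hx₀.2))) _
  have hu : ∀ x : Fin n → X, 0 ≤ ∏ i, rootDensity π q (blockDist Q R ⌊t * n⌋₊ i) (x i) :=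
    fun x => Finset.prod_nonneg fun i _ => rootDensity_nonneg hpos q (hB i).1 _
  have hadm : Admissible (extremal π q Q R t ε n) := by
    rw [extremal_eq hpos hq hQ.1 hR.1]
    refine ⟨fun x => mul_nonneg hc.le (mul_nonneg (hu x) (by positivity)), fun h => ?_⟩
    have h1 := congrFun h x₀
    rw [if_pos hx₀, mul_one, Pi.zero_apply, mul_eq_zero] at h1
    refine (Finset.prod_pos fun i _ => Real.rpow_pos_of_pos (div_pos ?_ (hpos _)) _).ne'
      (h1.resolve_left hc.ne')
    rw [blockDist]
    split_ifs with hi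
    · exact pos_of_mem_typicalSet hQ.1 hx₀.1 ⟨i, hi⟩
    · exact pos_of_mem_typicalSet hR.1 hx₀.2 ⟨i, hi⟩
  refine ⟨hadm, le_trans ?_ (ent₂_zero_le (prodDist_pos hpos) hadm hp hq hpq)⟩
  rw [ent₂, if_pos (Or.inl rfl), le_neg]
  have hmass := support_mass_pos (prodDist_pos hpos) hadm
  rw [Real.log_le_iff_le_exp hmass]
  set e := ⌊t * n⌋₊ * (relEnt π Q - ε * absRelEnt π Q) +
        (n - ⌊t * n⌋₊) * (relEnt π R - ε * absRelEnt π R) with he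
  have hpt : ∀ x, 0 < extremal π q Q R t ε n x →
      prodDist π x ≤ Real.exp (-e) * piDist (blockDist Q R ⌊t * n⌋₊) x := by
    intro x hx
    have hxA : x ∈ blockTypical Q R ε ⌊t * n⌋₊ n := by
      by_contra h
      rw [extremal_eq hpos hq hQ.1 hR.1] at hx
      simp only [if_neg h, mul_zero, lt_irrefl] at hx
    have h1 := exp_mul_prodDist_le hpos hQ hxA.1
    have h2 := exp_mul_prodDist_le hpos hR hxA.2
    rw [card_val_lt (floor_mul_le ht n)] at h1
    rw [card_not_val_lt (floor_mul_le ht n), Nat.cast_sub (floor_mul_le ht n)] at h2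
    have h3 := mul_le_mul h1 h2 (mul_nonneg (Real.exp_pos _).le (prodDist_pos hpos _).le)
      (Finset.prod_nonneg fun i _ => hQ.1 _)
    rw [← piDist_blockDist, mul_mul_mul_comm, prodDist_mul_prodDist, ← Real.exp_add] at h3
    calc prodDist π x = Real.exp (-e) * (Real.exp e * prodDist π x) := by
          rw [← mul_assoc, ← Real.exp_add, neg_add_cancel, Real.exp_zero, one_mul]
      _ ≤ _ := mul_le_mul_of_nonneg_left h3 (Real.exp_pos _).le
  calc ∑ x with 0 < extremal π q Q R t ε n x, prodDist π x
      ≤ ∑ x with 0 < extremal π q Q R t ε n x,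
          Real.exp (-e) * piDist (blockDist Q R ⌊t * n⌋₊) x :=
        Finset.sum_le_sum fun x hx => hpt x (Finset.mem_filter.1 hx).2
    _ ≤ ∑ x, Real.exp (-e) * piDist (blockDist Q R ⌊t * n⌋₊) x :=
        Finset.sum_le_sum_of_subset_of_nonneg (Finset.filter_subset _ _) fun x _ _ =>
          mul_nonneg (Real.exp_pos _).le (piDist_nonneg (fun i => (hB i).1) x)
    _ = Real.exp (-e) := by
        rw [← Finset.mul_sum, sum_piDist fun i => (hB i).2, mul_one]

lemma abs_energyForm_le_of_one_lt {L : Matrix X X ℝ} (hrow : ∀ x, ∑ y, L x y = 0)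
    {π : X → ℝ} (hpos : ∀ a, 0 < π a) {q : ℝ} (hq : 1 < q) {M : ℝ} {v : X → ℝ}
    (hv : ∀ a, 0 ≤ v a) (hvM : ∀ a, v a ≤ M) (hM : 0 ≤ M) :
    |energyForm L π q v| ≤
      1 / (q - 1) * ((∑ x, ∑ y, π x * |L x y|) * (M * M ^ (q - 1))) := by
  have hq' : 0 < 1 / (q - 1) := one_div_pos.2 (by linarith)
  rw [energyForm, if_neg hq.ne', abs_mul, abs_of_pos hq']
  refine mul_le_mul_of_nonneg_left (abs_dirichlet_le hrow hpos hM (fun x y => ?_)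
    fun x y => ?_) hq'.le
  · exact abs_sub_le_of_nonneg_of_le (hv y) (hvM y) (hv x) (hvM x)
  · exact abs_sub_le_of_nonneg_of_le (Real.rpow_nonneg (hv y) _)
      (Real.rpow_le_rpow (hv y) (hvM y) (by linarith)) (Real.rpow_nonneg (hv x) _)
      (Real.rpow_le_rpow (hv x) (hvM x) (by linarith))

/-- An upper bound for the root densities of two distributions. -/
lemma exists_rootDensity_le (π : X → ℝ) (q : ℝ) (Q R : X → ℝ) :
    ∃ M : ℝ, 0 ≤ M ∧ (∀ a, rootDensity π q Q a ≤ M) ∧ ∀ a, rootDensity π q R a ≤ M := by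
  refine ⟨∑ a, (|rootDensity π q Q a| + |rootDensity π q R a|),
    Finset.sum_nonneg fun a _ => by positivity, fun a => ?_, fun a => ?_⟩
  · exact le_trans (le_trans (le_abs_self _) (le_add_of_nonneg_right (abs_nonneg _)))
      (Finset.single_le_sum (f := fun a => |rootDensity π q Q a| + |rootDensity π q R a|)
        (fun a _ => by positivity) (Finset.mem_univ a))
  · exact le_trans (le_trans (le_abs_self _) (le_add_of_nonneg_left (abs_nonneg _)))
      (Finset.single_le_sum (f := fun a => |rootDensity π q Q a| + |rootDensity π q R a|)
        (fun a _ => by positivity) (Finset.mem_univ a))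

lemma eventually_blockTypical_nonempty {Q R : X → ℝ} (hQ : Q ∈ stdSimplex ℝ X)
    (hR : R ∈ stdSimplex ℝ X) {t : ℝ} (ht : t ∈ Set.Icc (0 : ℝ) 1) {ε : ℝ} (hε : 0 < ε) :
    ∀ᶠ n : ℕ in atTop, (blockTypical Q R ε ⌊t * n⌋₊ n).Nonempty := by
  filter_upwards [(tendsto_piProb_blockTypical hQ hR ht hε).eventually_lt_const one_pos] with n hn
  by_contra h
  rw [Set.not_nonempty_iff_eq_empty] at h
  have : piProb (blockDist Q R ⌊t * n⌋₊) (blockTypical Q R ε ⌊t * n⌋₊ n)ᶜ = 1 := by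
    simp only [h, piProb, mean]
    simpa using sum_piDist fun i : Fin n => (blockDist_mem hQ hR ⌊t * n⌋₊ i).2
  exact hn.ne this

lemma tendsto_energy_extremal {L : Matrix X X ℝ} (hsymm : L.IsSymm)
    (hoff : ∀ x y, x ≠ y → 0 ≤ L x y) (hrow : ∀ x, ∑ y, L x y = 0)
    {π : X → ℝ} (hpos : ∀ a, 0 < π a) (hπ : ∑ a, π a = 1) {q : ℝ} (hq : 1 < q)
    {Q R : X → ℝ} (hQ : Q ∈ stdSimplex ℝ X) (hR : R ∈ stdSimplex ℝ X)
    {t : ℝ} (ht : t ∈ Set.Icc (0 : ℝ) 1) {ε : ℝ} (hε : 0 < ε) :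
    Tendsto (fun n : ℕ => ((1 / n : ℝ) : EReal) * energy (prodGen L) (prodDist π) q
      (extremal π q Q R t ε n)) atTop
      (𝓝 ((t * energyForm L π q (rootDensity π q Q) +
        (1 - t) * energyForm L π q (rootDensity π q R) : ℝ) : EReal)) := by
  classical
  have hq0 : 0 < q := by linarith
  obtain ⟨M, hM, hMQ, hMR⟩ := exists_rootDensity_le π q Q R
  have hQ0 := rootDensity_nonneg hpos q hQ.1
  have hR0 := rootDensity_nonneg hpos q hR.1
  simp only [extremal_eq hpos hq0 hQ.1 hR.1]
  refine tendsto_energy hsymm hoff hrow hpos hπ hq0 hQ hR ht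
    (c := fun n => (1 / (typicalMass {i : Fin n // (i : ℕ) < ⌊t * n⌋₊} Q ε *
        typicalMass {i : Fin n // ¬ (i : ℕ) < ⌊t * n⌋₊} R ε)) ^ (1 / q))
    (w := fun n x => if x ∈ blockTypical Q R ε ⌊t * n⌋₊ n then 1 else 0)
    (A := fun n => blockTypical Q R ε ⌊t * n⌋₊ n) ?_ (fun n x => by positivity)
    (fun n x => by split_ifs <;> norm_num) (Or.inl hq) (fun n x hx => by simp [hx])
    (tendsto_piProb_blockTypical hQ hR ht hε)
    (abs_energyForm_le_of_one_lt hrow hpos hq hQ0 hMQ hM)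
    (abs_energyForm_le_of_one_lt hrow hpos hq hR0 hMR hM) ?_
  · filter_upwards [eventually_blockTypical_nonempty hQ hR ht hε] with n ⟨x, hx⟩
    exact Real.rpow_pos_of_pos (one_div_pos.2 (mul_pos (typicalMass_pos hQ.1 hx.1)
      (typicalMass_pos hR.1 hx.2))) _
  · intro n k x
    have hb : ∀ a, rootDensity π q (blockDist Q R ⌊t * n⌋₊ k) a ≤ M := by
      rw [blockDist]
      split_ifs
      exacts [hMQ, hMR]
    have hb0 := rootDensity_nonneg hpos q (blockDist_mem hQ hR ⌊t * n⌋₊ k).1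
    refine abs_energyForm_le_of_one_lt hrow hpos hq (fun a => mul_nonneg (hb0 a) (by positivity))
      (fun a => ?_) hM
    split_ifs
    · simpa using hb a
    · simpa using hM

lemma eventually_ent₂_extremal_ge {π : X → ℝ} (hpos : ∀ a, 0 < π a) {p q : ℝ} (hp : 0 ≤ p)
    (hpq : p ≤ q) (hq : 0 < q) {Q R : X → ℝ} (hQ : Q ∈ stdSimplex ℝ X)
    (hR : R ∈ stdSimplex ℝ X) {t : ℝ} (ht : t ∈ Set.Icc (0 : ℝ) 1) {β : ℝ}
    (hβ : β < t * relEnt π Q + (1 - t) * relEnt π R) :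
    ∃ ε₀ : ℝ, 0 < ε₀ ∧ ∀ ε : ℝ, 0 < ε → ε < ε₀ → ∀ᶠ n : ℕ in atTop,
      Admissible (extremal π q Q R t ε n) ∧
        β ≤ 1 / n * ent₂ (prodDist π) p q (extremal π q Q R t ε n) := by
  have habs : ∀ S ∈ stdSimplex ℝ X, 0 ≤ absRelEnt π S := fun S hS =>
    Finset.sum_nonneg fun a _ => mul_nonneg (hS.1 a) (abs_nonneg _)
  set γ := t * relEnt π Q + (1 - t) * relEnt π R - β with hγ
  set c := t * absRelEnt π Q + (1 - t) * absRelEnt π R with hc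
  have hc0 : 0 ≤ c := add_nonneg (mul_nonneg ht.1 (habs Q hQ))
    (mul_nonneg (sub_nonneg.2 ht.2) (habs R hR))
  have hγ0 : 0 < γ := sub_pos.2 hβ
  refine ⟨γ / (c + 1), by positivity, fun ε hε hε' => ?_⟩
  have h1 : ε * (c + 1) < γ := (lt_div_iff₀ (by linarith)).1 hε'
  have hlim := tendsto_block_average ht (relEnt π Q - ε * absRelEnt π Q)
    (relEnt π R - ε * absRelEnt π R)
  have hlt : β < t * (relEnt π Q - ε * absRelEnt π Q) +
      (1 - t) * (relEnt π R - ε * absRelEnt π R) := by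
    have : t * (relEnt π Q - ε * absRelEnt π Q) +
      (1 - t) * (relEnt π R - ε * absRelEnt π R) = β + γ - ε * c := by
      rw [hγ, hc]
      ring
    rw [this]
    linarith
  filter_upwards [eventually_blockTypical_nonempty hQ hR ht hε,
    hlim.eventually_const_lt hlt] with n hn hn'
  obtain ⟨h2, h3⟩ := ent₂_extremal_ge hpos hp hpq hq hQ hR ht hn
  exact ⟨h2, hn'.le.trans (mul_le_mul_of_nonneg_left h3 (by positivity))⟩

end Extremal

section OrderOne

variable {X : Type*} [Fintype X]

/-- The log-density of the product of block distributions. -/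
def logDensity {X : Type*} (π Q R : X → ℝ) (m : ℕ) {n : ℕ} (x : Fin n → X) : ℝ :=
  ∑ i, Real.log (rootDensity π 1 (blockDist Q R m i) (x i))

/-- The weight that damps the region where the log-density is below `b`. -/
def damping {X : Type*} (π Q R : X → ℝ) (s b : ℝ) (m : ℕ) {n : ℕ} (x : Fin n → X) : ℝ :=
  Real.exp (min 0 (s * (logDensity π Q R m x - b)))

lemma damping_le_one {X : Type*} (π Q R : X → ℝ) (s b : ℝ) (m : ℕ) {n : ℕ} (x : Fin n → X) :
    damping π Q R s b m x ≤ 1 :=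
  Real.exp_le_one_iff.2 (min_le_left _ _)

lemma rootDensity_one {X : Type*} (π Q : X → ℝ) (a : X) : rootDensity π 1 Q a = Q a / π a := by
  simp [rootDensity]

lemma rootDensity_pos {X : Type*} {π Q : X → ℝ} (hpos : ∀ a, 0 < π a) (hQ : ∀ a, 0 < Q a) (q : ℝ)
    (a : X) : 0 < rootDensity π q Q a := Real.rpow_pos_of_pos (div_pos (hQ a) (hpos a)) _

lemma prod_rootDensity_eq_exp {X : Type*} {π Q R : X → ℝ} (hpos : ∀ a, 0 < π a)
    (hQ : ∀ a, 0 < Q a) (hR : ∀ a, 0 < R a) (m : ℕ) {n : ℕ} (x : Fin n → X) :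
    ∏ i, rootDensity π 1 (blockDist Q R m i) (x i) = Real.exp (logDensity π Q R m x) := by
  rw [logDensity, Real.exp_sum]
  exact Finset.prod_congr rfl fun i _ =>
    (Real.exp_log (rootDensity_pos hpos (blockDist_pos hQ hR m i) 1 _)).symm

/-- The weak law of large numbers for the log-density. -/
lemma tendsto_piProb_logDensity_lt {π Q R : X → ℝ} (hpos : ∀ a, 0 < π a)
    (hQ : Q ∈ stdSimplex ℝ X) (hR : R ∈ stdSimplex ℝ X) {t β : ℝ} (ht : t ∈ Set.Icc (0 : ℝ) 1)
    (hβ : β < t * relEnt π Q + (1 - t) * relEnt π R) :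
    Tendsto (fun n : ℕ => piProb (blockDist Q R ⌊t * n⌋₊)
      {x : Fin n → X | n * β ≤ logDensity π Q R ⌊t * n⌋₊ x}ᶜ) atTop (𝓝 0) := by
  classical
  have hB : ∀ (n : ℕ) (i : Fin n), blockDist Q R ⌊t * n⌋₊ i ∈ stdSimplex ℝ X := fun n =>
    blockDist_mem hQ hR _
  let V : (X → ℝ) → ℝ := fun S =>
    mean S (fun a => (Real.log (rootDensity π 1 S a) - relEnt π S) ^ 2)
  have hV : ∀ S ∈ stdSimplex ℝ X, 0 ≤ V S := fun S hS => mean_nonneg hS.1 fun a => sq_nonneg _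
  obtain ⟨γ, hβγ, hγ⟩ := exists_between hβ
  set ζ := γ - β with hζ
  have hζ0 : 0 < ζ := sub_pos.2 hβγ
  have hlim : Tendsto (fun n : ℕ => (V Q + V R) / ζ ^ 2 * (n : ℝ)⁻¹) atTop (𝓝 0) := by
    simpa using tendsto_inv_atTop_nhds_zero_nat.const_mul ((V Q + V R) / ζ ^ 2)
  refine squeeze_zero' (Eventually.of_forall fun n => piProb_nonneg (hB n) _) ?_ hlim
  filter_upwards [(tendsto_block_average ht (relEnt π Q) (relEnt π R)).eventually_const_lt hγ,
    eventually_gt_atTop 0] with n hn hn0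
  have hn' : (0 : ℝ) < n := by exact_mod_cast hn0
  let h : Fin n → X → ℝ := fun i a =>
    Real.log (rootDensity π 1 (blockDist Q R ⌊t * n⌋₊ i) a) - relEnt π (blockDist Q R ⌊t * n⌋₊ i)
  have hsum : ∀ x : Fin n → X, ∑ i, h i (x i) = logDensity π Q R ⌊t * n⌋₊ x -
      (⌊t * n⌋₊ * relEnt π Q + (n - ⌊t * n⌋₊) * relEnt π R) := fun x => by
    rw [← sum_blockDist Q R (floor_mul_le ht n) (relEnt π), logDensity, ← Finset.sum_sub_distrib]
  have h0 : ∀ i, mean (blockDist Q R ⌊t * n⌋₊ i) (h i) = 0 := fun i => by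
    simp only [h, mean, mul_sub, Finset.sum_sub_distrib, ← Finset.sum_mul, (hB n i).2, one_mul,
      rootDensity_one]
    rw [relEnt_eq_sum hpos (hB n i), sub_self]
  have hγn : n * γ < ⌊t * n⌋₊ * relEnt π Q + (n - ⌊t * n⌋₊) * relEnt π R := by
    rw [one_div_mul_eq_div, lt_div_iff₀ hn'] at hn
    linarith
  have hpt : ∀ x : Fin n → X,
      (if x ∈ {x : Fin n → X | n * β ≤ logDensity π Q R ⌊t * n⌋₊ x}ᶜ then (1 : ℝ) else 0) ≤
        ((n * ζ) ^ 2)⁻¹ * (∑ i, h i (x i)) ^ 2 := by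
    intro x
    split_ifs with hx
    · rw [Set.mem_compl_iff, Set.mem_ofPred_eq, not_le] at hx
      rw [inv_mul_eq_div, le_div_iff₀ (by positivity), one_mul, ← sq_abs (∑ i, _)]
      refine pow_le_pow_left₀ (by positivity) ?_ 2
      rw [hsum x]
      refine le_trans ?_ (neg_le_abs _)
      rw [hζ]
      linarith
    · positivity
  calc _ ≤ mean (piDist (blockDist Q R ⌊t * n⌋₊))
        (fun x => ((n * ζ) ^ 2)⁻¹ * (∑ i, h i (x i)) ^ 2) := by
        refine mean_mono (piDist_nonneg fun i => (hB n i).1) fun x => ?_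
        convert hpt x
    _ = ((n * ζ) ^ 2)⁻¹ * ∑ i : Fin n, V (blockDist Q R ⌊t * n⌋₊ i) := by
        rw [mean_const_mul, mean_sq_sum_eq (hB n) h0]
    _ ≤ ((n * ζ) ^ 2)⁻¹ * ∑ i : Fin n, (V Q + V R) := by
        refine mul_le_mul_of_nonneg_left (Finset.sum_le_sum fun i _ => ?_) (by positivity)
        rw [blockDist]
        split_ifs
        · linarith [hV R hR]
        · linarith [hV Q hQ]
    _ = (V Q + V R) / ζ ^ 2 * (n : ℝ)⁻¹ := by
        rw [Finset.sum_const, Finset.card_univ, Fintype.card_fin, nsmul_eq_mul]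
        field_simp

lemma exists_abs_log_rootDensity_le (π Q R : X → ℝ) :
    ∃ N : ℝ, 0 ≤ N ∧ (∀ a, |Real.log (rootDensity π 1 Q a)| ≤ N) ∧
      ∀ a, |Real.log (rootDensity π 1 R a)| ≤ N := by
  refine ⟨∑ a, (|Real.log (rootDensity π 1 Q a)| + |Real.log (rootDensity π 1 R a)|),
    Finset.sum_nonneg fun a _ => by positivity, fun a => ?_, fun a => ?_⟩
  · exact le_trans (le_add_of_nonneg_right (abs_nonneg _)) (Finset.single_le_sum
      (f := fun a => |Real.log (rootDensity π 1 Q a)| + |Real.log (rootDensity π 1 R a)|)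
      (fun a _ => by positivity) (Finset.mem_univ a))
  · exact le_trans (le_add_of_nonneg_left (abs_nonneg _)) (Finset.single_le_sum
      (f := fun a => |Real.log (rootDensity π 1 Q a)| + |Real.log (rootDensity π 1 R a)|)
      (fun a _ => by positivity) (Finset.mem_univ a))

lemma logDensity_update_sub {X : Type*} (π Q R : X → ℝ) (m : ℕ) {n : ℕ} (x : Fin n → X)
    (k : Fin n) (a b : X) :
    logDensity π Q R m (Function.update x k b) - logDensity π Q R m (Function.update x k a) =
      Real.log (rootDensity π 1 (blockDist Q R m k) b) -
        Real.log (rootDensity π 1 (blockDist Q R m k) a) := by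
  rw [logDensity, logDensity, ← Finset.sum_sub_distrib, Finset.sum_eq_single k]
  · simp
  · intro i _ hi
    rw [Function.update_of_ne hi, Function.update_of_ne hi, sub_self]
  · simp

lemma abs_energyForm_one_le {L : Matrix X X ℝ} (hrow : ∀ x, ∑ y, L x y = 0)
    {π : X → ℝ} (hpos : ∀ a, 0 < π a) {M N : ℝ} {v : X → ℝ}
    (hv : ∀ a, 0 ≤ v a) (hvM : ∀ a, v a ≤ M) (hM : 0 ≤ M)
    (hN : ∀ a b, |Real.log (v b) - Real.log (v a)| ≤ N) :
    |energyForm L π 1 v| ≤ (∑ x, ∑ y, π x * |L x y|) * (M * N) := by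
  rw [energyForm, if_pos rfl]
  exact abs_dirichlet_le hrow hpos hM
    (fun x y => abs_sub_le_of_nonneg_of_le (hv y) (hvM y) (hv x) (hvM x)) hN

lemma tendsto_energy_damped {L : Matrix X X ℝ} (hsymm : L.IsSymm)
    (hoff : ∀ x y, x ≠ y → 0 ≤ L x y) (hrow : ∀ x, ∑ y, L x y = 0)
    {π : X → ℝ} (hpos : ∀ a, 0 < π a) (hπ : ∑ a, π a = 1) {Q R : X → ℝ}
    (hQ : Q ∈ stdSimplex ℝ X) (hR : R ∈ stdSimplex ℝ X) (hQ0 : ∀ a, 0 < Q a) (hR0 : ∀ a, 0 < R a)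
    {t β : ℝ} (ht : t ∈ Set.Icc (0 : ℝ) 1)
    (hβ : β < t * relEnt π Q + (1 - t) * relEnt π R) {s : ℝ} (hs : 0 ≤ s) :
    Tendsto (fun n : ℕ => ((1 / n : ℝ) : EReal) * energy (prodGen L) (prodDist π) 1
      (fun x : Fin n → X => 1 * ((∏ i, rootDensity π 1 (blockDist Q R ⌊t * n⌋₊ i) (x i)) *
        damping π Q R s (n * β) ⌊t * n⌋₊ x))) atTop
      (𝓝 ((t * energyForm L π 1 (rootDensity π 1 Q) +
        (1 - t) * energyForm L π 1 (rootDensity π 1 R) : ℝ) : EReal)) := by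
  obtain ⟨M, hM, hMQ, hMR⟩ := exists_rootDensity_le π 1 Q R
  obtain ⟨N, hN, hNQ, hNR⟩ := exists_abs_log_rootDensity_le π Q R
  have hC : ∀ (n : ℕ) (k : Fin n) (x : Fin n → X), |energyForm L π 1 fun a =>
      rootDensity π 1 (blockDist Q R ⌊t * n⌋₊ k) a *
        damping π Q R s (n * β) ⌊t * n⌋₊ (Function.update x k a)| ≤
      (∑ x, ∑ y, π x * |L x y|) * (M * (2 * N + s * (2 * N))) := by
    intro n k x
    have hb0 := rootDensity_pos hpos (blockDist_pos hQ0 hR0 ⌊t * n⌋₊ k) 1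
    have hb : ∀ a, rootDensity π 1 (blockDist Q R ⌊t * n⌋₊ k) a ≤ M := by
      rw [blockDist]
      split_ifs
      exacts [hMQ, hMR]
    have hbN : ∀ a, |Real.log (rootDensity π 1 (blockDist Q R ⌊t * n⌋₊ k) a)| ≤ N := by
      rw [blockDist]
      split_ifs
      exacts [hNQ, hNR]
    refine abs_energyForm_one_le hrow hpos
      (fun a => mul_nonneg (hb0 a).le (Real.exp_pos _).le) (fun a => ?_) hM fun a b => ?_
    · calc _ ≤ rootDensity π 1 (blockDist Q R ⌊t * n⌋₊ k) a * 1 :=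
            mul_le_mul_of_nonneg_left (damping_le_one _ _ _ _ _ _ _) (hb0 a).le
        _ ≤ M := by simpa using hb a
    · simp only [damping]
      rw [Real.log_mul (hb0 b).ne' (Real.exp_pos _).ne',
        Real.log_mul (hb0 a).ne' (Real.exp_pos _).ne', Real.log_exp,
        Real.log_exp, add_sub_add_comm]
      have h1 : |Real.log (rootDensity π 1 (blockDist Q R ⌊t * n⌋₊ k) b) -
          Real.log (rootDensity π 1 (blockDist Q R ⌊t * n⌋₊ k) a)| ≤ 2 * N :=
        (abs_sub _ _).trans (by linarith [hbN a, hbN b])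
      refine (abs_add_le _ _).trans (add_le_add h1 ?_)
      refine (abs_min_sub_min_le_max _ _ _ _).trans ?_
      rw [sub_self, abs_zero, max_eq_right (abs_nonneg _), ← mul_sub, abs_mul, abs_of_nonneg hs,
        sub_sub_sub_cancel_right, logDensity_update_sub]
      exact mul_le_mul_of_nonneg_left h1 hs
  have hC1 : ∀ S : X → ℝ, (∀ a, 0 < S a) → (∀ a, rootDensity π 1 S a ≤ M) →
      (∀ a, |Real.log (rootDensity π 1 S a)| ≤ N) → |energyForm L π 1 (rootDensity π 1 S)| ≤
      (∑ x, ∑ y, π x * |L x y|) * (M * (2 * N + s * (2 * N))) := by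
    intro S hS hSM hSN
    refine abs_energyForm_one_le hrow hpos (fun a => (rootDensity_pos hpos hS 1 a).le) hSM hM
      fun a b => (abs_sub _ _).trans ?_
    have : 0 ≤ s * (2 * N) := by positivity
    linarith [hSN a, hSN b]
  refine tendsto_energy hsymm hoff hrow hpos hπ one_pos hQ hR ht (c := fun _ => 1)
    (w := fun n x => damping π Q R s (n * β) ⌊t * n⌋₊ x)
    (A := fun n => {x : Fin n → X | n * β ≤ logDensity π Q R ⌊t * n⌋₊ x})
    (Eventually.of_forall fun _ => one_pos) (fun n x => (Real.exp_pos _).le)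
    (fun n x => damping_le_one _ _ _ _ _ _ _)
    (Or.inr ⟨hQ0, hR0, fun n x => Real.exp_pos _⟩) (fun n x hx => ?_)
    (tendsto_piProb_logDensity_lt hpos hQ hR ht hβ) (hC1 Q hQ0 hMQ hNQ) (hC1 R hR0 hMR hNR) hC
  rw [damping, min_eq_left, Real.exp_zero]
  exact mul_nonneg hs (sub_nonneg.2 hx)

lemma eventually_ent₂_damped_ge [Nonempty X] {π : X → ℝ} (hpos : ∀ a, 0 < π a) {Q R : X → ℝ}
    (hQ : Q ∈ stdSimplex ℝ X) (hR : R ∈ stdSimplex ℝ X) (hQ0 : ∀ a, 0 < Q a) (hR0 : ∀ a, 0 < R a)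
    {t α β : ℝ} (ht : t ∈ Set.Icc (0 : ℝ) 1) (hαβ : α < β)
    (hβ : β < t * relEnt π Q + (1 - t) * relEnt π R) {p : ℝ} (hp : 0 < p) (hp1 : p < 1) :
    ∀ᶠ n : ℕ in atTop,
      Admissible (fun x : Fin n → X => 1 * ((∏ i, rootDensity π 1 (blockDist Q R ⌊t * n⌋₊ i) (x i)) *
        damping π Q R ((1 - p) / p) (n * β) ⌊t * n⌋₊ x)) ∧
      α ≤ 1 / n * ent₂ (prodDist π) p 1 (fun x : Fin n → X =>
        1 * ((∏ i, rootDensity π 1 (blockDist Q R ⌊t * n⌋₊ i) (x i)) *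
          damping π Q R ((1 - p) / p) (n * β) ⌊t * n⌋₊ x)) := by
  have hB : ∀ (n : ℕ) (i : Fin n), blockDist Q R ⌊t * n⌋₊ i ∈ stdSimplex ℝ X := fun n =>
    blockDist_mem hQ hR _
  have hs : 0 ≤ (1 - p) / p := div_nonneg (by linarith) hp.le
  have hlim : Tendsto (fun n : ℕ => β + p / (1 - p) * Real.log (1 / 2) * (n : ℝ)⁻¹) atTop (𝓝 β) := by
    simpa using (tendsto_inv_atTop_nhds_zero_nat.const_mul
      (p / (1 - p) * Real.log (1 / 2))).const_add β
  filter_upwards [(tendsto_piProb_logDensity_lt hpos hQ hR ht hβ).eventually_lt_const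
    (by norm_num : (0 : ℝ) < 1 / 2), hlim.eventually_const_lt hαβ, eventually_gt_atTop 0]
    with n hn hnα hn0
  have hn' : (0 : ℝ) < n := by exact_mod_cast hn0
  set f : (Fin n → X) → ℝ := fun x =>
    1 * ((∏ i, rootDensity π 1 (blockDist Q R ⌊t * n⌋₊ i) (x i)) *
      damping π Q R ((1 - p) / p) (n * β) ⌊t * n⌋₊ x) with hf
  have hfexp : ∀ x, f x = Real.exp (logDensity π Q R ⌊t * n⌋₊ x +
      min 0 ((1 - p) / p * (logDensity π Q R ⌊t * n⌋₊ x - n * β))) := fun x => by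
    simp only [hf]
    rw [one_mul, prod_rootDensity_eq_exp hpos hQ0 hR0, damping, ← Real.exp_add]
  have hfpos : ∀ x, 0 < f x := fun x => by
    rw [hfexp]
    exact Real.exp_pos _
  have hadm : Admissible f := ⟨fun x => (hfpos x).le, fun h => by
    obtain ⟨a⟩ := ‹Nonempty X›
    exact (hfpos fun _ => a).ne' (congrFun h _)⟩
  refine ⟨hadm, ?_⟩
  have hW : 1 / 2 ≤ mean (prodDist π) (fun x => f x ^ (1 : ℝ)) := by
    have h1 := mean_perturbed_rpow hpos one_pos (hB n) one_pos
      (w := damping π Q R ((1 - p) / p) (n * β) ⌊t * n⌋₊) fun x => (Real.exp_pos _).le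
    rw [Real.one_rpow, one_mul] at h1
    rw [hf, h1]
    refine le_trans ?_ (one_sub_piProb_le_mean (hB n) 1
      (w := damping π Q R ((1 - p) / p) (n * β) ⌊t * n⌋₊) (fun x => (Real.exp_pos _).le)
      (A := {x : Fin n → X | n * β ≤ logDensity π Q R ⌊t * n⌋₊ x}) fun x hx => ?_)
    · linarith
    · rw [damping, min_eq_left, Real.exp_zero]
      exact mul_nonneg hs (sub_nonneg.2 hx)
  have hEp : mean (prodDist π) (fun x => f x ^ p) ≤ Real.exp (-((1 - p) * (n * β))) := by
    calc mean (prodDist π) (fun x => f x ^ p)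
        ≤ mean (prodDist π) (fun x => Real.exp (-((1 - p) * (n * β))) *
            (∏ i, rootDensity π 1 (blockDist Q R ⌊t * n⌋₊ i) (x i)) ^ (1 : ℝ)) := by
          refine mean_mono (fun x => (prodDist_pos hpos x).le) fun x => ?_
          rw [hfexp, prod_rootDensity_eq_exp hpos hQ0 hR0, ← Real.exp_mul, Real.rpow_one,
            ← Real.exp_add, Real.exp_le_exp]
          set l := logDensity π Q R ⌊t * n⌋₊ x
          have h1 : min 0 ((1 - p) / p * (l - n * β)) ≤ (1 - p) / p * (l - n * β) :=
            min_le_right _ _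
          have h2 := mul_le_mul_of_nonneg_right h1 hp.le
          have h3 : (1 - p) / p * (l - n * β) * p = (1 - p) * (l - n * β) := by
            field_simp
          rw [h3] at h2
          linarith
      _ = Real.exp (-((1 - p) * (n * β))) := by
          rw [mean_const_mul]
          simp only [mean, prodDist_mul_prod_rpow hpos one_pos fun i => (hB n i).1]
          rw [sum_piDist fun i => (hB n i).2, mul_one]
  have hE := mean_pos (prodDist_pos hpos) (admissible_rpow hadm p)
  have hlogp : Real.log (mean (prodDist π) (fun x => f x ^ p)) ≤ -((1 - p) * (n * β)) :=
    (Real.log_le_iff_le_exp hE).2 hEp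
  have hlog1 := Real.log_le_log (by norm_num) hW
  rw [ent₂_eq_log_sub_log (prodDist_pos hpos) hadm hp one_pos hp1.ne]
  set a := Real.log (mean (prodDist π) (fun x => f x ^ p))
  set b := Real.log (mean (prodDist π) (fun x => f x ^ (1 : ℝ)))
  have h1p : 0 < 1 - p := by linarith
  have e : 1 / (p - 1) * a - p / (p - 1) * b = 1 / (1 - p) * (-a) + p / (1 - p) * b := by
    have : p - 1 = -(1 - p) := by ring
    rw [this]
    field_simp
    ring
  rw [e]
  have h2 : n * β + p / (1 - p) * Real.log (1 / 2) ≤ 1 / (1 - p) * (-a) + p / (1 - p) * b := by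
    refine add_le_add ?_ (mul_le_mul_of_nonneg_left hlog1 (by positivity))
    rw [one_div_mul_eq_div, le_div_iff₀ h1p]
    linarith
  have h3 := mul_le_mul_of_nonneg_left h2 (by positivity : 0 ≤ 1 / (n : ℝ))
  refine hnα.le.trans (le_trans (le_of_eq ?_) h3)
  field_simp

end OrderOne

section Spike

variable {X : Type*} [Fintype X]

open scoped Classical in
/-- The function with value `b` at `z` and `1` elsewhere. -/
def spike {Ω : Type*} (z : Ω) (b : ℝ) (x : Ω) : ℝ := if x = z then b else 1

lemma spike_pos {Ω : Type*} (z : Ω) {b : ℝ} (hb : 0 < b) (x : Ω) : 0 < spike z b x := by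
  rw [spike]
  split_ifs
  exacts [hb, one_pos]

lemma mean_spike_rpow {Ω : Type*} [Fintype Ω] {π : Ω → ℝ} (hπ : ∑ a, π a = 1) (z : Ω) (b r : ℝ) :
    mean π (fun x => spike z b x ^ r) = 1 + π z * (b ^ r - 1) := by
  classical
  have : ∀ x, π x * spike z b x ^ r = π x + if x = z then π z * (b ^ r - 1) else 0 := by
    intro x
    rw [spike]
    split_ifs with h
    · rw [h]
      ring
    · simp
  simp only [mean, this, Finset.sum_add_distrib, hπ, Finset.sum_ite_eq', Finset.mem_univ, if_true]

lemma abs_energyForm_spike_le {L : Matrix X X ℝ} (hrow : ∀ x, ∑ y, L x y = 0)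
    {π : X → ℝ} (hpos : ∀ a, 0 < π a) {q : ℝ} (hq : 1 ≤ q) :
    ∃ C : ℝ, 0 ≤ C ∧ ∀ (z : X) (b : ℝ), 1 ≤ b →
      |energyForm L π q (spike z b)| ≤ C * (b ^ q * (1 + Real.log (b ^ q))) := by
  have hK : 0 ≤ ∑ x, ∑ y, π x * |L x y| := Finset.sum_nonneg fun x _ => Finset.sum_nonneg
    fun y _ => mul_nonneg (hpos x).le (abs_nonneg _)
  have hs0 : ∀ (z : X) (b : ℝ), 1 ≤ b → ∀ a, 0 ≤ spike z b a := fun z b hb a =>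
    (spike_pos z (by linarith) a).le
  have hsb : ∀ (z : X) (b : ℝ), 1 ≤ b → ∀ a, spike z b a ≤ b := fun z b hb a => by
    rw [spike]
    split_ifs
    exacts [le_rfl, hb]
  rcases hq.eq_or_lt with rfl | hq
  · refine ⟨_, hK, fun z b hb => ?_⟩
    have hl := Real.log_nonneg hb
    refine (abs_energyForm_one_le hrow hpos (hs0 z b hb) (hsb z b hb) (by linarith)
      (N := Real.log b) fun x y => ?_).trans ?_
    · have h1 : ∀ a, 0 ≤ Real.log (spike z b a) ∧ Real.log (spike z b a) ≤ Real.log b := by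
        intro a
        rw [spike]
        split_ifs
        · exact ⟨hl, le_rfl⟩
        · rw [Real.log_one]
          exact ⟨le_rfl, hl⟩
      exact abs_sub_le_of_nonneg_of_le (h1 y).1 (h1 y).2 (h1 x).1 (h1 x).2
    · rw [Real.rpow_one]
      exact mul_le_mul_of_nonneg_left (mul_le_mul_of_nonneg_left (by linarith) (by linarith)) hK
  · have hq' : 0 ≤ 1 / (q - 1) := one_div_nonneg.2 (by linarith)
    refine ⟨1 / (q - 1) * ∑ x, ∑ y, π x * |L x y|, mul_nonneg hq' hK, fun z b hb => ?_⟩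
    refine (abs_energyForm_le_of_one_lt hrow hpos hq (hs0 z b hb) (hsb z b hb)
      (by linarith)).trans ?_
    rw [mul_rpow_sub_one (by linarith) (by linarith), ← mul_assoc]
    refine mul_le_mul_of_nonneg_left (le_mul_of_one_le_right (by positivity) ?_)
      (mul_nonneg hq' hK)
    linarith [Real.log_nonneg (Real.one_le_rpow hb (by linarith : 0 ≤ q))]

/-- The energy of a spike at a constant sequence. -/
lemma energy_spike_le {L : Matrix X X ℝ} (hrow : ∀ x, ∑ y, L x y = 0)
    {π : X → ℝ} (hpos : ∀ a, 0 < π a) (hπ : ∑ a, π a = 1) {q : ℝ} (hq : 1 ≤ q) (z : X) {E b : ℝ}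
    (hb : 1 ≤ b) (hE : |energyForm L π q (spike z b)| ≤ E) {n : ℕ} (hn : 0 < n) :
    ((1 / n : ℝ) : EReal) * energy (prodGen L) (prodDist π) q (spike (fun _ : Fin n => z) b) ≤
      ((E * π z ^ n / π z : ℝ) : EReal) := by
  classical
  have hq0 : 0 < q := by linarith
  have hn' : (0 : ℝ) < n := by exact_mod_cast hn
  have hb0 : 0 < b := by linarith
  have hE0 : 0 ≤ E := (abs_nonneg _).trans hE
  have hsum : ∑ x : Fin n → X, prodDist π x = 1 := sum_piDist (Q := fun _ => π) fun _ => hπ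
  have hslice : ∀ (k : Fin n) (x : Fin n → X),
      energyForm L π q (fun a => spike (fun _ : Fin n => z) b (Function.update x k a)) ≤
        E * if x ∈ {x : Fin n → X | Function.update x k z ∈ ({fun _ => z} : Set (Fin n → X))}
          then 1 else 0 := by
    intro k x
    simp only [Set.mem_ofPred_eq, Set.mem_singleton_iff]
    by_cases h : Function.update x k z = fun _ => z
    · have e : (fun a => spike (fun _ : Fin n => z) b (Function.update x k a)) = spike z b := by
        funext a
        rw [spike, spike]
        congr 1
        refine propext ⟨fun h' => by simpa using congrFun h' k, fun h' => ?_⟩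
        rw [h', h]
      rw [e, if_pos h, mul_one]
      exact (le_abs_self _).trans hE
    · have e : (fun a => spike (fun _ : Fin n => z) b (Function.update x k a)) = fun _ => 1 := by
        funext a
        rw [spike, if_neg]
        intro h'
        have ha : a = z := by simpa using congrFun h' k
        exact h (ha ▸ h')
      rw [e, if_neg h, mul_zero]
      refine le_of_eq ?_
      rw [energyForm, dirichlet_eq hrow, dirichlet_eq hrow]
      simp
  have hform : energyForm (prodGen L) (prodDist π) q (spike (fun _ : Fin n => z) b) ≤
      n * (E * π z ^ n / π z) := by
    rw [energyForm_prodGen L hπ]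
    have hk : ∀ k : Fin n, (mean (prodDist π) fun x => energyForm L π q fun a =>
        spike (fun _ : Fin n => z) b (Function.update x k a)) ≤ E * π z ^ n / π z := by
      intro k
      refine (mean_mono (fun x => (prodDist_pos hpos x).le) (hslice k)).trans ?_
      rw [mean_const_mul, mul_div_assoc]
      refine mul_le_mul_of_nonneg_left ?_ hE0
      rw [le_div_iff₀ (hpos z), mul_comm]
      have h1 := mul_piProb_update_le (Q := fun _ : Fin n => π)
        (fun _ => ⟨fun a => (hpos a).le, hπ⟩) ({fun _ => z} : Set (Fin n → X)) k z
      have h2 : piProb (fun _ : Fin n => π) ({fun _ => z} : Set (Fin n → X)) = π z ^ n := by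
        rw [piProb, mean, Finset.sum_eq_single (fun _ : Fin n => z)]
        · simp [piDist]
        · intro x _ hx
          simp [hx]
        · simp
      rw [h2] at h1
      refine le_trans (le_of_eq ?_) h1
      rw [piProb]
      congr!
    calc _ ≤ ∑ _k : Fin n, E * π z ^ n / π z := Finset.sum_le_sum fun k _ => hk k
      _ = _ := by simp
  rw [energy_eq hq0.ne' (fun x => (spike_pos _ hb0 x).le)
    (regular_of_pos _ _ (spike_pos _ hb0)), ← EReal.coe_mul, EReal.coe_le_coe_iff]
  have hm : 1 ≤ mean (prodDist π) (fun x => spike (fun _ : Fin n => z) b x ^ q) := by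
    rw [mean_spike_rpow hsum]
    have := Real.one_le_rpow hb hq0.le
    nlinarith [prodDist_pos hpos (fun _ : Fin n => z)]
  have hR : 0 ≤ E * π z ^ n / π z := by
    have := hpos z
    positivity
  rw [one_div_mul_eq_div, div_le_iff₀ hn', div_le_iff₀ (by linarith)]
  calc _ ≤ n * (E * π z ^ n / π z) := hform
    _ ≤ n * (E * π z ^ n / π z) * mean (prodDist π)
          (fun x => spike (fun _ : Fin n => z) b x ^ q) :=
        le_mul_of_one_le_right (by positivity) hm
    _ = _ := by ring

lemma ent₂_spike_ge {Ω : Type*} [Fintype Ω] {π : Ω → ℝ} (hpos : ∀ a, 0 < π a)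
    (hπ : ∑ a, π a = 1) {p q : ℝ} (hq : 0 < q) (hpq : q < p) (z : Ω) {η : ℝ} (hη : 0 < η)
    (hη1 : η ≤ 1) :
    -Real.log (π z) + p / (p - q) * (Real.log η - Real.log 2) ≤
      ent₂ π p q (spike z ((1 + η / π z) ^ (1 / q))) := by
  have hp : 0 < p := by linarith
  have hz := hpos z
  set B := 1 + η / π z with hB
  have hB1 : 1 ≤ B := by
    have : 0 < η / π z := div_pos hη hz
    linarith
  have hb : 0 < B ^ (1 / q) := Real.rpow_pos_of_pos (by linarith) _
  have hadm : Admissible (spike z (B ^ (1 / q))) :=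
    ⟨fun x => (spike_pos z hb x).le, fun h => (spike_pos z hb z).ne' (congrFun h z)⟩
  rw [ent₂_eq_log_sub_log hpos hadm hp hq hpq.ne']
  have h1 : Real.log (mean π (fun x => spike z (B ^ (1 / q)) x ^ q)) ≤ Real.log 2 := by
    refine Real.log_le_log (mean_pos hpos (admissible_rpow hadm q)) ?_
    rw [mean_spike_rpow hπ, ← Real.rpow_mul (by linarith), one_div_mul_cancel hq.ne',
      Real.rpow_one, hB, add_sub_cancel_left, mul_div_cancel₀ _ hz.ne']
    linarith
  have h2 : Real.log (π z) + p / q * (Real.log η - Real.log (π z)) ≤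
      Real.log (mean π (fun x => spike z (B ^ (1 / q)) x ^ p)) := by
    have h3 : π z * (η / π z) ^ (p / q) ≤ mean π (fun x => spike z (B ^ (1 / q)) x ^ p) := by
      have h4 : π z * spike z (B ^ (1 / q)) z ^ p ≤
          mean π (fun x => spike z (B ^ (1 / q)) x ^ p) :=
        Finset.single_le_sum (f := fun x => π x * spike z (B ^ (1 / q)) x ^ p)
          (fun x _ => mul_nonneg (hpos x).le (Real.rpow_nonneg (spike_pos z hb x).le _))
          (Finset.mem_univ z)
      refine le_trans (mul_le_mul_of_nonneg_left ?_ hz.le) h4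
      rw [spike, if_pos rfl, ← Real.rpow_mul (by linarith), one_div_mul_eq_div]
      exact Real.rpow_le_rpow (by positivity) (by linarith) (by positivity)
    have hr : 0 < (η / π z) ^ (p / q) := Real.rpow_pos_of_pos (div_pos hη hz) _
    have h5 := Real.log_le_log (mul_pos hz hr) h3
    rwa [Real.log_mul hz.ne' hr.ne', Real.log_rpow (div_pos hη hz),
      Real.log_div hη.ne' hz.ne'] at h5
  have hd : 0 < p - q := by linarith
  have h6 := mul_le_mul_of_nonneg_left h2 (by positivity : 0 ≤ q / (p - q))
  have h7 := mul_le_mul_of_nonneg_left h1 (by positivity : 0 ≤ p / (p - q))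
  have e : q / (p - q) * (Real.log (π z) + p / q * (Real.log η - Real.log (π z))) =
      -Real.log (π z) + p / (p - q) * Real.log η := by
    field_simp
    ring
  rw [e] at h6
  linarith

/-- Above the diagonal, spikes have vanishing energy and nearly maximal entropy. -/
lemma exists_spike [Nonempty X] {L : Matrix X X ℝ} (hrow : ∀ x, ∑ y, L x y = 0)
    {π : X → ℝ} (hpos : ∀ a, 0 < π a) (hπ : ∑ a, π a = 1) {p q : ℝ} (hq : 1 ≤ q) (hpq : q < p)
    {α : ℝ} (hα0 : 0 ≤ α) (hα : α < -Real.log (⨅ x, π x)) :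
    ∃ (f : ∀ n : ℕ, (Fin n → X) → ℝ) (e : ℕ → ℝ), Tendsto e atTop (𝓝 0) ∧ ∀ᶠ n : ℕ in atTop,
      Admissible (f n) ∧ α ≤ 1 / n * ent₂ (prodDist π) p q (f n) ∧
      ((1 / n : ℝ) : EReal) * energy (prodGen L) (prodDist π) q (f n) ≤ (e n : EReal) := by
  obtain ⟨z, hz⟩ := exists_eq_ciInf_of_finite (f := π)
  rw [← hz] at hα
  have hq0 : 0 < q := by linarith
  have hθ := hpos z
  set θ := π z with hθdef
  have hlog : Real.log θ < 0 := by linarith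
  have hθ1 : θ < 1 := (Real.log_neg_iff hθ).1 hlog
  obtain ⟨C, hC0, hC⟩ := abs_energyForm_spike_le hrow hpos hq
  let B : ℕ → ℝ := fun n => 1 + ((n : ℝ) ^ 2)⁻¹ / θ ^ n
  have hBpos : ∀ n, 1 ≤ B n := fun n => by
    have : 0 ≤ ((n : ℝ) ^ 2)⁻¹ / θ ^ n := by positivity
    simp only [B]
    linarith
  refine ⟨fun n => spike (fun _ => z) (B n ^ (1 / q)), fun n =>
    C / θ * ((θ ^ n + ((n : ℝ) ^ 2)⁻¹) * (1 + (Real.log 2 + n * -Real.log θ))), ?_, ?_⟩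
  · have h1 : Tendsto (fun n : ℕ => θ ^ n) atTop (𝓝 0) :=
      tendsto_pow_atTop_nhds_zero_of_lt_one hθ.le hθ1
    have h2 : Tendsto (fun n : ℕ => (n : ℝ) * θ ^ n) atTop (𝓝 0) :=
      tendsto_self_mul_const_pow_of_lt_one hθ.le hθ1
    have h3 : Tendsto (fun n : ℕ => ((n : ℝ))⁻¹) atTop (𝓝 0) := tendsto_inv_atTop_nhds_zero_nat
    have h4 : Tendsto (fun n : ℕ => (((n : ℝ))⁻¹) ^ 2) atTop (𝓝 0) := by simpa using h3.pow 2
    have h5 : Tendsto (fun n : ℕ => C / θ * ((1 + Real.log 2) * (θ ^ n + ((n : ℝ)⁻¹) ^ 2) +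
        -Real.log θ * (n * θ ^ n + (n : ℝ)⁻¹))) atTop (𝓝 0) := by
      simpa using (((h1.add h4).const_mul (1 + Real.log 2)).add
        ((h2.add h3).const_mul (-Real.log θ))).const_mul (C / θ)
    refine h5.congr' ?_
    filter_upwards [eventually_gt_atTop 0] with n hn
    have hn' : (n : ℝ) ≠ 0 := by exact_mod_cast hn.ne'
    field_simp
    ring
  · have hlim : Tendsto (fun n : ℕ => -Real.log θ + p / (p - q) *
        (-2 * (Real.log n / n) - Real.log 2 * (n : ℝ)⁻¹)) atTop (𝓝 (-Real.log θ)) := by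
      have h1 : Tendsto (fun n : ℕ => Real.log n / n) atTop (𝓝 0) := by
        have := (Real.tendsto_pow_log_div_mul_add_atTop 1 0 1 one_ne_zero).comp
          (tendsto_natCast_atTop_atTop (R := ℝ))
        simpa [Function.comp_def] using this
      have h2 : Tendsto (fun n : ℕ => ((n : ℝ))⁻¹) atTop (𝓝 0) := tendsto_inv_atTop_nhds_zero_nat
      simpa using (((h1.const_mul (-2)).sub (h2.const_mul (Real.log 2))).const_mul
        (p / (p - q))).const_add (-Real.log θ)
    filter_upwards [hlim.eventually_const_lt hα, eventually_gt_atTop 0] with n hn hn0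
    have hn1 : (1 : ℝ) ≤ n := by exact_mod_cast hn0
    have hn' : (0 : ℝ) < n := by linarith
    have hb : 1 ≤ B n ^ (1 / q) := Real.one_le_rpow (hBpos n) (by positivity)
    have hη0 : 0 < ((n : ℝ) ^ 2)⁻¹ := by positivity
    have hη1 : ((n : ℝ) ^ 2)⁻¹ ≤ 1 := inv_le_one_of_one_le₀ (one_le_pow₀ hn1)
    have hsum : ∑ x : Fin n → X, prodDist π x = 1 := sum_piDist (Q := fun _ => π) fun _ => hπ
    have hzn : prodDist π (fun _ : Fin n => z) = θ ^ n := by simp [prodDist, hθdef]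
    refine ⟨⟨fun x => (spike_pos _ (by linarith) x).le, fun h =>
      (spike_pos (fun _ : Fin n => z) (by linarith) fun _ => z).ne' (congrFun h _)⟩, ?_, ?_⟩
    · have h1 := ent₂_spike_ge (prodDist_pos hpos) hsum hq0 hpq (fun _ : Fin n => z) hη0 hη1
      rw [hzn] at h1
      have h2 := mul_le_mul_of_nonneg_left h1 (by positivity : 0 ≤ 1 / (n : ℝ))
      refine hn.le.trans (le_trans (le_of_eq ?_) h2)
      rw [Real.log_pow, Real.log_inv, Real.log_pow]
      push_cast
      field_simp
    · refine (energy_spike_le hrow hpos hπ hq z hb (hC z _ hb) hn0).trans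
        (EReal.coe_le_coe_iff.2 ?_)
      rw [← Real.rpow_mul (by linarith [hBpos n]), one_div_mul_cancel hq0.ne', Real.rpow_one]
      have hBθ : B n * θ ^ n = θ ^ n + ((n : ℝ) ^ 2)⁻¹ := by
        simp only [B]
        have := pow_pos hθ n
        field_simp
      have hBle : B n ≤ 2 / θ ^ n := by
        rw [le_div_iff₀ (pow_pos hθ n), hBθ]
        have : θ ^ n ≤ 1 := pow_le_one₀ hθ.le hθ1.le
        linarith
      have hlogB : Real.log (B n) ≤ Real.log 2 + n * -Real.log θ := by
        refine (Real.log_le_log (by linarith [hBpos n]) hBle).trans (le_of_eq ?_)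
        rw [Real.log_div (by norm_num) (pow_pos hθ n).ne', Real.log_pow]
        ring
      calc C * (B n * (1 + Real.log (B n))) * θ ^ n / θ
          = C / θ * ((B n * θ ^ n) * (1 + Real.log (B n))) := by ring
        _ ≤ _ := by
          rw [hBθ]
          have : 0 ≤ C / θ := div_nonneg hC0 hθ.le
          gcongr

end Spike

section Tightness

variable {X : Type*} [Fintype X]

lemma renyiSobolev_le {L : Matrix X X ℝ} {π : X → ℝ} {p q : ℝ} {n : ℕ} {α : ℝ}
    {f : (Fin n → X) → ℝ} (hf : Admissible f) (hα : α ≤ 1 / n * ent₂ (prodDist π) p q f) :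
    renyiSobolev L π p q n α ≤
      ((1 / n : ℝ) : EReal) * energy (prodGen L) (prodDist π) q f :=
  iInf₂_le f ⟨hf, hα⟩

lemma convEnvelope_nonneg {L : Matrix X X ℝ} (hsymm : L.IsSymm)
    (hoff : ∀ x y, x ≠ y → 0 ≤ L x y) (hrow : ∀ x, ∑ y, L x y = 0)
    {π : X → ℝ} (hpos : ∀ a, 0 < π a) {q : ℝ} (hq : 0 < q) (α : ℝ) :
    0 ≤ convEnvelope (logSobolev L π q) α := by
  refine le_convEnvelope_of_affine (m := 0) (μ := 0) fun a => ?_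
  rw [logSobolev, if_neg hq.ne']
  refine le_iInf₂ fun f hf => ?_
  simpa using energy_nonneg_of_energyForm_nonneg (fun x => (hpos x).le) q hf.1.1
    (energyForm_nonneg hsymm hoff hrow (fun x => (hpos x).le) hf.1.1)

/-- The lower bound is tight if it is nearly attained by feasible sequences. -/
lemma tendsto_renyiSobolev_of_approx {L : Matrix X X ℝ} (hsymm : L.IsSymm)
    (hoff : ∀ x y, x ≠ y → 0 ≤ L x y) (hrow : ∀ x, ∑ y, L x y = 0)
    {π : X → ℝ} (hpos : ∀ a, 0 < π a) (hπ : ∑ a, π a = 1) {p q : ℝ} (hp : 0 ≤ p) (hq : 0 < q)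
    (hpq : p ≤ q) {α : ℝ}
    (h : ∀ δ : ℝ, 0 < δ → ∃ (f : ∀ n : ℕ, (Fin n → X) → ℝ) (l : EReal),
      (∀ᶠ n : ℕ in atTop, Admissible (f n) ∧ α ≤ 1 / n * ent₂ (prodDist π) p q (f n)) ∧
      l ≤ convEnvelope (logSobolev L π q) α + (δ : EReal) ∧
      Tendsto (fun n : ℕ => ((1 / n : ℝ) : EReal) * energy (prodGen L) (prodDist π) q (f n))
        atTop (𝓝 l)) :
    Tendsto (fun n : ℕ => renyiSobolev L π p q n α) atTop (𝓝 (phi L π p q α)) := by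
  have hphi : phi L π p q α = convEnvelope (logSobolev L π q) α := by rw [phi, if_pos hpq]
  refine tendsto_order.2 ⟨fun a ha => ?_, fun b hb => ?_⟩
  · filter_upwards [eventually_ge_atTop 1] with n hn
    exact ha.trans_le (phi_le_renyiSobolev hsymm hoff hrow hpos hπ hp hq.le hn α)
  · rw [hphi] at hb
    obtain ⟨c, hc1, hc2⟩ := EReal.lt_iff_exists_real_btwn.1 hb
    have h0 := convEnvelope_nonneg hsymm hoff hrow hpos hq α
    have htop : convEnvelope (logSobolev L π q) α ≠ ⊤ := (hc1.trans_le le_top).ne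
    have hbot : convEnvelope (logSobolev L π q) α ≠ ⊥ :=
      (lt_of_lt_of_le EReal.bot_lt_zero h0).ne'
    lift convEnvelope (logSobolev L π q) α to ℝ using ⟨htop, hbot⟩ with r
    obtain ⟨f, l, hf, hl, hlim⟩ := h (c - r) (sub_pos.2 (EReal.coe_lt_coe_iff.1 hc1))
    rw [← EReal.coe_add, add_sub_cancel] at hl
    filter_upwards [hf, hlim.eventually_lt_const (hl.trans_lt hc2)] with n hn hn'
    exact (renyiSobolev_le hn.1 hn.2).trans_lt hn'

lemma exists_extremal_mix [Nonempty X] {L : Matrix X X ℝ} (hsymm : L.IsSymm)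
    (hoff : ∀ x y, x ≠ y → 0 ≤ L x y) (hrow : ∀ x, ∑ y, L x y = 0)
    {π : X → ℝ} (hpos : ∀ a, 0 < π a) {q : ℝ} (hq : 1 < q) {α : ℝ}
    (hα : α < -Real.log (⨅ x, π x)) {δ : ℝ} (hδ : 0 < δ) :
    ∃ Q ∈ stdSimplex ℝ X, ∃ R ∈ stdSimplex ℝ X, ∃ t ∈ Set.Icc (0 : ℝ) 1,
      α < t * relEnt π Q + (1 - t) * relEnt π R ∧
      ((t * energyForm L π q (rootDensity π q Q) +
        (1 - t) * energyForm L π q (rootDensity π q R) : ℝ) : EReal) ≤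
          convEnvelope (logSobolev L π q) α + (δ : EReal) := by
  refine exists_mix_lt (fun Q hQ => ?_) ?_ (fun m _ hm =>
    le_convEnvelope_of_one_lt hsymm hoff hrow hpos hq hα hm) hδ
  · exact energyForm_nonneg hsymm hoff hrow (fun a => (hpos a).le)
      (rootDensity_nonneg hpos q hQ.1) (regular_of_one_lt L hq _)
  · obtain ⟨Q, hQ, h⟩ := exists_relEnt_eq hpos
    exact ⟨Q, hQ, h ▸ hα⟩

lemma tendsto_renyiSobolev_of_one_lt [Nonempty X] {L : Matrix X X ℝ} (hsymm : L.IsSymm)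
    (hoff : ∀ x y, x ≠ y → 0 ≤ L x y) (hrow : ∀ x, ∑ y, L x y = 0)
    {π : X → ℝ} (hpos : ∀ a, 0 < π a) (hπ : ∑ a, π a = 1) {p q : ℝ} (hp : 0 ≤ p) (hq : 1 < q)
    (hpq : p ≤ q) {α : ℝ} (hα : α < -Real.log (⨅ x, π x)) :
    Tendsto (fun n : ℕ => renyiSobolev L π p q n α) atTop (𝓝 (phi L π p q α)) := by
  have hq0 : 0 < q := by linarith
  refine tendsto_renyiSobolev_of_approx hsymm hoff hrow hpos hπ hp hq0 hpq fun δ hδ => ?_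
  obtain ⟨Q, hQ, R, hR, t, ht, h1, h2⟩ := exists_extremal_mix hsymm hoff hrow hpos hq hα hδ
  obtain ⟨ε₀, hε₀, h3⟩ := eventually_ent₂_extremal_ge hpos hp hpq hq0 hQ hR ht h1
  exact ⟨extremal π q Q R t (ε₀ / 2), _, h3 _ (by linarith) (by linarith), h2,
    tendsto_energy_extremal hsymm hoff hrow hpos hπ hq hQ hR ht (by linarith)⟩

lemma tendsto_renyiSobolev_of_eq_one [Nonempty X] {L : Matrix X X ℝ} (hsymm : L.IsSymm)
    (hoff : ∀ x y, x ≠ y → 0 ≤ L x y) (hrow : ∀ x, ∑ y, L x y = 0)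
    {π : X → ℝ} (hpos : ∀ a, 0 < π a) (hπ : ∑ a, π a = 1) {p : ℝ} (hp : 0 < p)
    (hp1 : p ≤ 1) {α : ℝ} (hα : α < -Real.log (⨅ x, π x)) :
    Tendsto (fun n : ℕ => renyiSobolev L π p 1 n α) atTop (𝓝 (phi L π p 1 α)) := by
  refine tendsto_renyiSobolev_of_approx hsymm hoff hrow hpos hπ hp.le one_pos hp1 fun δ hδ => ?_
  obtain ⟨Q, ⟨hQ, hQ0⟩, R, ⟨hR, hR0⟩, t, ht, h1, h2⟩ := exists_mix_lt (L := L) (π := π) (q := 1)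
    (T := {Q ∈ stdSimplex ℝ X | ∀ a, 0 < Q a}) (α := α)
    (fun Q hQ => energyForm_nonneg hsymm hoff hrow (fun a => (hpos a).le)
      (rootDensity_nonneg hpos 1 hQ.1.1) (regular_of_pos L 1 (rootDensity_pos hpos hQ.2 1)))
    (exists_pos_lt_relEnt hsymm hoff hrow hpos hα)
    (fun m _ hm => le_convEnvelope_of_eq_one hsymm hoff hrow hpos hα hm) hδ
  obtain ⟨β, hαβ, hβ⟩ := exists_between h1
  obtain ⟨r, hr0, hr1, hr⟩ : ∃ r : ℝ, 0 < r ∧ r < 1 ∧ ∀ (n : ℕ) (f : (Fin n → X) → ℝ),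
      Admissible f → ent₂ (prodDist π) r 1 f ≤ ent₂ (prodDist π) p 1 f := by
    rcases hp1.eq_or_lt with rfl | hp1
    · refine ⟨1 / 2, by norm_num, by norm_num, fun n f hf => ?_⟩
      refine (ent₂_le_normEnt (prodDist_pos hpos) hf (by norm_num) one_pos
        (by norm_num)).trans (le_of_eq ?_)
      rw [ent₂, if_neg (by norm_num), if_pos rfl]
    · exact ⟨p, hp, hp1, fun n f _ => le_rfl⟩
  refine ⟨_, _, ?_, h2, tendsto_energy_damped hsymm hoff hrow hpos hπ hQ hR hQ0 hR0 ht hβ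
    (s := (1 - r) / r) (div_nonneg (by linarith) hr0.le)⟩
  filter_upwards [eventually_ent₂_damped_ge hpos hQ hR hQ0 hR0 ht hαβ hβ hr0 hr1] with n hn
  exact ⟨hn.1, hn.2.trans (mul_le_mul_of_nonneg_left (hr n _ hn.1) (by positivity))⟩

lemma tendsto_renyiSobolev_of_lt [Nonempty X] {L : Matrix X X ℝ} (hsymm : L.IsSymm)
    (hoff : ∀ x y, x ≠ y → 0 ≤ L x y) (hrow : ∀ x, ∑ y, L x y = 0)
    {π : X → ℝ} (hpos : ∀ a, 0 < π a) (hπ : ∑ a, π a = 1) {p q : ℝ} (hq : 1 ≤ q)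
    (hpq : q < p) {α : ℝ} (hα0 : 0 ≤ α) (hα : α < -Real.log (⨅ x, π x)) :
    Tendsto (fun n : ℕ => renyiSobolev L π p q n α) atTop (𝓝 (phi L π p q α)) := by
  have hphi : phi L π p q α = 0 := by rw [phi, if_neg hpq.not_ge]
  obtain ⟨f, e, he, hf⟩ := exists_spike hrow hpos hπ hq hpq hα0 hα (L := L)
  rw [hphi]
  refine tendsto_of_tendsto_of_tendsto_of_le_of_le' (tendsto_const_nhds (x := (0 : EReal)))
    ((continuous_coe_real_ereal.tendsto 0).comp he) ?_ ?_
  · filter_upwards [eventually_ge_atTop 1] with n hn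
    rw [← hphi]
    exact phi_le_renyiSobolev hsymm hoff hrow hpos hπ (by linarith) (by linarith) hn α
  · filter_upwards [hf] with n hn
    exact (renyiSobolev_le hn.1 hn.2.1).trans hn.2.2

end Tightness

end RenyiSobolev

end

theorem theorem2 {X : Type*} [Fintype X] (L : Matrix X X ℝ) (hsymm : L.IsSymm)
    (hoff : ∀ x y, x ≠ y → 0 ≤ L x y) (hrow : ∀ x, ∑ y, L x y = 0)
    (π : X → ℝ) (hπ : π ∈ stdSimplex ℝ X) (hpos : ∀ x, 0 < π x)
    (hstat : ∀ y, ∑ x, π x * L x y = 0) :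
    -- the dimension-free lower bound
    (∀ p q : ℝ, 0 ≤ p → 0 ≤ q → ∀ n : ℕ, 1 ≤ n → ∀ α : ℝ,
      RenyiSobolev.phi L π p q α ≤ RenyiSobolev.renyiSobolev L π p q n α) ∧
    -- asymptotic tightness
    (∀ p q : ℝ, 0 ≤ p → 1 ≤ q → ¬ (p = 0 ∧ q = 1) →
      ∀ α : ℝ, 0 ≤ α → α < -Real.log (⨅ x, π x) →
      Tendsto (fun n : ℕ => RenyiSobolev.renyiSobolev L π p q n α) atTop
        (𝓝 (RenyiSobolev.phi L π p q α))) ∧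
    -- asymptotically extremal functions
    (∀ p q : ℝ, 0 ≤ p → p ≤ q → 1 < q →
      ∀ α : ℝ, 0 ≤ α → α < -Real.log (⨅ x, π x) →
      -- exactly feasible, with limit arbitrarily close to the bound
      (∀ δ : ℝ, 0 < δ → ∃ Q ∈ stdSimplex ℝ X, ∃ R ∈ stdSimplex ℝ X, ∃ t ∈ Set.Icc (0 : ℝ) 1,
        ∃ ε₀ : ℝ, 0 < ε₀ ∧ ∀ ε : ℝ, 0 < ε → ε < ε₀ →
          (∀ᶠ n : ℕ in atTop,
            RenyiSobolev.Admissible (RenyiSobolev.extremal π q Q R t ε n) ∧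
            α ≤ 1 / n * RenyiSobolev.ent₂ (RenyiSobolev.prodDist π) p q
              (RenyiSobolev.extremal π q Q R t ε n)) ∧
          ∃ l : EReal, l ≤ RenyiSobolev.convEnvelope (RenyiSobolev.logSobolev L π q) α + (δ : EReal) ∧
            Tendsto (fun n : ℕ => ((1 / n : ℝ) : EReal) *
              RenyiSobolev.energy (RenyiSobolev.prodGen L) (RenyiSobolev.prodDist π) q
                (RenyiSobolev.extremal π q Q R t ε n)) atTop (𝓝 l)) ∧
      -- fixed distributions, attaining the bound, with a constraint loss that vanishes with ε
      (∃ Q ∈ stdSimplex ℝ X, ∃ R ∈ stdSimplex ℝ X, ∃ t ∈ Set.Icc (0 : ℝ) 1,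
        ∀ δ : ℝ, 0 < δ → ∃ ε₀ : ℝ, 0 < ε₀ ∧ ∀ ε : ℝ, 0 < ε → ε < ε₀ →
          (∀ᶠ n : ℕ in atTop,
            RenyiSobolev.Admissible (RenyiSobolev.extremal π q Q R t ε n) ∧
            α - δ ≤ 1 / n * RenyiSobolev.ent₂ (RenyiSobolev.prodDist π) p q
              (RenyiSobolev.extremal π q Q R t ε n)) ∧
          Tendsto (fun n : ℕ => ((1 / n : ℝ) : EReal) *
            RenyiSobolev.energy (RenyiSobolev.prodGen L) (RenyiSobolev.prodDist π) q
              (RenyiSobolev.extremal π q Q R t ε n)) atTop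
            (𝓝 (RenyiSobolev.convEnvelope (RenyiSobolev.logSobolev L π q) α)))) := by
  have : Nonempty X := by
    by_contra h
    rw [not_nonempty_iff] at h
    simpa using hπ.2
  refine ⟨fun p q hp hq n hn α =>
      RenyiSobolev.phi_le_renyiSobolev hsymm hoff hrow hpos hπ.2 hp hq hn α,
    fun p q hp hq hne α hα0 hα => ?_, fun p q hp hpq hq α hα0 hα => ⟨fun δ hδ => ?_, ?_⟩⟩
  · rcases lt_or_ge q p with hpq | hpq
    · exact RenyiSobolev.tendsto_renyiSobolev_of_lt hsymm hoff hrow hpos hπ.2 hq hpq hα0 hα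
    · rcases hq.eq_or_lt with rfl | hq
      · exact RenyiSobolev.tendsto_renyiSobolev_of_eq_one hsymm hoff hrow hpos hπ.2
          (hp.lt_of_ne fun h => hne ⟨h.symm, rfl⟩) hpq hα
      · exact RenyiSobolev.tendsto_renyiSobolev_of_one_lt hsymm hoff hrow hpos hπ.2 hp hq hpq hα
  · obtain ⟨Q, hQ, R, hR, t, ht, h1, h2⟩ :=
      RenyiSobolev.exists_extremal_mix hsymm hoff hrow hpos hq hα hδ
    obtain ⟨ε₀, hε₀, h3⟩ := RenyiSobolev.eventually_ent₂_extremal_ge hpos hp hpq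
      (by linarith) hQ hR ht h1
    exact ⟨Q, hQ, R, hR, t, ht, ε₀, hε₀, fun ε hε hε' => ⟨h3 ε hε hε', _, h2,
      RenyiSobolev.tendsto_energy_extremal hsymm hoff hrow hpos hπ.2 hq hQ hR ht hε⟩⟩
  · obtain ⟨Q, hQ, R, hR, t, ht, h1, h2⟩ :=
      RenyiSobolev.exists_mix_eq hsymm hoff hrow hpos hq hα
    refine ⟨Q, hQ, R, hR, t, ht, fun δ hδ => ?_⟩
    obtain ⟨ε₀, hε₀, h3⟩ := RenyiSobolev.eventually_ent₂_extremal_ge hpos hp hpq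
      (by linarith) hQ hR ht (β := α - δ) (by linarith)
    refine ⟨ε₀, hε₀, fun ε hε hε' => ⟨h3 ε hε hε', ?_⟩⟩
    rw [h2]
    exact RenyiSobolev.tendsto_energy_extremal hsymm hoff hrow hpos hπ.2 hq hQ hR ht hε
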